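/- **Setting.** Let $\Omega\subset\mathbb R^3$ be a bounded polyhedral domain, partitioned by a finite mesh $\mathcal T_h$ into closed convex polytopes $K$ with non-empty, pairwise disjoint interiors; $\Omega_h=\bigcup_{K}K$ and $\Omega$ is the interior of $\Omega_h$. For $k\ge 0$ let $P_k(K)$ be the polynomials of degree at most $k$ on $K$, and put $$Q_{k}=\{f\in H^1(\Omega): f|_K\in P_k(K)\ \forall K\},\qquad N_k=\{f\in H(\mathrm{curl},\Omega): f|_K\in P_k(K)^3+x\times P_k(K)^3\ \forall K\},$$ $$RT_k=\{f\in H(\mathrm{div},\Omega): f|_K\in P_k(K)^3+x\,P_k(K)\ \forall K\}.$$ Functions in $Q_k$ are identified with their continuous representatives; at points of several cells, a field in $N_k$ or $RT_k$ takes the value of one of these cells, chosen once and for all in an arbitrary way. $\mathring Q_k,\mathring N_k,\mathring{RT}_k$ are the subspaces with, respectively, $f=0$, $n\times f=0$, $n\cdot f=0$ on $\partial\Omega$ (in the sense of Green's formula). A bar denotes the $L^2(\Omega)$-projection onto $Q_{k+1}$ (componentwise for vectors), and $\nabla_w\cdot f\in\mathring Q_{k+1}$ is defined by $\int_\Omega(\nabla_w\cdot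 f)\,\phi_h\,dx=-\int_\Omega f\cdot\nabla\phi_h\,dx$ for all $\phi_h\in\mathring Q_{k+1}$. Let $m,c>0$, $e\in\mathbb R$, $\gamma(u)=\sqrt{1+\frac{u\cdot u}{m^2c^2}}$, and let $w_1,\dots,w_N\in\mathbb R$ be constant particle weights. **Scheme.** Let $T\ge 0$ and let $\rho_h(t)\in Q_{k+1}$, $M_h(t)\in Q_{k+1}^3$, $E_h(t)\in\mathring N_k$, $B_h(t)\in\mathring{RT}_k$, $X_p(t)\in\Omega_h$, $U_p(t)\in\mathbb R^3$ ($1\le p\le N$, $t\in[0,T]$) be absolutely continuous in time, with $\rho_h(x,t)\neq0$ for all $x\in\Omega_h$ and $t\in[0,T]$. Write $$\mathbf w_h=\overline{\frac{M_h}{\rho_h\,\gamma(mM_h/\rho_h)}},\qquad \eta_h=\overline{\gamma(mM_h/\rho_h)-1-\frac{M_h\cdot M_h}{\rho_h^2c^2\gamma(mM_h/\rho_h)}}.$$ Suppose that for almost every $t\in[0,T]$ $$\int_\Omega\partial_t\rho_h\,\phi_h\,dx=\int_\Omega\rho_h\,\mathbf w_h\cdot\nabla\phi_h\,dx\qquad\forall\phi_h\in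 Q_{k+1},$$ $$\int_\Omega\partial_tM_h\cdot\mu_h\,dx=\int_\Omega(\mathbf w_h\cdot\nabla\mu_h-\mu_h\cdot\nabla\mathbf w_h)\cdot M_h\,dx-\int_\Omega\rho_h\,\mu_h\cdot\nabla\eta_h\,c^2\,dx+\frac em\int_\Omega\rho_h\Big(E_h+\mathbf w_h\times\frac{B_h}{c}\Big)\cdot\mu_h\,dx\qquad\forall\mu_h\in Q_{k+1}^3,$$ $$\int_\Omega\partial_tE_h\cdot\nu_h\,dx=c\int_\Omega B_h\cdot(\nabla\times\nu_h)\,dx-\frac{4\pi e}{m}\int_\Omega\rho_h\mathbf w_h\cdot\nu_h\,dx-\frac{4\pi e}{m}\sum_{p=1}^N\frac{w_pU_p}{\gamma(U_p)}\cdot\nu_h(X_p)\qquad\forall\nu_h\in\mathring N_k,$$ $$\int_\Omega\partial_tB_h\cdot\tau_h\,dx=-c\int_\Omega\tau_h\cdot(\nabla\times E_h)\,dx\qquad\forall\tau_h\in\mathring{RT}_k,$$ $$\partial_tX_p=\frac{U_p}{m\gamma(U_p)},\qquad \partial_tU_p=e\Big(E_h(X_p,t)+\frac{U_p\times B_h(X_p,t)}{c\,m\,\gamma(U_p)}\Big),\qquad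 1\le p\le N.$$ **Proposition.** The following quantities have, at every $t\in[0,T]$, the same value as at time $0$: 1. the total fluid mass $\int_{\Omega_h}\rho_h\,dx$; 2. the total particle mass $\int_{\Omega_h}\sum_pw_p\,\delta(x-X_p)\,dx$, which equals $\sum_{p=1}^Nw_p$; 3. the total energy $\displaystyle\int_{\Omega_h}\rho_h\big(\gamma(mM_h/\rho_h)-1\big)c^2\,dx+\sum_{p=1}^Nw_p(\gamma(U_p)-1)mc^2+\frac1{8\pi}\int_{\Omega_h}(E_h\cdot E_h+B_h\cdot B_h)\,dx$; 4. for every $\phi_h\in\mathring Q_{k+1}$, the weak Gauss law $\displaystyle\int_{\Omega_h}\Big[\nabla_w\cdot E_h-4\pi e\Big(\frac{\rho_h}{m}+\sum_{p=1}^Nw_p\,\delta(x-X_p)\Big)\Big]\phi_h\,dx$, where $\int_{\Omega_h}\delta(x-X_p)\phi_h\,dx=\phi_h(X_p)$; 5. the divergence $\nabla\cdot B_h$ (as an element of $L^2(\Omega)$); in particular the constraint $\nabla\cdot B_h=0$ is preserved. -/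

import Mathlib

open MeasureTheory Set
open scoped ContDiff Matrix

namespace ColdPlasma

/-- Vectors of `ℝ³`; inner products are written with `⬝ᵥ`, cross products with `⨯₃`. -/
abbrev Vec : Type := Fin 3 → ℝ

noncomputable section

/-! ### Classical differential operators, applied to smooth test functions -/

/-- The partial derivative `∂ⱼ f`. -/
def pderiv (j : Fin 3) (f : Vec → ℝ) (x : Vec) : ℝ := fderiv ℝ f x (Pi.single j 1)

def gradC (ψ : Vec → ℝ) (x : Vec) : Vec := fun j => pderiv j ψ x

def divC (ψ : Vec → Vec) (x : Vec) : ℝ := ∑ j, pderiv j (fun y => ψ y j) x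

def curlC (ψ : Vec → Vec) (x : Vec) : Vec :=
  ![pderiv 1 (fun y => ψ y 2) x - pderiv 2 (fun y => ψ y 1) x,
    pderiv 2 (fun y => ψ y 0) x - pderiv 0 (fun y => ψ y 2) x,
    pderiv 0 (fun y => ψ y 1) x - pderiv 1 (fun y => ψ y 0) x]

/-! ### Weak derivatives and Sobolev spaces on an open set `Ω` -/

/-- `C_c^∞(Ω; F)`. -/
def IsTest {F : Type*} [NormedAddCommGroup F] [NormedSpace ℝ F] (Ω : Set Vec) (ψ : Vec → F) :
    Prop :=
  ContDiff ℝ ∞ ψ ∧ HasCompactSupport ψ ∧ tsupport ψ ⊆ Ω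

/-- `f ∈ L²(Ω; F)`. -/
def MemL2 {F : Type*} [NormedAddCommGroup F] (Ω : Set Vec) (f : Vec → F) : Prop :=
  MemLp f 2 (volume.restrict Ω)

/-- `g ∈ L²(Ω)³` is the weak gradient of `f` on `Ω`. -/
def IsWeakGrad (Ω : Set Vec) (f : Vec → ℝ) (g : Vec → Vec) : Prop :=
  MemL2 Ω g ∧ ∀ ψ : Vec → Vec, IsTest Ω ψ →
    ∫ x in Ω, f x * divC ψ x = -∫ x in Ω, g x ⬝ᵥ ψ x

/-- `g ∈ L²(Ω)³` is the weak curl of `f` on `Ω`. -/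
def IsWeakCurl (Ω : Set Vec) (f g : Vec → Vec) : Prop :=
  MemL2 Ω g ∧ ∀ ψ : Vec → Vec, IsTest Ω ψ →
    ∫ x in Ω, f x ⬝ᵥ curlC ψ x = ∫ x in Ω, g x ⬝ᵥ ψ x

/-- `g ∈ L²(Ω)` is the weak divergence of `f` on `Ω`. -/
def IsWeakDiv (Ω : Set Vec) (f : Vec → Vec) (g : Vec → ℝ) : Prop :=
  MemL2 Ω g ∧ ∀ ψ : Vec → ℝ, IsTest Ω ψ →
    ∫ x in Ω, f x ⬝ᵥ gradC ψ x = -∫ x in Ω, g x * ψ x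

/-- The weak gradient (unique up to null sets when it exists). -/
def grad (Ω : Set Vec) (f : Vec → ℝ) : Vec → Vec := Classical.epsilon (IsWeakGrad Ω f)

/-- The weak curl (unique up to null sets when it exists). -/
def curl (Ω : Set Vec) (f : Vec → Vec) : Vec → Vec := Classical.epsilon (IsWeakCurl Ω f)

/-- The weak divergence (unique up to null sets when it exists). -/
def dvg (Ω : Set Vec) (f : Vec → Vec) : Vec → ℝ := Classical.epsilon (IsWeakDiv Ω f)

/-- `H¹(Ω)`. -/
def H1 (Ω : Set Vec) : Set (Vec → ℝ) := {f | MemL2 Ω f ∧ ∃ g, IsWeakGrad Ω f g}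

/-- `H(curl, Ω)`. -/
def Hcurl (Ω : Set Vec) : Set (Vec → Vec) := {f | MemL2 Ω f ∧ ∃ g, IsWeakCurl Ω f g}

/-- `H(div, Ω)`. -/
def Hdiv (Ω : Set Vec) : Set (Vec → Vec) := {f | MemL2 Ω f ∧ ∃ g, IsWeakDiv Ω f g}

/-- `H¹(Ω)` with `f = 0` on `∂Ω`: the boundary term `∫_{∂Ω} f (ψ · n)` of Green's formula vanishes
for all `ψ` smooth up to the boundary (restrictions to `Ω` of `C_c^∞(ℝ³; ℝ³)`). -/
def H1₀ (Ω : Set Vec) : Set (Vec → ℝ) :=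
  {f | f ∈ H1 Ω ∧ ∀ ψ : Vec → Vec, IsTest univ ψ →
    ∫ x in Ω, f x * divC ψ x = -∫ x in Ω, grad Ω f x ⬝ᵥ ψ x}

/-- `H(curl, Ω)` with `n × f = 0` on `∂Ω`: the boundary term `∫_{∂Ω} (n × f) · ψ` of Green's
formula vanishes for all `ψ` smooth up to the boundary. -/
def Hcurl₀ (Ω : Set Vec) : Set (Vec → Vec) :=
  {f | f ∈ Hcurl Ω ∧ ∀ ψ : Vec → Vec, IsTest univ ψ →
    ∫ x in Ω, f x ⬝ᵥ curlC ψ x = ∫ x in Ω, curl Ω f x ⬝ᵥ ψ x}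

/-- `H(div, Ω)` with `n · f = 0` on `∂Ω`: the boundary term `∫_{∂Ω} (n · f) ψ` of Green's
formula vanishes for all `ψ` smooth up to the boundary. -/
def Hdiv₀ (Ω : Set Vec) : Set (Vec → Vec) :=
  {f | f ∈ Hdiv Ω ∧ ∀ ψ : Vec → ℝ, IsTest univ ψ →
    ∫ x in Ω, f x ⬝ᵥ gradC ψ x = -∫ x in Ω, dvg Ω f x * ψ x}

/-! ### Meshes and finite element spaces -/

/-- A finite partition of a polyhedral domain into closed convex polytopes with non-empty,
pairwise disjoint interiors (for instance a tetrahedral mesh). Points that lie in several closed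
cells are attributed by `cellOf` to one of them, in an arbitrary way: this fixes the point values
of the fields that may jump across faces. -/
structure Mesh (ι : Type*) [Fintype ι] where
  /-- The vertices of a cell. -/
  verts : ι → Finset Vec
  interior_nonempty : ∀ i, (interior (convexHull ℝ (verts i : Set Vec))).Nonempty
  disjoint_interior : ∀ i j, i ≠ j →
    Disjoint (interior (convexHull ℝ (verts i : Set Vec)))
      (interior (convexHull ℝ (verts j : Set Vec)))
  /-- The cell from which the value at a point is taken. -/
  cellOf : Vec → ι
  mem_cellOf : ∀ i, ∀ x ∈ convexHull ℝ (verts i : Set Vec),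
    x ∈ convexHull ℝ (verts (cellOf x) : Set Vec)

namespace Mesh

variable {ι : Type*} [Fintype ι] (𝒯 : Mesh ι)

/-- The closed cell `K`. -/
def cell (i : ι) : Set Vec := convexHull ℝ (𝒯.verts i : Set Vec)

/-- `Ω_h`, the union of all closed cells. -/
def Ωh : Set Vec := ⋃ i, 𝒯.cell i

/-- The open domain `Ω`; it differs from `Ω_h` by the null set `∂Ω`. -/
def Ω : Set Vec := interior 𝒯.Ωh

end Mesh

/-- Polynomials of degree at most `k` in three variables. -/
def PolyLE (k : ℕ) : Set (MvPolynomial (Fin 3) ℝ) := {p | p.totalDegree ≤ k}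

/-- The vector field with polynomial components `p 0, p 1, p 2`. -/
def evalVec (p : Fin 3 → MvPolynomial (Fin 3) ℝ) (x : Vec) : Vec :=
  fun i => MvPolynomial.eval x (p i)

section Spaces

variable {ι : Type*} [Fintype ι] (𝒯 : Mesh ι)

/-- `Q_k = {f ∈ H¹(Ω) : f|_K ∈ P_k(K) for all closed cells K}`. All discrete functions are
functions on `Ω_h`, extended by zero to `ℝ³`. -/
def Q (k : ℕ) : Set (Vec → ℝ) :=
  {f | f ∈ H1 𝒯.Ω ∧ Function.support f ⊆ 𝒯.Ωh ∧
    ∀ i, ∃ p ∈ PolyLE k, ∀ x ∈ 𝒯.cell i, f x = MvPolynomial.eval x p}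

/-- `N_k = {f ∈ H(curl, Ω) : f|_K ∈ P_k(K)³ + x × P_k(K)³ for all K}`. -/
def Ned (k : ℕ) : Set (Vec → Vec) :=
  {f | f ∈ Hcurl 𝒯.Ω ∧ Function.support f ⊆ 𝒯.Ωh ∧
    ∀ i, ∃ p q : Fin 3 → MvPolynomial (Fin 3) ℝ, (∀ j, p j ∈ PolyLE k) ∧ (∀ j, q j ∈ PolyLE k) ∧
      ∀ x ∈ 𝒯.cell i, 𝒯.cellOf x = i → f x = evalVec p x + x ⨯₃ evalVec q x}

/-- `RT_k = {f ∈ H(div, Ω) : f|_K ∈ P_k(K)³ + x P_k(K) for all K}`. -/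
def RT (k : ℕ) : Set (Vec → Vec) :=
  {f | f ∈ Hdiv 𝒯.Ω ∧ Function.support f ⊆ 𝒯.Ωh ∧
    ∀ i, ∃ (p : Fin 3 → MvPolynomial (Fin 3) ℝ) (q : MvPolynomial (Fin 3) ℝ),
      (∀ j, p j ∈ PolyLE k) ∧ q ∈ PolyLE k ∧
      ∀ x ∈ 𝒯.cell i, 𝒯.cellOf x = i → f x = evalVec p x + MvPolynomial.eval x q • x}

/-- `Q_k` with `f = 0` on `∂Ω`. -/
def Q₀ (k : ℕ) : Set (Vec → ℝ) := Q 𝒯 k ∩ H1₀ 𝒯.Ω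

/-- `N_k` with `n × f = 0` on `∂Ω`. -/
def Ned₀ (k : ℕ) : Set (Vec → Vec) := Ned 𝒯 k ∩ Hcurl₀ 𝒯.Ω

/-- `RT_k` with `n · f = 0` on `∂Ω`. -/
def RT₀ (k : ℕ) : Set (Vec → Vec) := RT 𝒯 k ∩ Hdiv₀ 𝒯.Ω

/-- The `L²(Ω)`-representative in the finite element space `W` of a linear functional `ℓ` on `W`:
the `d ∈ W` with `∫_Ω d φ = ℓ φ` for all `φ ∈ W`. -/
def l2Rep (W : Set (Vec → ℝ)) (ℓ : (Vec → ℝ) → ℝ) : Vec → ℝ :=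
  Classical.epsilon fun d => d ∈ W ∧ ∀ φ ∈ W, ∫ x in 𝒯.Ω, d x * φ x = ℓ φ

/-- The `L²(Ω)`-projection of `g` onto `Q_k`. -/
def projQ (k : ℕ) (g : Vec → ℝ) : Vec → ℝ :=
  l2Rep 𝒯 (Q 𝒯 k) fun φ => ∫ x in 𝒯.Ω, g x * φ x

/-- The `L²(Ω)³`-projection of a vector field onto `Q_k³`. -/
def projQ3 (k : ℕ) (g : Vec → Vec) : Vec → Vec :=
  fun x i => projQ 𝒯 k (fun y => g y i) x

/-- The weak divergence operator `∇_w ·`, from fields to `Q₀_k`: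
`∫_Ω (∇_w · f) φ = -∫_Ω f · ∇φ` for all `φ ∈ Q₀_k`. -/
def divW (k : ℕ) (f : Vec → Vec) : Vec → ℝ :=
  l2Rep 𝒯 (Q₀ 𝒯 k) fun φ => -∫ x in 𝒯.Ω, f x ⬝ᵥ grad 𝒯.Ω φ x

end Spaces

/-! ### The semi-discrete scheme -/

/-- The relativistic factor `γ(u) = √(1 + u · u / (m² c²))`. -/
def gam (m c : ℝ) (u : Vec) : ℝ := √(1 + (u ⬝ᵥ u) / (m ^ 2 * c ^ 2))

/-- `γ(m M / ρ)`. -/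
def fluidGam (m c r : ℝ) (M : Vec) : ℝ := gam m c ((m / r) • M)

/-- `M / (ρ γ(m M / ρ))`. -/
def fluidVel (m c r : ℝ) (M : Vec) : Vec := (r * fluidGam m c r M)⁻¹ • M

/-- `γ(m M / ρ) - 1 - M · M / (ρ² c² γ(m M / ρ))`. -/
def fluidPot (m c r : ℝ) (M : Vec) : ℝ :=
  fluidGam m c r M - 1 - (M ⬝ᵥ M) / (r ^ 2 * c ^ 2 * fluidGam m c r M)

/-- `a · ∇f`, that is `(a · ∇f)_i = ∑ⱼ aⱼ ∂ⱼ f_i`. -/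
def advect (Ω : Set Vec) (a f : Vec → Vec) (x : Vec) : Vec :=
  fun i => a x ⬝ᵥ grad Ω (fun y => f y i) x

/-- `(ρ, M, E, B, X, U)` solves the flux-free semi-discrete scheme of order `k` on `[0, T]`, for
`N` particles of weights `wt`. All unknowns are absolutely continuous in time and the evolution
equations hold at almost every time. -/
structure IsSolution {ι : Type*} [Fintype ι] (𝒯 : Mesh ι) (k N : ℕ) (m c e : ℝ)
    (wt : Fin N → ℝ) (T : ℝ) (ρ : ℝ → Vec → ℝ) (M E B : ℝ → Vec → Vec)
    (X U : ℝ → Fin N → Vec) : Prop where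
  rho_mem : ∀ t ∈ Icc 0 T, ρ t ∈ Q 𝒯 (k + 1)
  mom_mem : ∀ t ∈ Icc 0 T, ∀ i, (fun x => M t x i) ∈ Q 𝒯 (k + 1)
  elec_mem : ∀ t ∈ Icc 0 T, E t ∈ Ned₀ 𝒯 k
  mag_mem : ∀ t ∈ Icc 0 T, B t ∈ RT₀ 𝒯 k
  /-- The particles are in the domain. -/
  pos_mem : ∀ t ∈ Icc 0 T, ∀ p, X t p ∈ 𝒯.Ωh
  rho_ac : ∀ x, AbsolutelyContinuousOnInterval (fun t => ρ t x) 0 T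
  mom_ac : ∀ x, AbsolutelyContinuousOnInterval (fun t => M t x) 0 T
  elec_ac : ∀ x, AbsolutelyContinuousOnInterval (fun t => E t x) 0 T
  mag_ac : ∀ x, AbsolutelyContinuousOnInterval (fun t => B t x) 0 T
  pos_ac : ∀ p, AbsolutelyContinuousOnInterval (fun t => X t p) 0 T
  vel_ac : ∀ p, AbsolutelyContinuousOnInterval (fun t => U t p) 0 T
  /-- The continuity equation. -/
  density_eq : ∀ᵐ t ∂(volume.restrict (Icc 0 T)),
    let w := projQ3 𝒯 (k + 1) (fun x => fluidVel m c (ρ t x) (M t x))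
    ∀ φ ∈ Q 𝒯 (k + 1),
      ∫ x in 𝒯.Ω, deriv (fun s => ρ s x) t * φ x
        = ∫ x in 𝒯.Ω, ρ t x * (w x ⬝ᵥ grad 𝒯.Ω φ x)
  /-- The momentum equation. -/
  momentum_eq : ∀ᵐ t ∂(volume.restrict (Icc 0 T)),
    let w := projQ3 𝒯 (k + 1) (fun x => fluidVel m c (ρ t x) (M t x))
    let η := projQ 𝒯 (k + 1) (fun x => fluidPot m c (ρ t x) (M t x))
    ∀ μ : Vec → Vec, (∀ i, (fun x => μ x i) ∈ Q 𝒯 (k + 1)) →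
      ∫ x in 𝒯.Ω, deriv (fun s => M s x) t ⬝ᵥ μ x
        = (∫ x in 𝒯.Ω, (advect 𝒯.Ω w μ x - advect 𝒯.Ω μ w x) ⬝ᵥ M t x)
          - (∫ x in 𝒯.Ω, ρ t x * (μ x ⬝ᵥ grad 𝒯.Ω η x) * c ^ 2)
          + e / m * ∫ x in 𝒯.Ω, ρ t x * ((E t x + w x ⨯₃ (c⁻¹ • B t x)) ⬝ᵥ μ x)
  /-- Ampère's equation. -/
  ampere_eq : ∀ᵐ t ∂(volume.restrict (Icc 0 T)),
    let w := projQ3 𝒯 (k + 1) (fun x => fluidVel m c (ρ t x) (M t x))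
    ∀ ν ∈ Ned₀ 𝒯 k,
      ∫ x in 𝒯.Ω, deriv (fun s => E s x) t ⬝ᵥ ν x
        = (c * ∫ x in 𝒯.Ω, B t x ⬝ᵥ curl 𝒯.Ω ν x)
          - 4 * Real.pi * e / m * (∫ x in 𝒯.Ω, ρ t x * (w x ⬝ᵥ ν x))
          - 4 * Real.pi * e / m * ∑ p, (wt p / gam m c (U t p)) * (U t p ⬝ᵥ ν (X t p))
  /-- Faraday's equation. -/
  faraday_eq : ∀ᵐ t ∂(volume.restrict (Icc 0 T)), ∀ τ ∈ RT₀ 𝒯 k,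
      ∫ x in 𝒯.Ω, deriv (fun s => B s x) t ⬝ᵥ τ x
        = -(c * ∫ x in 𝒯.Ω, τ x ⬝ᵥ curl 𝒯.Ω (E t) x)
  /-- The equation of the particle positions. -/
  position_eq : ∀ᵐ t ∂(volume.restrict (Icc 0 T)), ∀ p,
    HasDerivAt (fun s => X s p) ((m * gam m c (U t p))⁻¹ • U t p) t
  /-- The equation of the particle momenta. -/
  velocity_eq : ∀ᵐ t ∂(volume.restrict (Icc 0 T)), ∀ p,
    HasDerivAt (fun s => U s p)
      (e • (E t (X t p) + (c * m * gam m c (U t p))⁻¹ • (U t p ⨯₃ B t (X t p)))) t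

/-! ### The invariants -/

section Invariants

variable {ι : Type*} [Fintype ι] (𝒯 : Mesh ι)

/-- The total fluid mass `∫_{Ω_h} ρ`. -/
def fluidMass (ρ : Vec → ℝ) : ℝ := ∫ x in 𝒯.Ωh, ρ x

/-- The total particle mass in `Ω_h`: the mass that the measure `∑ wₚ δ_{Xₚ}` gives to `Ω_h`. -/
def particleMass {N : ℕ} (wt : Fin N → ℝ) (X : Fin N → Vec) : ℝ :=
  ∑ p, wt p * (Measure.dirac (X p)).real 𝒯.Ωh

/-- The total energy. -/
def energy (m c : ℝ) {N : ℕ} (wt : Fin N → ℝ) (ρ : Vec → ℝ) (M E B : Vec → Vec)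
    (U : Fin N → Vec) : ℝ :=
  (∫ x in 𝒯.Ωh, ρ x * (fluidGam m c (ρ x) (M x) - 1) * c ^ 2)
    + (∑ p, wt p * (gam m c (U p) - 1) * m * c ^ 2)
    + 1 / (8 * Real.pi) * ∫ x in 𝒯.Ωh, (E x ⬝ᵥ E x + B x ⬝ᵥ B x)

/-- `∫_{Ω_h} [∇_w · E - 4πe (ρ/m + ∑ wₚ δ(x - Xₚ))] φ dx`, with `∇_w ·` valued in `Q₀_k`. -/
def gauss (k : ℕ) (m e : ℝ) {N : ℕ} (wt : Fin N → ℝ) (ρ : Vec → ℝ) (E : Vec → Vec)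
    (X : Fin N → Vec) (φ : Vec → ℝ) : ℝ :=
  (∫ x in 𝒯.Ωh, (divW 𝒯 k E x - 4 * Real.pi * e * (ρ x / m)) * φ x)
    - 4 * Real.pi * e * ∑ p, wt p * φ (X p)

end Invariants

end

end ColdPlasma

/-! Every discrete unknown lives in a finite-dimensional space of piecewise polynomials. Absolute
continuity in time at each point therefore passes to every linear functional. At almost every time
there is a time derivative belonging to the same space, and it may be integrated or used as a test
function. Apart from the particle mass, each claim reduces to absolutely continuous functions of
time whose derivative vanishes almost everywhere; such functions are constant.

Masses: the constant function on `Ωh` is an admissible test function for the continuity equation and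
its weak gradient is zero. The particles stay in `Ωh`, so each Dirac measure gives it mass one.

Energy: the partial derivatives of the fluid energy density in `ρ` and `M` are `c ^ 2 * fluidPot`
and `fluidVel` (`hasDerivAt_fluidEnergy`). Since the time derivatives of `ρ` and `M` lie in the
finite element space, these may be replaced by their projections `η` and `w` (`fluidEnergy_family`).
Now `η`, `w`, `E`, `B` are inserted as test functions in the continuity, momentum, Ampère and
Faraday equations. The advection bracket vanishes, the magnetic force does no work, and the
pressure-like, electric work and curl terms cancel in pairs.

Gauss law: gradients of `Q₀` functions are curl-free elements of `Ned₀` (`piecewiseGrad_mem_Ned₀`),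
so Ampère's equation can be tested with `∇φ`. The fluid current is matched by the continuity
equation tested with `φ`, the particle current by the chain rule for `φ (X t)`. The delicate point
is that `∇φ` jumps across faces, where a particle may spend a set of times of positive measure. At
almost every such time, however, the cells containing the particle all give the same derivative
along the trajectory (`ae_deriv_eq_of_eqOn`, `ae_hasDerivAt_along_curve`).

Divergence: the curl of a field in `Ned₀` is almost everywhere a divergence-free element of `RT₀`
(`exists_curl_mem_RT₀`). Faraday's equation then holds almost everywhere in space, and not merely
against test functions, which gives the claim. -/

namespace ColdPlasma

noncomputable section

/-! ### Absolutely continuous functions of time -/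

section Time

open Filter Topology

variable {a b : ℝ}

/-- Absolute continuity is a limit of sums of increments over small families of intervals, so
domination of increments passes to it by squeezing. This is how absolute continuity is transferred
through nonlinear quantities such as `gam` and the fluid energy. -/
theorem ac_of_dist_le {σ X Y : Type*} [Fintype σ] [PseudoMetricSpace X] [PseudoMetricSpace Y]
    {f : ℝ → Y} {g : σ → ℝ → X} (hg : ∀ j, AbsolutelyContinuousOnInterval (g j) a b) (C : ℝ)
    (h : ∀ s ∈ uIcc a b, ∀ t ∈ uIcc a b, dist (f s) (f t) ≤ C * ∑ j, dist (g j s) (g j t)) :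
    AbsolutelyContinuousOnInterval f a b := by
  have hlim := (tendsto_finsetSum (Finset.univ : Finset σ) fun j _ => hg j).const_mul C
  simp only [Finset.sum_const_zero, mul_zero] at hlim
  refine squeeze_zero' ?_ ?_ hlim
  · exact Eventually.of_forall fun _ => Finset.sum_nonneg fun _ _ => dist_nonneg
  · rw [eventually_inf_principal]
    refine Eventually.of_forall fun I hI => ?_
    rw [Finset.sum_comm, Finset.mul_sum]
    exact Finset.sum_le_sum fun i hi => h _ (hI.1 i hi).1 _ (hI.1 i hi).2

theorem ac_congr {X : Type*} [PseudoMetricSpace X] {f g : ℝ → X}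
    (hg : AbsolutelyContinuousOnInterval g a b) (h : ∀ t ∈ uIcc a b, f t = g t) :
    AbsolutelyContinuousOnInterval f a b :=
  ac_of_dist_le (σ := Unit) (g := fun _ => g) (fun _ => hg) 1 fun s hs t ht => by
    simp [h s hs, h t ht]

theorem ac_apply {f : ℝ → Vec} (hf : AbsolutelyContinuousOnInterval f a b) (i : Fin 3) :
    AbsolutelyContinuousOnInterval (fun t => f t i) a b :=
  ac_of_dist_le (σ := Unit) (g := fun _ => f) (fun _ => hf) 1 fun s _ t _ => by
    simpa using dist_le_pi_dist (f s) (f t) i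

theorem ac_const {X : Type*} [PseudoMetricSpace X] (c : X) :
    AbsolutelyContinuousOnInterval (fun _ => c) a b :=
  ac_of_dist_le (σ := Empty) (g := fun _ _ => (0 : ℝ)) (fun j => j.elim) 0 (by simp)

theorem ac_sum {σ : Type*} (s : Finset σ) {f : σ → ℝ → ℝ}
    (hf : ∀ j ∈ s, AbsolutelyContinuousOnInterval (f j) a b) :
    AbsolutelyContinuousOnInterval (fun t => ∑ j ∈ s, f j t) a b := by
  classical
  induction s using Finset.induction_on with
  | empty => simpa using ac_const (0 : ℝ)
  | insert j s hj ih =>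
    simp only [Finset.sum_insert hj]
    exact (hf j (Finset.mem_insert_self j s)).fun_add
      (ih fun i hi => hf i (Finset.mem_insert_of_mem hi))

/-! ### Curves in a finite-dimensional space, seen through linear functionals. -/

section Coordinates

variable {V κ : Type*} [AddCommGroup V] [Module ℝ V] [FiniteDimensional ℝ V]

/-- In finite dimension, functionals with trivial common kernel span the dual, so `L` is a finite
combination of the `e j`. The index type may be infinite; in the application it runs over point
evaluations. -/
theorem ac_linear_of_separating (e : κ → V →ₗ[ℝ] ℝ) (he : ∀ v, (∀ j, e j v = 0) → v = 0)
    {u : ℝ → V} (hu : ∀ j, AbsolutelyContinuousOnInterval (fun t => e j (u t)) a b)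
    (L : V →ₗ[ℝ] ℝ) : AbsolutelyContinuousOnInterval (fun t => L (u t)) a b := by
  have htop : Submodule.span ℝ (range e) = ⊤ := by
    have h := Subspace.dualCoannihilator_dualAnnihilator_eq (W := Submodule.span ℝ (range e))
    have hbot : (Submodule.span ℝ (range e)).dualCoannihilator = ⊥ := by
      rw [eq_bot_iff]
      intro v hv
      rw [Submodule.mem_dualCoannihilator] at hv
      exact (Submodule.mem_bot ℝ).2 (he v fun j => hv _ (Submodule.subset_span ⟨j, rfl⟩))
    rw [← h, hbot, Submodule.dualAnnihilator_bot]
  have hL : L ∈ Submodule.span ℝ (range e) := htop ▸ Submodule.mem_top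
  induction hL using Submodule.span_induction with
  | mem x hx => obtain ⟨j, rfl⟩ := hx; exact hu j
  | zero => simpa using ac_const (0 : ℝ)
  | add x y _ _ hx hy => simpa using hx.fun_add hy
  | smul c x _ hx => simpa using hx.const_mul c

theorem linear_eq_sum (L : V →ₗ[ℝ] ℝ) (v : V) :
    L v = ∑ i, (Module.finBasis ℝ V).coord i v * L (Module.finBasis ℝ V i) := by
  conv_lhs => rw [← (Module.finBasis ℝ V).sum_repr v]
  simp only [map_sum, map_smul, smul_eq_mul]
  rfl

/-- The finitely many coordinates share one null set, and it serves all functionals at once. The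
derivative is an element of `V`, which is what makes time derivatives available as test functions.
-/
theorem ae_hasDerivAt_linear {u : ℝ → V}
    (hu : ∀ L : V →ₗ[ℝ] ℝ, AbsolutelyContinuousOnInterval (fun t => L (u t)) a b) :
    ∀ᵐ t, t ∈ uIcc a b → ∃ v : V, ∀ L : V →ₗ[ℝ] ℝ, HasDerivAt (fun s => L (u s)) (L v) t := by
  have h : ∀ᵐ t, ∀ i, t ∈ uIcc a b →
      DifferentiableAt ℝ (fun s => (Module.finBasis ℝ V).coord i (u s)) t :=
    ae_all_iff.2 fun i => (hu _).ae_differentiableAt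
  filter_upwards [h] with t ht hmem
  refine ⟨∑ i, deriv (fun s => (Module.finBasis ℝ V).coord i (u s)) t • Module.finBasis ℝ V i,
    fun L => ?_⟩
  have hd := HasDerivAt.fun_sum (u := Finset.univ) fun i _ =>
    ((ht i hmem).hasDerivAt).mul_const (L (Module.finBasis ℝ V i))
  simp only [map_sum, map_smul, smul_eq_mul]
  exact hd.congr_of_eventuallyEq (Eventually.of_forall fun s => linear_eq_sum L (u s))

theorem bilinear_eq_sum (β : V →ₗ[ℝ] V →ₗ[ℝ] ℝ) (v w : V) :
    β v w = ∑ i, (Module.finBasis ℝ V).coord i v * β (Module.finBasis ℝ V i) w := by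
  simpa using linear_eq_sum (β.flip w) v

theorem ac_bilinear {u : ℝ → V}
    (hu : ∀ L : V →ₗ[ℝ] ℝ, AbsolutelyContinuousOnInterval (fun t => L (u t)) a b)
    (β : V →ₗ[ℝ] V →ₗ[ℝ] ℝ) :
    AbsolutelyContinuousOnInterval (fun t => β (u t) (u t)) a b := by
  have h := ac_sum (a := a) (b := b) Finset.univ
    (f := fun i t => (Module.finBasis ℝ V).coord i (u t) * β (Module.finBasis ℝ V i) (u t))
    fun i _ => (hu _).fun_mul (hu _)
  exact ac_congr h fun t _ => bilinear_eq_sum β _ _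

theorem hasDerivAt_bilinear {u : ℝ → V} {v : V} {t : ℝ}
    (hv : ∀ L : V →ₗ[ℝ] ℝ, HasDerivAt (fun s => L (u s)) (L v) t) (β : V →ₗ[ℝ] V →ₗ[ℝ] ℝ) :
    HasDerivAt (fun s => β (u s) (u s)) (β v (u t) + β (u t) v) t := by
  have h := HasDerivAt.fun_sum (u := Finset.univ) fun i _ =>
    (hv ((Module.finBasis ℝ V).coord i)).fun_mul (hv (β (Module.finBasis ℝ V i)))
  rw [bilinear_eq_sum β v, bilinear_eq_sum β (u t) v, ← Finset.sum_add_distrib]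
  exact h.congr_of_eventuallyEq (Eventually.of_forall fun s => bilinear_eq_sum β _ _)

end Coordinates

/-- Induction on the number of sets: jump from `a` to the last time spent in a set containing `a`;
that set is not needed afterwards. In this way a trajectory that changes cells infinitely often
still inherits the Lipschitz bound of the single cells. -/
theorem dist_le_of_finite_closed_cover {σ : Type*} (F : Finset σ) {τ : σ → Set ℝ} {g : ℝ → ℝ}
    {L : ℝ} (hab : a ≤ b) (hcl : ∀ i ∈ F, IsClosed (Icc a b ∩ τ i))
    (hcov : Icc a b ⊆ ⋃ i ∈ F, τ i)
    (hg : ∀ i ∈ F, ∀ s ∈ Icc a b ∩ τ i, ∀ t ∈ Icc a b ∩ τ i, |g t - g s| ≤ L * |t - s|) :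
    |g b - g a| ≤ L * (b - a) := by
  classical
  induction hn : F.card using Nat.strong_induction_on generalizing F a with
  | _ n ih =>
    obtain ⟨i, hiF, hai⟩ : ∃ i ∈ F, a ∈ τ i := by simpa using hcov (left_mem_Icc.2 hab)
    have hc : IsCompact (Icc a b ∩ τ i) := isCompact_Icc.of_isClosed_subset (hcl i hiF)
      inter_subset_left
    have hne : (Icc a b ∩ τ i).Nonempty := ⟨a, left_mem_Icc.2 hab, hai⟩
    obtain ⟨r, hr, hrmax⟩ := hc.exists_isGreatest hne
    have hfirst : |g r - g a| ≤ L * (r - a) := by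
      simpa [abs_of_nonneg (sub_nonneg.2 hr.1.1)] using
        hg i hiF a ⟨left_mem_Icc.2 hab, hai⟩ r hr
    rcases hr.1.2.eq_or_lt with rfl | hrb
    · exact hfirst
    have hsub : Icc r b ⊆ Icc a b := Icc_subset_Icc_left hr.1.1
    have hcl' : IsClosed (⋃ j ∈ F.erase i, Icc a b ∩ τ j) :=
      (F.erase i).finite_toSet.isClosed_biUnion fun j hj => hcl j (Finset.mem_of_mem_erase hj)
    have hIoc : Ioc r b ⊆ ⋃ j ∈ F.erase i, Icc a b ∩ τ j := by
      intro t ht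
      have htI : t ∈ Icc a b := ⟨hr.1.1.trans ht.1.le, ht.2⟩
      obtain ⟨j, hj, htj⟩ : ∃ j ∈ F, t ∈ τ j := by simpa using hcov htI
      have hji : j ≠ i := by
        rintro rfl
        exact absurd (hrmax ⟨htI, htj⟩) (not_le.2 ht.1)
      exact mem_biUnion (Finset.mem_coe.2 (Finset.mem_erase.2 ⟨hji, hj⟩)) ⟨htI, htj⟩
    -- The other sets cover only the times after `r`; closedness of their union adds `r` itself.
    have hIcc : Icc r b ⊆ ⋃ j ∈ F.erase i, Icc a b ∩ τ j := by
      rw [← closure_Ioc hrb.ne]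
      exact hcl'.closure_subset_iff.2 hIoc
    have hsecond : |g b - g r| ≤ L * (b - r) := by
      refine ih _ ?_ (F.erase i) hrb.le ?_ ?_ ?_ rfl
      · rw [← hn]; exact Finset.card_erase_lt_of_mem hiF
      · intro j hj
        have : Icc r b ∩ τ j = Icc r b ∩ (Icc a b ∩ τ j) := by
          rw [← inter_assoc, inter_eq_left.2 hsub]
        rw [this]
        exact isClosed_Icc.inter (hcl j (Finset.mem_of_mem_erase hj))
      · exact hIcc.trans (iUnion₂_mono fun j _ => inter_subset_right)
      · exact fun j hj s hs t ht => hg j (Finset.mem_of_mem_erase hj) s ⟨hsub hs.1, hs.2⟩ t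
          ⟨hsub ht.1, ht.2⟩
    calc |g b - g a| = |(g b - g r) + (g r - g a)| := by congr 1; ring
      _ ≤ L * (b - r) + L * (r - a) := (abs_add_le _ _).trans (add_le_add hsecond hfirst)
      _ = L * (b - a) := by ring

/-- Only countably many points of `S` are isolated in `S` from the right. At any other point,
difference quotients along `S` determine the derivative. The exceptional set depends on `S` alone
and not on the two functions. -/
theorem ae_deriv_eq_of_eqOn (S : Set ℝ) :
    ∀ᵐ t : ℝ, t ∈ S → ∀ f g : ℝ → ℝ, EqOn f g S → ∀ f' g' : ℝ,
      HasDerivAt f f' t → HasDerivAt g g' t → f' = g' := by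
  have hc : {x ∈ S | 𝓝[S ∩ Ioi x] x = ⊥}.Countable := countable_setOfPred_isolated_right_within
  filter_upwards [hc.ae_notMem volume] with t ht htS f g hfg f' g' hf hg
  have hacc : AccPt t (𝓟 S) := by
    have hne : (𝓝[S ∩ Ioi t] t).NeBot := neBot_iff.2 fun h => ht ⟨htS, h⟩
    rw [accPt_iff_frequently_nhdsNE]
    have h2 : ∃ᶠ y in 𝓝[S ∩ Ioi t] t, y ∈ S :=
      (eventually_mem_nhdsWithin.mono fun y hy => hy.1).frequently
    exact h2.filter_mono (nhdsWithin_mono t fun y hy => (ne_of_gt hy.2 : y ≠ t))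
  have hu := hacc.uniqueDiffWithinAt
  exact hu.eq_deriv S hf.hasDerivWithinAt
    (hg.hasDerivWithinAt.congr (fun x hx => hfg hx) (hfg htS))

end Time

/-! ### Geometry of the mesh -/

namespace Mesh

variable {ι : Type*} [Fintype ι] (𝒯 : Mesh ι)

theorem isCompact_cell (i : ι) : IsCompact (𝒯.cell i) :=
  Set.Finite.isCompact_convexHull ℝ (𝒯.verts i).finite_toSet

theorem convex_cell (i : ι) : Convex ℝ (𝒯.cell i) := convex_convexHull ℝ _

theorem isCompact_Ωh : IsCompact 𝒯.Ωh := isCompact_iUnion 𝒯.isCompact_cell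

theorem isOpen_Ω : IsOpen 𝒯.Ω := isOpen_interior

theorem cell_subset_Ωh (i : ι) : 𝒯.cell i ⊆ 𝒯.Ωh := subset_iUnion 𝒯.cell i

theorem interior_cell_subset_Ω (i : ι) : interior (𝒯.cell i) ⊆ 𝒯.Ω :=
  interior_mono (𝒯.cell_subset_Ωh i)

theorem Ω_subset_Ωh : 𝒯.Ω ⊆ 𝒯.Ωh := interior_subset

theorem mem_cell_cellOf {x : Vec} (hx : x ∈ 𝒯.Ωh) : x ∈ 𝒯.cell (𝒯.cellOf x) := by
  obtain ⟨i, hi⟩ := mem_iUnion.1 hx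
  exact 𝒯.mem_cellOf i x hi

theorem closure_interior_cell (i : ι) : closure (interior (𝒯.cell i)) = 𝒯.cell i := by
  rw [(𝒯.convex_cell i).closure_interior_eq_closure_of_nonempty_interior
    (𝒯.interior_nonempty i), (𝒯.isCompact_cell i).isClosed.closure_eq]

/-- A cell is the closure of its interior, so a neighbourhood of `x` inside cell `i` would meet the
interior of cell `j`. -/
theorem eq_of_mem_interior_of_mem {x : Vec} {i j : ι} (hi : x ∈ interior (𝒯.cell i))
    (hj : x ∈ 𝒯.cell j) : i = j := by
  by_contra hij
  rw [← 𝒯.closure_interior_cell j] at hj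
  obtain ⟨y, hyi, hyj⟩ := mem_closure_iff.1 hj _ isOpen_interior hi
  exact disjoint_left.1 (𝒯.disjoint_interior i j hij) hyi hyj

theorem cellOf_eq {x : Vec} {i : ι} (hi : x ∈ interior (𝒯.cell i)) : 𝒯.cellOf x = i :=
  (𝒯.eq_of_mem_interior_of_mem hi
    (𝒯.mem_cell_cellOf (𝒯.cell_subset_Ωh i (interior_subset hi)))).symm

/-- Frontiers of convex sets are null. Hence the arbitrary choice made by `cellOf` on faces is
invisible to integrals. -/
theorem ae_mem_interior : ∀ᵐ x : Vec, x ∈ 𝒯.Ωh → x ∈ interior (𝒯.cell (𝒯.cellOf x)) := by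
  have h : ∀ᵐ x : Vec, ∀ i, x ∉ frontier (𝒯.cell i) :=
    ae_all_iff.2 fun i => measure_eq_zero_iff_ae_notMem.1 ((𝒯.convex_cell i).addHaar_frontier _)
  filter_upwards [h] with x hx hmem
  by_contra hcon
  exact hx _ ⟨subset_closure (𝒯.mem_cell_cellOf hmem), hcon⟩

theorem Ω_ae_eq_Ωh : (𝒯.Ω : Set Vec) =ᵐ[volume] 𝒯.Ωh := by
  filter_upwards [𝒯.ae_mem_interior] with x hx
  exact propext ⟨fun h => 𝒯.Ω_subset_Ωh h, fun h => 𝒯.interior_cell_subset_Ω _ (hx h)⟩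

theorem integral_Ωh (f : Vec → ℝ) : ∫ x in 𝒯.Ωh, f x = ∫ x in 𝒯.Ω, f x :=
  setIntegral_congr_set 𝒯.Ω_ae_eq_Ωh.symm

theorem ae_restrict_iff_Ω {p : Vec → Prop} :
    (∀ᵐ x ∂volume.restrict 𝒯.Ω, p x) ↔ ∀ᵐ x, x ∈ 𝒯.Ω → p x :=
  ae_restrict_iff' 𝒯.isOpen_Ω.measurableSet

theorem ae_Ω_mem_interior :
    ∀ᵐ x ∂volume.restrict 𝒯.Ω, x ∈ interior (𝒯.cell (𝒯.cellOf x)) := by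
  rw [𝒯.ae_restrict_iff_Ω]
  filter_upwards [𝒯.ae_mem_interior] with x hx h using hx (𝒯.Ω_subset_Ωh h)

theorem ae_Ω_of_cells {p : Vec → Prop} (h : ∀ i, ∀ᵐ x, x ∈ interior (𝒯.cell i) → p x) :
    ∀ᵐ x ∂volume.restrict 𝒯.Ω, p x := by
  rw [𝒯.ae_restrict_iff_Ω]
  filter_upwards [𝒯.ae_mem_interior, ae_all_iff.2 h] with x hx hp hmem
  exact hp _ (hx (𝒯.Ω_subset_Ωh hmem))

instance : IsFiniteMeasure (volume.restrict 𝒯.Ω) :=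
  ⟨by
    rw [Measure.restrict_apply_univ]
    exact (measure_mono 𝒯.Ω_subset_Ωh).trans_lt 𝒯.isCompact_Ωh.measure_lt_top⟩

theorem memL2_of_continuousOn {F : Type*} [NormedAddCommGroup F] {f : Vec → F}
    [SecondCountableTopologyEither Vec F]
    (hf : ContinuousOn f 𝒯.Ωh) : MemL2 𝒯.Ω f := by
  obtain ⟨C, hC⟩ := 𝒯.isCompact_Ωh.exists_bound_of_continuousOn hf
  refine MemLp.of_bound
    ((hf.mono 𝒯.Ω_subset_Ωh).aestronglyMeasurable 𝒯.isOpen_Ω.measurableSet) C ?_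
  rw [𝒯.ae_restrict_iff_Ω]
  exact Filter.Eventually.of_forall fun x hx => hC x (𝒯.Ω_subset_Ωh hx)

theorem integrable_of_continuousOn {f : Vec → ℝ} (hf : ContinuousOn f 𝒯.Ωh) :
    Integrable f (volume.restrict 𝒯.Ω) :=
  (hf.integrableOn_compact 𝒯.isCompact_Ωh).mono_set 𝒯.Ω_subset_Ωh

end Mesh

/-! ### Square integrable fields -/

section L2

variable {Ω : Set Vec}

theorem memL2_apply {f : Vec → Vec} (hf : MemL2 Ω f) (i : Fin 3) : MemL2 Ω fun x => f x i :=
  (ContinuousLinearMap.proj (R := ℝ) (φ := fun _ : Fin 3 => ℝ) i).comp_memLp' hf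

theorem memL2_pi {f : Vec → Vec} (hf : ∀ i, MemL2 Ω fun x => f x i) : MemL2 Ω f :=
  memLp_pi_iff.2 hf

theorem integrable_mul {f g : Vec → ℝ} (hf : MemL2 Ω f) (hg : MemL2 Ω g) :
    Integrable (fun x => f x * g x) (volume.restrict Ω) :=
  hf.integrable_mul hg

theorem integrable_dot {f g : Vec → Vec} (hf : MemL2 Ω f) (hg : MemL2 Ω g) :
    Integrable (fun x => f x ⬝ᵥ g x) (volume.restrict Ω) :=
  integrable_finsetSum _ fun i _ => integrable_mul (memL2_apply hf i) (memL2_apply hg i)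

end L2

/-! ### Piecewise polynomial functions -/

section PiecewisePolynomial

variable {ι : Type*} [Fintype ι] (𝒯 : Mesh ι)

theorem continuous_eval (p : MvPolynomial (Fin 3) ℝ) :
    Continuous fun x : Vec => MvPolynomial.eval x p := MvPolynomial.continuous_eval p

theorem continuous_evalVec (p : Fin 3 → MvPolynomial (Fin 3) ℝ) : Continuous (evalVec p) :=
  continuous_pi fun i => continuous_eval (p i)

/-- The function that is given by the polynomial `P i` at the points that are attributed to the
cell `i`, as a linear function of `P`. -/
def piecewise (d : ℕ) :
    (ι → MvPolynomial.restrictTotalDegree (Fin 3) ℝ d) →ₗ[ℝ] Vec → ℝ where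
  toFun P := 𝒯.Ωh.indicator fun x => MvPolynomial.eval x (P (𝒯.cellOf x)).1
  map_add' P R := by
    ext x
    by_cases hx : x ∈ 𝒯.Ωh <;> simp [hx]
  map_smul' a P := by
    ext x
    by_cases hx : x ∈ 𝒯.Ωh <;> simp [hx]

/-- The vector-valued version of `piecewise`. -/
def piecewiseVec (d : ℕ) :
    (ι → Fin 3 → MvPolynomial.restrictTotalDegree (Fin 3) ℝ d) →ₗ[ℝ] Vec → Vec where
  toFun P := 𝒯.Ωh.indicator fun x => evalVec (fun j => (P (𝒯.cellOf x) j).1) x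
  map_add' P R := by
    ext x
    by_cases hx : x ∈ 𝒯.Ωh <;> simp [hx, evalVec]
  map_smul' a P := by
    ext x
    by_cases hx : x ∈ 𝒯.Ωh <;> simp [hx, evalVec]

/-- Piecewise polynomial vector fields of degree at most `d`. -/
def PW (d : ℕ) : Submodule ℝ (Vec → Vec) := LinearMap.range (piecewiseVec 𝒯 d)

instance (d : ℕ) : FiniteDimensional ℝ (PW 𝒯 d) :=
  inferInstanceAs (FiniteDimensional ℝ (LinearMap.range (piecewiseVec 𝒯 d)))

theorem mem_PW {d : ℕ} {f : Vec → Vec} (P : ι → Fin 3 → MvPolynomial (Fin 3) ℝ)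
    (hP : ∀ i j, (P i j).totalDegree ≤ d)
    (hf : f = 𝒯.Ωh.indicator fun x => evalVec (P (𝒯.cellOf x)) x) : f ∈ PW 𝒯 d :=
  ⟨fun i j => ⟨P i j, (MvPolynomial.mem_restrictTotalDegree _ _ _).2 (hP i j)⟩, hf.symm⟩

/-- No measurability of `cellOf` is assumed, so the function is compared almost everywhere with a
finite sum of indicators of open cell interiors. -/
theorem memL2_piecewise {F : Type*} [NormedAddCommGroup F] [SecondCountableTopology F]
    {G : ι → Vec → F} (hG : ∀ i, Continuous (G i)) :
    MemL2 𝒯.Ω (𝒯.Ωh.indicator fun x => G (𝒯.cellOf x) x) := by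
  classical
  have hL : MemL2 𝒯.Ω (fun x => ∑ i, (interior (𝒯.cell i)).indicator (G i) x) :=
    memLp_finsetSum _ fun i _ => (𝒯.memL2_of_continuousOn (hG i).continuousOn).indicator
      isOpen_interior.measurableSet
  refine MemLp.ae_eq ?_ hL
  filter_upwards [𝒯.ae_Ω_mem_interior] with x hx
  have hxΩ : x ∈ 𝒯.Ωh := 𝒯.Ω_subset_Ωh (𝒯.interior_cell_subset_Ω _ hx)
  rw [indicator_of_mem hxΩ, Finset.sum_eq_single (𝒯.cellOf x), indicator_of_mem hx]
  · intro i _ hi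
    exact indicator_of_notMem (fun h => hi (𝒯.cellOf_eq h).symm) _
  · simp

theorem memL2_of_mem_PW {d : ℕ} {f : Vec → Vec} (hf : f ∈ PW 𝒯 d) : MemL2 𝒯.Ω f := by
  obtain ⟨P, rfl⟩ := hf
  exact memL2_piecewise 𝒯 fun i => continuous_evalVec fun j => (P i j).1

end PiecewisePolynomial

/-! ### Calculus of test functions -/

section TestFunctions

variable {Ω U : Set Vec}

theorem IsTest.mono {F : Type*} [NormedAddCommGroup F] [NormedSpace ℝ F] {ψ : Vec → F}
    (h : IsTest U ψ) (hU : U ⊆ Ω) : IsTest Ω ψ := ⟨h.1, h.2.1, h.2.2.trans hU⟩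

theorem IsTest.apply {ψ : Vec → Vec} (h : IsTest Ω ψ) (i : Fin 3) : IsTest Ω fun x => ψ x i := by
  have hsub : tsupport (fun x => ψ x i) ⊆ tsupport ψ :=
    closure_mono fun x hx h0 => hx (by simp [h0])
  exact ⟨contDiff_pi.1 h.1 i, h.2.1.of_isClosed_subset (isClosed_tsupport _) hsub,
    hsub.trans h.2.2⟩

theorem isTest_pi {ψ : Vec → Vec} (h : ∀ i, IsTest Ω fun x => ψ x i) : IsTest Ω ψ := by
  have hsub : tsupport ψ ⊆ ⋃ i, tsupport fun x => ψ x i := by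
    refine closure_minimal (fun x hx => ?_) (isClosed_iUnion_of_finite fun i => isClosed_tsupport _)
    obtain ⟨i, hi⟩ := Function.ne_iff.1 hx
    exact mem_iUnion.2 ⟨i, subset_closure hi⟩
  exact ⟨contDiff_pi.2 fun i => (h i).1,
    (isCompact_iUnion fun i => (h i).2.1).of_isClosed_subset (isClosed_tsupport _) hsub,
    hsub.trans (iUnion_subset fun i => (h i).2.2)⟩

theorem contDiff_pderiv {f : Vec → ℝ} (hf : ContDiff ℝ ∞ f) (j : Fin 3) :
    ContDiff ℝ ∞ (pderiv j f) :=
  (hf.fderiv_right (m := ∞) (by simp)).clm_apply contDiff_const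

theorem tsupport_pderiv_subset (f : Vec → ℝ) (j : Fin 3) : tsupport (pderiv j f) ⊆ tsupport f :=
  closure_minimal (fun x hx => support_fderiv_subset ℝ fun h0 => hx (by simp [pderiv, h0]))
    (isClosed_tsupport _)

theorem IsTest.pderiv {φ : Vec → ℝ} (h : IsTest Ω φ) (j : Fin 3) : IsTest Ω (pderiv j φ) :=
  ⟨contDiff_pderiv h.1 j,
    h.2.1.of_isClosed_subset (isClosed_tsupport _) (tsupport_pderiv_subset φ j),
    (tsupport_pderiv_subset φ j).trans h.2.2⟩

theorem IsTest.sub {φ χ : Vec → ℝ} (h : IsTest Ω φ) (h' : IsTest Ω χ) :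
    IsTest Ω fun x => φ x - χ x := by
  have hsub : tsupport (fun x => φ x - χ x) ⊆ tsupport φ ∪ tsupport χ := by
    refine closure_minimal (fun x hx => ?_) ((isClosed_tsupport _).union (isClosed_tsupport _))
    by_contra hcon
    rw [mem_union, not_or] at hcon
    exact hx (by simp [image_eq_zero_of_notMem_tsupport hcon.1,
      image_eq_zero_of_notMem_tsupport hcon.2])
  exact ⟨h.1.sub h'.1, (h.2.1.union h'.2.1).of_isClosed_subset (isClosed_tsupport _) hsub,
    hsub.trans (union_subset h.2.2 h'.2.2)⟩

theorem IsTest.gradC {φ : Vec → ℝ} (h : IsTest Ω φ) : IsTest Ω (gradC φ) :=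
  isTest_pi fun j => h.pderiv j

theorem IsTest.curlC {ψ : Vec → Vec} (h : IsTest Ω ψ) : IsTest Ω (curlC ψ) := by
  refine isTest_pi fun j => ?_
  fin_cases j
  · exact ((h.apply 2).pderiv 1).sub ((h.apply 1).pderiv 2)
  · exact ((h.apply 0).pderiv 2).sub ((h.apply 2).pderiv 0)
  · exact ((h.apply 1).pderiv 0).sub ((h.apply 0).pderiv 1)

theorem isTest_single {φ : Vec → ℝ} (h : IsTest Ω φ) (i : Fin 3) :
    IsTest Ω fun x => (Pi.single i (φ x) : Vec) := by
  refine isTest_pi fun j => ?_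
  rcases eq_or_ne j i with rfl | hj
  · simpa using h
  · simp only [Pi.single_eq_of_ne hj]
    exact ⟨contDiff_const, HasCompactSupport.zero, by simp [tsupport]⟩

theorem IsTest.memL2 {F : Type*} [NormedAddCommGroup F] [NormedSpace ℝ F] {ψ : Vec → F}
    (h : IsTest U ψ) [SecondCountableTopology F] : MemL2 Ω ψ :=
  (h.1.continuous.memLp_of_hasCompactSupport h.2.1 :
    MemLp ψ 2 (volume : Measure Vec)).restrict Ω

theorem IsTest.memL2_divC {ψ : Vec → Vec} (h : IsTest Ω ψ) : MemL2 U (divC ψ) :=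
  memLp_finsetSum _ fun j _ => ((h.apply j).pderiv j).memL2

theorem pderiv_comm {f : Vec → ℝ} (hf : ContDiff ℝ ∞ f) (i j : Fin 3) (x : Vec) :
    pderiv i (pderiv j f) x = pderiv j (pderiv i f) x := by
  have hd : DifferentiableAt ℝ (fderiv ℝ f) x :=
    (hf.fderiv_right (m := ∞) (by simp)).differentiable (by simp) x
  have hsymm : IsSymmSndFDerivAt ℝ f x := hf.contDiffAt.isSymmSndFDerivAt (by
    simpa using (WithTop.coe_le_coe.2 le_top : ((2 : ℕ∞) : WithTop ℕ∞) ≤ ∞))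
  have key : ∀ k l : Fin 3, pderiv k (pderiv l f) x
      = fderiv ℝ (fderiv ℝ f) x (Pi.single k 1) (Pi.single l 1) := by
    intro k l
    unfold pderiv
    rw [fderiv_clm_apply hd (differentiableAt_const _)]
    simp
  rw [key, key, hsymm.eq]

theorem pderiv_sub {f g : Vec → ℝ} (hf : ContDiff ℝ ∞ f) (hg : ContDiff ℝ ∞ g) (i : Fin 3)
    (x : Vec) : pderiv i (fun y => f y - g y) x = pderiv i f x - pderiv i g x := by
  unfold pderiv
  rw [fderiv_fun_sub (hf.differentiable (by simp) x) (hg.differentiable (by simp) x)]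
  rfl

theorem divC_curlC {ψ : Vec → Vec} (h : ContDiff ℝ ∞ ψ) (x : Vec) : divC (curlC ψ) x = 0 := by
  have hc : ∀ i, ContDiff ℝ ∞ fun y => ψ y i := contDiff_pi.1 h
  have hp : ∀ i j, ContDiff ℝ ∞ (pderiv j fun y => ψ y i) := fun i j => contDiff_pderiv (hc i) j
  rw [divC, Fin.sum_univ_three]
  simp only [curlC, Matrix.cons_val]
  rw [pderiv_sub (hp _ _) (hp _ _), pderiv_sub (hp _ _) (hp _ _), pderiv_sub (hp _ _) (hp _ _),
    pderiv_comm (hc 2) 0 1, pderiv_comm (hc 1) 0 2, pderiv_comm (hc 0) 1 2]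
  ring

theorem curlC_gradC {φ : Vec → ℝ} (h : ContDiff ℝ ∞ φ) (x : Vec) : curlC (gradC φ) x = 0 := by
  ext i
  fin_cases i <;> simp [curlC, gradC, pderiv_comm h 1 2, pderiv_comm h 2 0, pderiv_comm h 0 1]

theorem divC_single (φ : Vec → ℝ) (i : Fin 3) (x : Vec) :
    divC (fun y => (Pi.single i (φ y) : Vec)) x = pderiv i φ x := by
  rw [divC, Finset.sum_eq_single i]
  · simp
  · intro j _ hj
    simp [Pi.single_eq_of_ne hj, pderiv]
  · simp

theorem integral_mul_pderiv {F φ : Vec → ℝ} (hF : ContDiff ℝ ∞ F) (hφ : IsTest Ω φ) (j : Fin 3) :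
    ∫ x, F x * pderiv j φ x = -∫ x, pderiv j F x * φ x := by
  have hcp := (hφ.pderiv j).2.1
  refine integral_mul_fderiv_eq_neg_fderiv_mul_of_integrable ?_ ?_ ?_
    (fun x _ => hF.differentiable (by simp) x) fun x _ => hφ.1.differentiable (by simp) x
  · exact ((contDiff_pderiv hF j).continuous.mul hφ.1.continuous).integrable_of_hasCompactSupport
      hφ.2.1.mul_left
  · exact (hF.continuous.mul (contDiff_pderiv hφ.1 j).continuous).integrable_of_hasCompactSupport
      hcp.mul_left
  · exact (hF.continuous.mul hφ.1.continuous).integrable_of_hasCompactSupport hφ.2.1.mul_left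

theorem integral_alternating_sum {f₁ f₂ f₃ f₄ f₅ f₆ : Vec → ℝ} (h₁ : Integrable f₁)
    (h₂ : Integrable f₂) (h₃ : Integrable f₃) (h₄ : Integrable f₄) (h₅ : Integrable f₅)
    (h₆ : Integrable f₆) :
    ∫ x, ((f₁ x - f₂ x) + (f₃ x - f₄ x)) + (f₅ x - f₆ x)
      = ((∫ x, f₁ x) - ∫ x, f₂ x) + ((∫ x, f₃ x) - ∫ x, f₄ x) + ((∫ x, f₅ x) - ∫ x, f₆ x) := by
  have h := integral_add (h₁.sub h₂) (h₃.sub h₄)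
  simp only [Pi.sub_apply] at h
  rw [← integral_sub h₁ h₂, ← integral_sub h₃ h₄, ← integral_sub h₅ h₆, ← h]
  exact integral_add ((h₁.sub h₂).add (h₃.sub h₄)) (h₅.sub h₆)

theorem integral_dot_curlC {F ψ : Vec → Vec} (hF : ContDiff ℝ ∞ F) (hψ : IsTest Ω ψ) :
    ∫ x, F x ⬝ᵥ curlC ψ x = ∫ x, curlC F x ⬝ᵥ ψ x := by
  have hFc : ∀ i, ContDiff ℝ ∞ fun y => F y i := contDiff_pi.1 hF
  have hi : ∀ i j k, Integrable fun x => F x i * pderiv j (fun y => ψ y k) x := fun i j k =>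
    ((hFc i).continuous.mul
      (contDiff_pderiv (hψ.apply k).1 j).continuous).integrable_of_hasCompactSupport
      ((hψ.apply k).pderiv j).2.1.mul_left
  have hi' : ∀ i j k, Integrable fun x => pderiv j (fun y => F y i) x * ψ x k := fun i j k =>
    ((contDiff_pderiv (hFc i) j).continuous.mul
      (hψ.apply k).1.continuous).integrable_of_hasCompactSupport
      (hψ.apply k).2.1.mul_left
  have e1 : ∀ x, F x ⬝ᵥ curlC ψ x =
      ((F x 0 * pderiv 1 (fun y => ψ y 2) x - F x 0 * pderiv 2 (fun y => ψ y 1) x)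
      + (F x 1 * pderiv 2 (fun y => ψ y 0) x - F x 1 * pderiv 0 (fun y => ψ y 2) x))
      + (F x 2 * pderiv 0 (fun y => ψ y 1) x - F x 2 * pderiv 1 (fun y => ψ y 0) x) := by
    intro x
    simp [dotProduct, Fin.sum_univ_three, curlC]
    ring
  have e2 : ∀ x, curlC F x ⬝ᵥ ψ x =
      ((pderiv 1 (fun y => F y 2) x * ψ x 0 - pderiv 2 (fun y => F y 1) x * ψ x 0)
      + (pderiv 2 (fun y => F y 0) x * ψ x 1 - pderiv 0 (fun y => F y 2) x * ψ x 1))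
      + (pderiv 0 (fun y => F y 1) x * ψ x 2 - pderiv 1 (fun y => F y 0) x * ψ x 2) := by
    intro x
    simp [dotProduct, Fin.sum_univ_three, curlC]
    ring
  simp only [e1, e2]
  rw [integral_alternating_sum (hi _ _ _) (hi _ _ _) (hi _ _ _) (hi _ _ _) (hi _ _ _) (hi _ _ _),
    integral_alternating_sum (hi' _ _ _) (hi' _ _ _) (hi' _ _ _) (hi' _ _ _) (hi' _ _ _)
      (hi' _ _ _)]
  simp only [fun i j k => integral_mul_pderiv (hFc i) (hψ.apply k) j]
  ring

theorem setIntegral_eq_of_test {F : Type*} [NormedAddCommGroup F] [NormedSpace ℝ F] {ψ : Vec → F}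
    (hψ : IsTest Ω ψ) {f : Vec → ℝ} (hf : ∀ x, ψ x = 0 → f x = 0) :
    ∫ x in Ω, f x = ∫ x, f x :=
  setIntegral_eq_integral_of_forall_compl_eq_zero fun x hx =>
    hf x (image_eq_zero_of_notMem_tsupport fun h => hx (hψ.2.2 h))

/-! ### Uniqueness of weak derivatives -/

/-- The fundamental lemma of the calculus of variations. Allowing `U` smaller than `Ω` makes it
possible to localize to the interior of one cell. -/
theorem ae_eq_of_integral_test (hU : IsOpen U) (hUΩ : U ⊆ Ω) {g₁ g₂ : Vec → ℝ} (h₁ : MemL2 Ω g₁)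
    (h₂ : MemL2 Ω g₂)
    (h : ∀ φ : Vec → ℝ, IsTest U φ → ∫ x in Ω, g₁ x * φ x = ∫ x in Ω, g₂ x * φ x) :
    ∀ᵐ x, x ∈ U → g₁ x = g₂ x := by
  have hloc : LocallyIntegrableOn (fun x => g₁ x - g₂ x) U := by
    refine locallyIntegrableOn_of_locallyIntegrable_restrict ?_
    exact ((h₁.sub h₂).mono_measure (Measure.restrict_mono_set _ hUΩ)).locallyIntegrable
      (by norm_num)
  have key := hU.ae_eq_zero_of_integral_contDiff_smul_eq_zero hloc fun φ hφ hc hs => by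
    have hφU : IsTest U φ := ⟨hφ, hc, hs⟩
    have hφ2 : MemL2 Ω φ := hφU.memL2
    rw [← setIntegral_eq_of_test (hφU.mono hUΩ) fun x hx => by simp [hx]]
    have : ∀ x, φ x • (g₁ x - g₂ x) = g₁ x * φ x - g₂ x * φ x := fun x => by
      simp only [smul_eq_mul]; ring
    simp only [this]
    rw [integral_sub (integrable_mul h₁ hφ2) (integrable_mul h₂ hφ2), h φ hφU, sub_self]
  filter_upwards [key] with x hx hxU using sub_eq_zero.1 (hx hxU)

theorem ae_eq_of_integral_test_vec (hU : IsOpen U) (hUΩ : U ⊆ Ω) {g₁ g₂ : Vec → Vec}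
    (h₁ : MemL2 Ω g₁) (h₂ : MemL2 Ω g₂)
    (h : ∀ ψ : Vec → Vec, IsTest U ψ → ∫ x in Ω, g₁ x ⬝ᵥ ψ x = ∫ x in Ω, g₂ x ⬝ᵥ ψ x) :
    ∀ᵐ x, x ∈ U → g₁ x = g₂ x := by
  have key : ∀ i, ∀ᵐ x, x ∈ U → g₁ x i = g₂ x i := fun i =>
    ae_eq_of_integral_test hU hUΩ (memL2_apply h₁ i) (memL2_apply h₂ i) fun φ hφ => by
      simpa [dotProduct_single] using h _ (isTest_single hφ i)
  filter_upwards [ae_all_iff.2 key] with x hx hxU using funext fun i => hx i hxU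

theorem isWeakGrad_grad {f : Vec → ℝ} (h : ∃ g, IsWeakGrad Ω f g) : IsWeakGrad Ω f (grad Ω f) :=
  Classical.epsilon_spec h

theorem isWeakCurl_curl {f : Vec → Vec} (h : ∃ g, IsWeakCurl Ω f g) :
    IsWeakCurl Ω f (curl Ω f) := Classical.epsilon_spec h

theorem isWeakDiv_dvg {f : Vec → Vec} (h : ∃ g, IsWeakDiv Ω f g) : IsWeakDiv Ω f (dvg Ω f) :=
  Classical.epsilon_spec h

theorem IsWeakGrad.ae_eq (hΩ : IsOpen Ω) {f : Vec → ℝ} {g : Vec → Vec} (h : IsWeakGrad Ω f g) :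
    ∀ᵐ x ∂volume.restrict Ω, grad Ω f x = g x := by
  rw [ae_restrict_iff' hΩ.measurableSet]
  have hg := isWeakGrad_grad ⟨g, h⟩
  exact ae_eq_of_integral_test_vec hΩ subset_rfl hg.1 h.1 fun ψ hψ =>
    neg_injective ((hg.2 ψ hψ).symm.trans (h.2 ψ hψ))

theorem IsWeakCurl.ae_eq (hΩ : IsOpen Ω) {f g : Vec → Vec} (h : IsWeakCurl Ω f g) :
    ∀ᵐ x ∂volume.restrict Ω, curl Ω f x = g x := by
  rw [ae_restrict_iff' hΩ.measurableSet]
  have hg := isWeakCurl_curl ⟨g, h⟩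
  exact ae_eq_of_integral_test_vec hΩ subset_rfl hg.1 h.1 fun ψ hψ =>
    (hg.2 ψ hψ).symm.trans (h.2 ψ hψ)

theorem IsWeakDiv.ae_eq (hΩ : IsOpen Ω) {f : Vec → Vec} {g : Vec → ℝ} (h : IsWeakDiv Ω f g) :
    ∀ᵐ x ∂volume.restrict Ω, dvg Ω f x = g x := by
  rw [ae_restrict_iff' hΩ.measurableSet]
  have hg := isWeakDiv_dvg ⟨g, h⟩
  exact ae_eq_of_integral_test hΩ subset_rfl hg.1 h.1 fun ψ hψ =>
    neg_injective ((hg.2 ψ hψ).symm.trans (h.2 ψ hψ))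

/-- Test functions supported in `U` see only `F`, for which classical integration by parts holds.
With `U` a cell interior and `F` a polynomial, this computes weak gradients cell by cell. -/
theorem IsWeakGrad.ae_eq_gradC (hU : IsOpen U) (hUΩ : U ⊆ Ω) {f F : Vec → ℝ} {g : Vec → Vec}
    (h : IsWeakGrad Ω f g) (hF : ContDiff ℝ ∞ F) (hFL : MemL2 Ω (gradC F)) (hfF : EqOn f F U) :
    ∀ᵐ x, x ∈ U → g x = gradC F x := by
  have key : ∀ i, ∀ᵐ x, x ∈ U → g x i = gradC F x i := fun i =>
    ae_eq_of_integral_test hU hUΩ (memL2_apply h.1 i) (memL2_apply hFL i) fun φ hφ => by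
      have h1 := h.2 _ ((isTest_single hφ i).mono hUΩ)
      simp only [divC_single, dotProduct_single] at h1
      have hφΩ := hφ.mono hUΩ
      have hφ' := (hφ.pderiv i).mono hUΩ
      rw [← neg_inj, ← h1, setIntegral_eq_of_test hφΩ (f := fun x => gradC F x i * φ x)
        fun x hx => by simp [hx]]
      have h2 : ∀ x, f x * pderiv i φ x = F x * pderiv i φ x := fun x => by
        by_cases hx : x ∈ U
        · rw [hfF hx]
        · rw [image_eq_zero_of_notMem_tsupport fun h => hx ((hφ.pderiv i).2.2 h), mul_zero,
            mul_zero]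
      simp only [h2]
      rw [setIntegral_eq_of_test hφ' fun x hx => by simp [hx]]
      exact integral_mul_pderiv hF hφ i
  filter_upwards [ae_all_iff.2 key] with x hx hxU using funext fun i => hx i hxU

theorem IsWeakCurl.ae_eq_curlC (hU : IsOpen U) (hUΩ : U ⊆ Ω) {f F g : Vec → Vec}
    (h : IsWeakCurl Ω f g) (hF : ContDiff ℝ ∞ F) (hFL : MemL2 Ω (curlC F)) (hfF : EqOn f F U) :
    ∀ᵐ x, x ∈ U → g x = curlC F x := by
  refine ae_eq_of_integral_test_vec hU hUΩ h.1 hFL fun ψ hψ => ?_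
  rw [← h.2 ψ (hψ.mono hUΩ), setIntegral_eq_of_test (hψ.mono hUΩ) (f := fun x => curlC F x ⬝ᵥ ψ x)
    fun x hx => by simp [hx]]
  have h2 : ∀ x, f x ⬝ᵥ curlC ψ x = F x ⬝ᵥ curlC ψ x := fun x => by
    by_cases hx : x ∈ U
    · rw [hfF hx]
    · rw [image_eq_zero_of_notMem_tsupport fun h => hx (hψ.curlC.2.2 h), dotProduct_zero,
        dotProduct_zero]
  simp only [h2]
  rw [setIntegral_eq_of_test (hψ.curlC.mono hUΩ) fun x hx => by simp [hx]]
  exact integral_dot_curlC hF hψ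

/-! ### Linearity, and homogeneous boundary conditions -/

theorem IsWeakGrad.add {f f' : Vec → ℝ} {g g' : Vec → Vec} (hf : MemL2 Ω f) (hf' : MemL2 Ω f')
    (h : IsWeakGrad Ω f g) (h' : IsWeakGrad Ω f' g') : IsWeakGrad Ω (f + f') (g + g') := by
  refine ⟨h.1.add h'.1, fun ψ hψ => ?_⟩
  simp only [Pi.add_apply, add_mul, add_dotProduct]
  rw [integral_add (integrable_mul hf hψ.memL2_divC) (integrable_mul hf' hψ.memL2_divC),
    integral_add (integrable_dot h.1 hψ.memL2) (integrable_dot h'.1 hψ.memL2), h.2 ψ hψ,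
    h'.2 ψ hψ, neg_add]

theorem IsWeakGrad.smul {f : Vec → ℝ} {g : Vec → Vec} (a : ℝ) (h : IsWeakGrad Ω f g) :
    IsWeakGrad Ω (a • f) (a • g) := by
  refine ⟨h.1.const_smul a, fun ψ hψ => ?_⟩
  simp only [Pi.smul_apply, smul_eq_mul, mul_assoc, smul_dotProduct]
  rw [integral_const_mul, integral_const_mul, h.2 ψ hψ, mul_neg]

/-- Green's formula with any candidate `g` makes `g` a weak gradient, hence almost everywhere equal
to the chosen `grad`. The vanishing boundary term then transfers to `grad`, so the choice need not
be known explicitly. -/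
theorem mem_H1₀_of (hΩ : IsOpen Ω) {f : Vec → ℝ} {g : Vec → Vec} (hf : MemL2 Ω f)
    (hg : MemL2 Ω g)
    (h : ∀ ψ : Vec → Vec, IsTest univ ψ → ∫ x in Ω, f x * divC ψ x = -∫ x in Ω, g x ⬝ᵥ ψ x) :
    f ∈ H1₀ Ω := by
  have hw : IsWeakGrad Ω f g := ⟨hg, fun ψ hψ => h ψ (hψ.mono (subset_univ _))⟩
  refine ⟨⟨hf, g, hw⟩, fun ψ hψ => ?_⟩
  rw [h ψ hψ]
  congr 1
  refine integral_congr_ae ?_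
  filter_upwards [hw.ae_eq hΩ] with x hx
  rw [hx]

theorem mem_Hcurl₀_of (hΩ : IsOpen Ω) {f g : Vec → Vec} (hf : MemL2 Ω f) (hg : MemL2 Ω g)
    (h : ∀ ψ : Vec → Vec, IsTest univ ψ → ∫ x in Ω, f x ⬝ᵥ curlC ψ x = ∫ x in Ω, g x ⬝ᵥ ψ x) :
    f ∈ Hcurl₀ Ω := by
  have hw : IsWeakCurl Ω f g := ⟨hg, fun ψ hψ => h ψ (hψ.mono (subset_univ _))⟩
  refine ⟨⟨hf, g, hw⟩, fun ψ hψ => ?_⟩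
  rw [h ψ hψ]
  refine integral_congr_ae ?_
  filter_upwards [hw.ae_eq hΩ] with x hx
  rw [hx]

theorem mem_Hdiv₀_of (hΩ : IsOpen Ω) {f : Vec → Vec} {g : Vec → ℝ} (hf : MemL2 Ω f)
    (hg : MemL2 Ω g)
    (h : ∀ ψ : Vec → ℝ, IsTest univ ψ → ∫ x in Ω, f x ⬝ᵥ gradC ψ x = -∫ x in Ω, g x * ψ x) :
    f ∈ Hdiv₀ Ω := by
  have hw : IsWeakDiv Ω f g := ⟨hg, fun ψ hψ => h ψ (hψ.mono (subset_univ _))⟩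
  refine ⟨⟨hf, g, hw⟩, fun ψ hψ => ?_⟩
  rw [h ψ hψ]
  congr 1
  refine integral_congr_ae ?_
  filter_upwards [hw.ae_eq hΩ] with x hx
  rw [hx]

theorem memL2_zero {F : Type*} [NormedAddCommGroup F] : MemL2 Ω (0 : Vec → F) := MemLp.zero

/-- `H¹(Ω)` with zero boundary values, as a subspace. -/
def H1₀Sub (hΩ : IsOpen Ω) : Submodule ℝ (Vec → ℝ) where
  carrier := H1₀ Ω
  zero_mem' := mem_H1₀_of hΩ (g := 0) memL2_zero memL2_zero (by simp)
  add_mem' {f f'} hf hf' := by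
    have hg := (isWeakGrad_grad hf.1.2).1
    have hg' := (isWeakGrad_grad hf'.1.2).1
    refine mem_H1₀_of hΩ (hf.1.1.add hf'.1.1) (hg.add hg') fun ψ hψ => ?_
    simp only [Pi.add_apply, add_mul, add_dotProduct]
    rw [integral_add (integrable_mul hf.1.1 hψ.memL2_divC) (integrable_mul hf'.1.1 hψ.memL2_divC),
      integral_add (integrable_dot hg hψ.memL2) (integrable_dot hg' hψ.memL2), hf.2 ψ hψ,
      hf'.2 ψ hψ, neg_add]
  smul_mem' a f hf := by
    have hg := (isWeakGrad_grad hf.1.2).1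
    refine mem_H1₀_of hΩ (hf.1.1.const_smul a) (hg.const_smul a) fun ψ hψ => ?_
    simp only [Pi.smul_apply, smul_eq_mul, mul_assoc, smul_dotProduct]
    rw [integral_const_mul, integral_const_mul, hf.2 ψ hψ, mul_neg]

/-- `H(div, Ω)` with zero normal boundary values, as a subspace. -/
def Hdiv₀Sub (hΩ : IsOpen Ω) : Submodule ℝ (Vec → Vec) where
  carrier := Hdiv₀ Ω
  zero_mem' := mem_Hdiv₀_of hΩ (g := 0) memL2_zero memL2_zero (by simp)
  add_mem' {f f'} hf hf' := by
    have hg := (isWeakDiv_dvg hf.1.2).1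
    have hg' := (isWeakDiv_dvg hf'.1.2).1
    refine mem_Hdiv₀_of hΩ (hf.1.1.add hf'.1.1) (hg.add hg') fun ψ hψ => ?_
    simp only [Pi.add_apply, add_mul, add_dotProduct]
    rw [integral_add (integrable_dot hf.1.1 hψ.gradC.memL2)
        (integrable_dot hf'.1.1 hψ.gradC.memL2),
      integral_add (integrable_mul hg hψ.memL2) (integrable_mul hg' hψ.memL2), hf.2 ψ hψ,
      hf'.2 ψ hψ, neg_add]
  smul_mem' a f hf := by
    have hg := (isWeakDiv_dvg hf.1.2).1
    refine mem_Hdiv₀_of hΩ (hf.1.1.const_smul a) (hg.const_smul a) fun ψ hψ => ?_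
    simp only [Pi.smul_apply, smul_eq_mul, mul_assoc, smul_dotProduct]
    rw [integral_const_mul, integral_const_mul, hf.2 ψ hψ, mul_neg]

/-- The divergence of a curl is zero. Since `ψ` need not vanish on `∂Ω`, this says both that `∇f` is
curl-free and that its tangential trace is zero. -/
theorem integral_gradient_dot_curlC {f : Vec → ℝ} (hf : f ∈ H1₀ Ω) {ψ : Vec → Vec}
    (hψ : IsTest univ ψ) : ∫ x in Ω, grad Ω f x ⬝ᵥ curlC ψ x = 0 := by
  have h := hf.2 _ hψ.curlC
  simp only [divC_curlC hψ.1, mul_zero, integral_zero] at h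
  linarith

/-- The curl of a gradient is zero; as `φ` is free on `∂Ω`, the normal trace of the curl vanishes
together with its divergence. -/
theorem integral_curl_dot_gradC {f : Vec → Vec} (hf : f ∈ Hcurl₀ Ω) {φ : Vec → ℝ}
    (hφ : IsTest univ φ) : ∫ x in Ω, curl Ω f x ⬝ᵥ gradC φ x = 0 := by
  have h := hf.2 _ hφ.gradC
  simp only [curlC_gradC hφ.1, dotProduct_zero, integral_zero] at h
  exact h.symm

end TestFunctions

/-! ### Differentiation of polynomials -/

section Polynomials

open MvPolynomial (X C)

variable {k : ℕ} {p q : MvPolynomial (Fin 3) ℝ}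

theorem contDiff_eval (p : MvPolynomial (Fin 3) ℝ) :
    ContDiff ℝ ∞ fun x : Vec => MvPolynomial.eval x p := by
  induction p using MvPolynomial.induction_on with
  | C a => simpa using contDiff_const
  | add p q hp hq => simpa using hp.add hq
  | mul_X p i hp => simpa using hp.mul (contDiff_apply ℝ ℝ i)

theorem contDiff_evalVec (p : Fin 3 → MvPolynomial (Fin 3) ℝ) : ContDiff ℝ ∞ (evalVec p) :=
  contDiff_pi.2 fun i => contDiff_eval (p i)

theorem pderiv_eval (j : Fin 3) (p : MvPolynomial (Fin 3) ℝ) (x : Vec) :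
    pderiv j (fun y : Vec => MvPolynomial.eval y p) x
      = MvPolynomial.eval x (MvPolynomial.pderiv j p) := by
  have hd : ∀ p : MvPolynomial (Fin 3) ℝ,
      DifferentiableAt ℝ (fun y : Vec => MvPolynomial.eval y p) x :=
    fun p => (contDiff_eval p).differentiable (by simp) x
  induction p using MvPolynomial.induction_on with
  | C a => simp [pderiv]
  | add p q hp hq =>
    have h := fderiv_fun_add (hd p) (hd q)
    unfold pderiv at hp hq ⊢
    simp only [map_add, h, add_apply, hp, hq]
  | mul_X p i hp =>
    have h := fderiv_fun_mul (hd p) (hd (X i))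
    have hX : fderiv ℝ (fun y : Vec => y i) x = ContinuousLinearMap.proj i :=
      (ContinuousLinearMap.proj (R := ℝ) (φ := fun _ : Fin 3 => ℝ) i).fderiv
    unfold pderiv at hp ⊢
    simp only [map_mul]
    rw [h]
    simp only [MvPolynomial.eval_X, hX, MvPolynomial.pderiv_mul, map_add, map_mul,
      add_apply, smul_apply, hp, smul_eq_mul, ContinuousLinearMap.proj_apply]
    rcases eq_or_ne i j with rfl | hij
    · simp; ring
    · rw [MvPolynomial.pderiv_X_of_ne hij, Pi.single_eq_of_ne hij]; simp; ring

theorem totalDegree_pderiv_le (h : p.totalDegree ≤ k + 1) (j : Fin 3) :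
    (MvPolynomial.pderiv j p).totalDegree ≤ k := by
  classical
  refine Finset.sup_le fun s hs => ?_
  rw [MvPolynomial.mem_support_iff, MvPolynomial.coeff_pderiv] at hs
  have hs' : s + Finsupp.single j 1 ∈ p.support :=
    MvPolynomial.mem_support_iff.2 (left_ne_zero_of_mul hs)
  have h1 := (MvPolynomial.le_totalDegree hs').trans h
  rw [Finsupp.sum_add_index' (by simp) (by simp), Finsupp.sum_single_index rfl] at h1
  omega

theorem totalDegree_pderiv_le' (h : p.totalDegree ≤ k) (j : Fin 3) :
    (MvPolynomial.pderiv j p).totalDegree ≤ k :=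
  totalDegree_pderiv_le (h.trans k.le_succ) j

theorem totalDegree_X_mul_le (h : p.totalDegree ≤ k) (i : Fin 3) :
    (X i * p).totalDegree ≤ k + 1 := by
  refine (MvPolynomial.totalDegree_mul _ _).trans ?_
  rw [MvPolynomial.totalDegree_X]
  omega

theorem totalDegree_X_mul_pderiv_le (h : p.totalDegree ≤ k) (i j : Fin 3) :
    (X i * MvPolynomial.pderiv j p).totalDegree ≤ k := by
  -- Lowering the degree by differentiation requires a bound of the form `k + 1`; for degree zero
  -- the polynomial is constant.
  cases k with
  | zero =>
    obtain ⟨a, rfl⟩ : ∃ a, p = C a :=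
      ⟨_, MvPolynomial.totalDegree_eq_zero_iff_eq_C.1 (Nat.le_zero.1 h)⟩
    simp
  | succ k => exact totalDegree_X_mul_le (totalDegree_pderiv_le h j) i

theorem totalDegree_add_le (hp : p.totalDegree ≤ k) (hq : q.totalDegree ≤ k) :
    (p + q).totalDegree ≤ k := (MvPolynomial.totalDegree_add p q).trans (max_le hp hq)

theorem totalDegree_sub_le (hp : p.totalDegree ≤ k) (hq : q.totalDegree ≤ k) :
    (p - q).totalDegree ≤ k := (MvPolynomial.totalDegree_sub p q).trans (max_le hp hq)

/-- The polynomial field `x × q`. -/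
def crossX (q : Fin 3 → MvPolynomial (Fin 3) ℝ) : Fin 3 → MvPolynomial (Fin 3) ℝ :=
  ![X 1 * q 2 - X 2 * q 1, X 2 * q 0 - X 0 * q 2, X 0 * q 1 - X 1 * q 0]

/-- The curl of a polynomial field. -/
def curlPoly (p : Fin 3 → MvPolynomial (Fin 3) ℝ) : Fin 3 → MvPolynomial (Fin 3) ℝ :=
  ![MvPolynomial.pderiv 1 (p 2) - MvPolynomial.pderiv 2 (p 1),
    MvPolynomial.pderiv 2 (p 0) - MvPolynomial.pderiv 0 (p 2),
    MvPolynomial.pderiv 0 (p 1) - MvPolynomial.pderiv 1 (p 0)]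

/-- The gradient of a polynomial. -/
def gradPoly (p : MvPolynomial (Fin 3) ℝ) : Fin 3 → MvPolynomial (Fin 3) ℝ :=
  fun j => MvPolynomial.pderiv j p

/-- The divergence of a polynomial field. -/
def divPoly (p : Fin 3 → MvPolynomial (Fin 3) ℝ) : MvPolynomial (Fin 3) ℝ :=
  MvPolynomial.pderiv 0 (p 0) + MvPolynomial.pderiv 1 (p 1) + MvPolynomial.pderiv 2 (p 2)

/-- The polynomial `x · ∇ p`. -/
def eulerPoly (p : MvPolynomial (Fin 3) ℝ) : MvPolynomial (Fin 3) ℝ :=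
  X 0 * MvPolynomial.pderiv 0 p + X 1 * MvPolynomial.pderiv 1 p + X 2 * MvPolynomial.pderiv 2 p

theorem evalVec_add (p q : Fin 3 → MvPolynomial (Fin 3) ℝ) (x : Vec) :
    evalVec (p + q) x = evalVec p x + evalVec q x := by
  ext i; simp [evalVec]

theorem evalVec_crossX (q : Fin 3 → MvPolynomial (Fin 3) ℝ) (x : Vec) :
    evalVec (crossX q) x = x ⨯₃ evalVec q x := by
  ext i; fin_cases i <;> simp [evalVec, crossX, cross_apply]

theorem gradC_eval (p : MvPolynomial (Fin 3) ℝ) (x : Vec) :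
    gradC (fun y => MvPolynomial.eval y p) x = evalVec (gradPoly p) x :=
  funext fun j => pderiv_eval j p x

theorem curlC_evalVec (p : Fin 3 → MvPolynomial (Fin 3) ℝ) (x : Vec) :
    curlC (evalVec p) x = evalVec (curlPoly p) x := by
  ext i
  fin_cases i <;> simp [curlC, evalVec, curlPoly, pderiv_eval]

/-- The Raviart–Thomas form of the curl of a Nédélec field: the part multiplying `X j` is `divPoly
q`, and the remainder keeps degree at most `k`, because the Euler operator does not raise the
degree. -/
theorem curlPoly_crossX (p q : Fin 3 → MvPolynomial (Fin 3) ℝ) :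
    curlPoly (p + crossX q) =
      (curlPoly p - fun j => q j + q j + eulerPoly (q j)) + fun j => X j * divPoly q := by
  have e : ∀ i j : Fin 3, i ≠ j → MvPolynomial.pderiv j (X i : MvPolynomial (Fin 3) ℝ) = 0 :=
    fun i j h => MvPolynomial.pderiv_X_of_ne h
  ext1 i
  fin_cases i <;>
  simp [curlPoly, crossX, eulerPoly, divPoly, e, Matrix.vecHead, Matrix.vecTail,
    -MvPolynomial.pderiv_X] <;>
  ring

theorem totalDegree_crossX_le {q : Fin 3 → MvPolynomial (Fin 3) ℝ}
    (h : ∀ j, (q j).totalDegree ≤ k) (j : Fin 3) : (crossX q j).totalDegree ≤ k + 1 := by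
  fin_cases j <;>
  exact totalDegree_sub_le (totalDegree_X_mul_le (h _) _) (totalDegree_X_mul_le (h _) _)

theorem totalDegree_curlPoly_le {p : Fin 3 → MvPolynomial (Fin 3) ℝ}
    (h : ∀ j, (p j).totalDegree ≤ k) (j : Fin 3) : (curlPoly p j).totalDegree ≤ k := by
  fin_cases j <;>
  exact totalDegree_sub_le (totalDegree_pderiv_le' (h _) _) (totalDegree_pderiv_le' (h _) _)

theorem totalDegree_eulerPoly_le (h : p.totalDegree ≤ k) : (eulerPoly p).totalDegree ≤ k :=
  totalDegree_add_le (totalDegree_add_le (totalDegree_X_mul_pderiv_le h _ _)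
    (totalDegree_X_mul_pderiv_le h _ _)) (totalDegree_X_mul_pderiv_le h _ _)

theorem totalDegree_divPoly_le {p : Fin 3 → MvPolynomial (Fin 3) ℝ}
    (h : ∀ j, (p j).totalDegree ≤ k) : (divPoly p).totalDegree ≤ k :=
  totalDegree_add_le (totalDegree_add_le (totalDegree_pderiv_le' (h _) _)
    (totalDegree_pderiv_le' (h _) _)) (totalDegree_pderiv_le' (h _) _)

theorem eq_zero_of_eval_eq_zero_on_open {U : Set Vec} (hU : IsOpen U) (hne : U.Nonempty)
    (h : ∀ x ∈ U, MvPolynomial.eval x p = 0) : p = 0 := by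
  obtain ⟨x, hx⟩ := hne
  obtain ⟨ε, hε, hb⟩ := Metric.isOpen_iff.1 hU x hx
  refine MvPolynomial.funext_set (fun i => Metric.ball (x i) ε) (fun i => ?_) fun y hy => ?_
  · rw [Real.ball_eq_Ioo]
    exact Ioo_infinite (by linarith)
  · rw [map_zero]
    refine h y (hb ?_)
    rw [ball_pi _ hε]
    exact hy

end Polynomials

/-! ### The finite element spaces -/

section FiniteElements

variable {ι : Type*} [Fintype ι] (𝒯 : Mesh ι) {k : ℕ}

theorem eq_indicator {F : Type*} [Zero F] {f : Vec → F} {G : ι → Vec → F}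
    (hsupp : Function.support f ⊆ 𝒯.Ωh)
    (h : ∀ i, ∀ x ∈ 𝒯.cell i, 𝒯.cellOf x = i → f x = G i x) :
    f = 𝒯.Ωh.indicator fun x => G (𝒯.cellOf x) x := by
  ext1 x
  by_cases hx : x ∈ 𝒯.Ωh
  · rw [indicator_of_mem hx]
    exact h _ x (𝒯.mem_cell_cellOf hx) rfl
  · rw [indicator_of_notMem hx]
    exact Function.notMem_support.1 fun h => hx (hsupp h)

theorem indicator_cell {F : Type*} [Zero F] (G : ι → Vec → F) {i : ι} {x : Vec}
    (hx : x ∈ 𝒯.cell i) (hi : 𝒯.cellOf x = i) :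
    𝒯.Ωh.indicator (fun x => G (𝒯.cellOf x) x) x = G i x := by
  rw [indicator_of_mem (𝒯.cell_subset_Ωh i hx), hi]

theorem eqOn_interior_cell {F : Type*} [Zero F] (G : ι → Vec → F) (i : ι) :
    EqOn (𝒯.Ωh.indicator fun x => G (𝒯.cellOf x) x) (G i) (interior (𝒯.cell i)) :=
  fun _ hx => indicator_cell 𝒯 G (interior_subset hx) (𝒯.cellOf_eq hx)

/-- The polynomials match `f` on closed cells, hence agree on shared faces, and finitely many closed
pieces glue. -/
theorem continuousOn_of_mem_Q {f : Vec → ℝ} (hf : f ∈ Q 𝒯 k) : ContinuousOn f 𝒯.Ωh := by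
  refine (locallyFinite_of_finite 𝒯.cell).continuousOn_iUnion
    (fun i => (𝒯.isCompact_cell i).isClosed) fun i => ?_
  obtain ⟨p, -, hp⟩ := hf.2.2 i
  exact (continuous_eval p).continuousOn.congr hp

theorem memL2_of_mem_Q {f : Vec → ℝ} (hf : f ∈ Q 𝒯 k) : MemL2 𝒯.Ω f := hf.1.1

/-- The space `Q_k` as a submodule. -/
def QSub (k : ℕ) : Submodule ℝ (Vec → ℝ) where
  carrier := Q 𝒯 k
  zero_mem' := ⟨⟨memL2_zero, 0, memL2_zero, by simp⟩, by simp, fun i =>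
    ⟨0, by simp [PolyLE], by simp⟩⟩
  add_mem' {f g} hf hg := by
    obtain ⟨f', hf'⟩ := hf.1.2
    obtain ⟨g', hg'⟩ := hg.1.2
    refine ⟨⟨hf.1.1.add hg.1.1, _, hf'.add hf.1.1 hg.1.1 hg'⟩,
      (Function.support_add f g).trans (union_subset hf.2.1 hg.2.1), fun i => ?_⟩
    obtain ⟨p, hp, hfp⟩ := hf.2.2 i
    obtain ⟨q, hq, hgq⟩ := hg.2.2 i
    exact ⟨p + q, totalDegree_add_le hp hq, fun x hx => by simp [hfp x hx, hgq x hx]⟩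
  smul_mem' a f hf := by
    obtain ⟨f', hf'⟩ := hf.1.2
    refine ⟨⟨hf.1.1.const_smul a, _, hf'.smul a⟩,
      (Function.support_const_smul_subset a f).trans hf.2.1, fun i => ?_⟩
    obtain ⟨p, hp, hfp⟩ := hf.2.2 i
    exact ⟨a • p, (MvPolynomial.totalDegree_smul_le a p).trans hp, fun x hx => by
      simp [hfp x hx]⟩

theorem QSub_le (k : ℕ) : QSub 𝒯 k ≤ LinearMap.range (piecewise 𝒯 k) := by
  intro f hf
  choose p hp hfp using hf.2.2
  exact ⟨fun i => ⟨p i, (MvPolynomial.mem_restrictTotalDegree _ _ _).2 (hp i)⟩,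
    (eq_indicator 𝒯 hf.2.1 fun i x hx _ => hfp i x hx).symm⟩

instance (k : ℕ) : FiniteDimensional ℝ (QSub 𝒯 k) := Submodule.finiteDimensional_of_le (QSub_le 𝒯 k)

/-- The space `Q_k` with zero boundary values, as a submodule. -/
def Q₀Sub (k : ℕ) : Submodule ℝ (Vec → ℝ) := QSub 𝒯 k ⊓ H1₀Sub 𝒯.isOpen_Ω

/-- The space `RT_k` with zero normal boundary values, as a submodule. -/
def RT₀Sub (k : ℕ) : Submodule ℝ (Vec → Vec) where
  carrier := RT₀ 𝒯 k
  zero_mem' := by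
    have h := (Hdiv₀Sub 𝒯.isOpen_Ω).zero_mem
    exact ⟨⟨h.1, by simp, fun i => ⟨0, 0, by simp [PolyLE], by simp [PolyLE], fun x _ _ => by
      ext j; simp [evalVec]⟩⟩, h⟩
  add_mem' {f g} hf hg := by
    have h := (Hdiv₀Sub 𝒯.isOpen_Ω).add_mem hf.2 hg.2
    refine ⟨⟨h.1, (Function.support_add f g).trans (union_subset hf.1.2.1 hg.1.2.1),
      fun i => ?_⟩, h⟩
    obtain ⟨p, q, hp, hq, hf⟩ := hf.1.2.2 i
    obtain ⟨p', q', hp', hq', hg⟩ := hg.1.2.2 i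
    exact ⟨p + p', q + q', fun j => totalDegree_add_le (hp j) (hp' j), totalDegree_add_le hq hq',
      fun x hx hi => by
        rw [Pi.add_apply, hf x hx hi, hg x hx hi, evalVec_add, map_add, add_smul]; abel⟩
  smul_mem' a f hf := by
    have h := (Hdiv₀Sub 𝒯.isOpen_Ω).smul_mem a hf.2
    refine ⟨⟨h.1, (Function.support_const_smul_subset a f).trans hf.1.2.1, fun i => ?_⟩, h⟩
    obtain ⟨p, q, hp, hq, hf⟩ := hf.1.2.2 i
    exact ⟨a • p, a • q, fun j => (MvPolynomial.totalDegree_smul_le a _).trans (hp j),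
      (MvPolynomial.totalDegree_smul_le a _).trans hq, fun x hx hi => by
        rw [Pi.smul_apply, hf x hx hi]; ext j; simp [evalVec]; ring⟩

/-- For `E` an ambient finite-dimensional space suffices, because its time derivative is never used
as a test function. For `B` the argument needs the derivative to lie in `RT₀` itself. -/
theorem Ned_subset_PW : Ned 𝒯 k ⊆ PW 𝒯 (k + 1) := by
  intro f hf
  choose p q hp hq hf' using hf.2.2
  refine mem_PW 𝒯 (fun i => p i + crossX (q i)) (fun i j => totalDegree_add_le
    ((hp i j).trans k.le_succ) (totalDegree_crossX_le (hq i) j)) ?_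
  exact eq_indicator 𝒯 (G := fun i => evalVec (p i + crossX (q i))) hf.2.1 fun i x hx hi => by
    rw [hf' i x hx hi, evalVec_add, evalVec_crossX]

theorem evalVec_X_mul (q : MvPolynomial (Fin 3) ℝ) (x : Vec) :
    evalVec (fun j => MvPolynomial.X j * q) x = MvPolynomial.eval x q • x := by
  ext j; simp [evalVec, mul_comm]

theorem RT₀_subset_PW : RT₀Sub 𝒯 k ≤ PW 𝒯 (k + 1) := by
  intro f hf
  choose p q hp hq hf' using hf.1.2.2
  refine mem_PW 𝒯 (fun i => p i + fun j => MvPolynomial.X j * q i) (fun i j =>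
    totalDegree_add_le ((hp i j).trans k.le_succ) (totalDegree_X_mul_le (hq i) j)) ?_
  exact eq_indicator 𝒯 (G := fun i => evalVec (p i + fun j => MvPolynomial.X j * q i))
    hf.1.2.1 fun i x hx hi => by
    rw [hf' i x hx hi, evalVec_add, evalVec_X_mul]

instance (k : ℕ) : FiniteDimensional ℝ (RT₀Sub 𝒯 k) :=
  Submodule.finiteDimensional_of_le (RT₀_subset_PW 𝒯)

/-- The indicator plays the part of the constant `1`, since discrete functions vanish off `Ωh`. Its
weak gradient is zero because derivatives of test functions supported in `Ω` integrate to zero. -/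
theorem one_mem_Q : 𝒯.Ωh.indicator 1 ∈ Q 𝒯 k := by
  have hcont : ContinuousOn (𝒯.Ωh.indicator (1 : Vec → ℝ)) 𝒯.Ωh :=
    continuousOn_const.congr fun x hx => indicator_of_mem hx _
  refine ⟨⟨𝒯.memL2_of_continuousOn hcont, 0, memL2_zero, fun ψ hψ => ?_⟩,
    support_indicator_subset, fun i => ⟨1, by simp [PolyLE], fun x hx => ?_⟩⟩
  · have h1 : ∫ x in 𝒯.Ω, 𝒯.Ωh.indicator (1 : Vec → ℝ) x * divC ψ x = ∫ x in 𝒯.Ω, divC ψ x :=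
      setIntegral_congr_fun 𝒯.isOpen_Ω.measurableSet fun x hx => by
        simp [indicator_of_mem (𝒯.Ω_subset_Ωh hx)]
    have h2 : ∀ j : Fin 3, ∫ x in 𝒯.Ω, pderiv j (fun y => ψ y j) x = 0 := fun j => by
      rw [setIntegral_eq_of_test ((hψ.apply j).pderiv j) fun x hx => hx]
      have := integral_mul_pderiv (F := fun _ => (1 : ℝ)) contDiff_const (hψ.apply j) j
      simpa [pderiv] using this
    rw [h1]
    unfold divC
    rw [integral_finsetSum _ fun j _ => (((hψ.apply j).pderiv j).memL2 :
      MemL2 𝒯.Ω _).integrable (by norm_num)]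
    simp [h2]
  · simp [indicator_of_mem (𝒯.cell_subset_Ωh i hx)]

theorem grad_one : ∀ᵐ x ∂volume.restrict 𝒯.Ω, grad 𝒯.Ω (𝒯.Ωh.indicator 1) x = 0 := by
  have h := isWeakGrad_grad (one_mem_Q 𝒯 (k := 0)).1.2
  refine 𝒯.ae_Ω_of_cells fun i => ?_
  have hz : ∀ x, gradC (fun _ => (1 : ℝ)) x = 0 := fun x => by ext j; simp [gradC, pderiv]
  have hL : MemL2 𝒯.Ω (gradC fun _ => (1 : ℝ)) := by
    rw [show gradC (fun _ => (1 : ℝ)) = 0 from funext hz]; exact memL2_zero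
  filter_upwards [h.ae_eq_gradC isOpen_interior (𝒯.interior_cell_subset_Ω i) contDiff_const hL
    fun x hx => indicator_of_mem (𝒯.cell_subset_Ωh i (interior_subset hx)) _] with x hx hxi
  rw [hx hxi, hz]

/-- A polynomial vanishing almost everywhere on a cell interior is the zero polynomial, so vanishing
in `L²` becomes vanishing at every point. Thus the `L²` form is definite on pointwise functions,
without passing to classes. -/
theorem eq_zero_of_integral_sq {f : Vec → ℝ} (hf : f ∈ Q 𝒯 k)
    (h : ∫ x in 𝒯.Ω, f x * f x = 0) : f = 0 := by
  have hae : ∀ᵐ x ∂volume.restrict 𝒯.Ω, f x = 0 := by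
    have := (integral_eq_zero_iff_of_nonneg (fun x => mul_self_nonneg (f x))
      (integrable_mul hf.1.1 hf.1.1)).1 h
    filter_upwards [this] with x hx using mul_self_eq_zero.1 hx
  rw [𝒯.ae_restrict_iff_Ω] at hae
  ext1 x
  by_cases hx : x ∈ 𝒯.Ωh
  · obtain ⟨p, -, hp⟩ := hf.2.2 (𝒯.cellOf x)
    have hp0 : p = 0 := by
      refine eq_zero_of_eval_eq_zero_on_open isOpen_interior
        (𝒯.interior_nonempty (𝒯.cellOf x)) ?_
      have hz : EqOn (fun y : Vec => MvPolynomial.eval y p) 0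
          (interior (𝒯.cell (𝒯.cellOf x))) := by
        refine Measure.eqOn_open_of_ae_eq (μ := (volume : Measure Vec)) ?_ isOpen_interior
          (continuous_eval p).continuousOn continuousOn_const
        rw [Filter.EventuallyEq, ae_restrict_iff' isOpen_interior.measurableSet]
        filter_upwards [hae] with y hy hyi
        rw [← hp y (interior_subset hyi)]
        exact hy (𝒯.interior_cell_subset_Ω _ hyi)
      exact hz
    rw [hp x (𝒯.mem_cell_cellOf hx), hp0]
    simp
  · exact Function.notMem_support.1 fun h => hx (hf.2.1 h)

/-- Riesz representation in finite dimension: a definite form embeds `W` in its dual, and equality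
of dimensions makes the embedding onto. This is what gives meaning to the choices in `projQ` and
`divW`. -/
theorem exists_l2Rep (W : Submodule ℝ (Vec → ℝ)) (hW : W ≤ QSub 𝒯 k) (ℓ : (Vec → ℝ) → ℝ)
    (hadd : ∀ φ ∈ W, ∀ χ ∈ W, ℓ (φ + χ) = ℓ φ + ℓ χ)
    (hsmul : ∀ (a : ℝ), ∀ φ ∈ W, ℓ (a • φ) = a * ℓ φ) :
    ∃ d, d ∈ (W : Set (Vec → ℝ)) ∧
      ∀ φ ∈ (W : Set (Vec → ℝ)), ∫ x in 𝒯.Ω, d x * φ x = ℓ φ := by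
  have : FiniteDimensional ℝ W := Submodule.finiteDimensional_of_le hW
  have hL2 : ∀ f : W, MemL2 𝒯.Ω f.1 := fun f => (hW f.2).1.1
  let β : W →ₗ[ℝ] W →ₗ[ℝ] ℝ := LinearMap.mk₂ ℝ (fun f g => ∫ x in 𝒯.Ω, f.1 x * g.1 x)
    (fun f f' g => by
      simp only [Submodule.coe_add, Pi.add_apply, add_mul]
      exact integral_add (integrable_mul (hL2 f) (hL2 g)) (integrable_mul (hL2 f') (hL2 g)))
    (fun a f g => by
      simp only [Submodule.coe_smul, Pi.smul_apply, smul_eq_mul, mul_assoc]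
      exact integral_const_mul _ _)
    (fun f g g' => by
      simp only [Submodule.coe_add, Pi.add_apply, mul_add]
      exact integral_add (integrable_mul (hL2 f) (hL2 g)) (integrable_mul (hL2 f) (hL2 g')))
    (fun a f g => by
      simp only [Submodule.coe_smul, Pi.smul_apply, smul_eq_mul, mul_left_comm _ a]
      exact integral_const_mul _ _)
  have hinj : Function.Injective β := by
    rw [injective_iff_map_eq_zero]
    intro f hf
    have h0 : β f f = 0 := by rw [hf]; rfl
    exact Subtype.ext (eq_zero_of_integral_sq 𝒯 (hW f.2) h0)
  have hsurj : Function.Surjective β :=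
    (LinearMap.injective_iff_surjective_of_finrank_eq_finrank
      (Subspace.dual_finrank_eq (K := ℝ) (V := W)).symm).1 hinj
  obtain ⟨d, hd⟩ := hsurj
    { toFun := fun φ => ℓ φ.1
      map_add' := fun φ χ => hadd _ φ.2 _ χ.2
      map_smul' := fun a φ => hsmul a _ φ.2 }
  exact ⟨d.1, d.2, fun φ hφ => LinearMap.congr_fun hd ⟨φ, hφ⟩⟩

theorem projQ_spec {g : Vec → ℝ} (hg : ContinuousOn g 𝒯.Ωh) :
    projQ 𝒯 k g ∈ Q 𝒯 k ∧
      ∀ φ ∈ Q 𝒯 k, ∫ x in 𝒯.Ω, projQ 𝒯 k g x * φ x = ∫ x in 𝒯.Ω, g x * φ x := by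
  have hg2 := 𝒯.memL2_of_continuousOn hg
  refine Classical.epsilon_spec (exists_l2Rep 𝒯 (QSub 𝒯 k) le_rfl
    (fun φ => ∫ x in 𝒯.Ω, g x * φ x) (fun φ hφ χ hχ => ?_) fun a φ hφ => ?_)
  · simp only [Pi.add_apply, mul_add]
    exact integral_add (integrable_mul hg2 hφ.1.1) (integrable_mul hg2 hχ.1.1)
  · simp only [Pi.smul_apply, smul_eq_mul, mul_left_comm _ a]
    exact integral_const_mul _ _

theorem memL2_grad {f : Vec → ℝ} (hf : f ∈ Q 𝒯 k) : MemL2 𝒯.Ω (grad 𝒯.Ω f) :=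
  (isWeakGrad_grad hf.1.2).1

/-- The represented functional is linear because chosen weak gradients are additive and homogeneous
up to null sets. -/
theorem divW_spec {E : Vec → Vec} (hE : MemL2 𝒯.Ω E) :
    divW 𝒯 k E ∈ Q₀ 𝒯 k ∧ ∀ φ ∈ Q₀ 𝒯 k,
      ∫ x in 𝒯.Ω, divW 𝒯 k E x * φ x = -∫ x in 𝒯.Ω, E x ⬝ᵥ grad 𝒯.Ω φ x := by
  refine Classical.epsilon_spec (exists_l2Rep 𝒯 (Q₀Sub 𝒯 k) inf_le_left
    (fun φ => -∫ x in 𝒯.Ω, E x ⬝ᵥ grad 𝒯.Ω φ x) (fun φ hφ χ hχ => ?_) fun a φ hφ => ?_)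
  · have h := ((isWeakGrad_grad hφ.1.1.2).add hφ.1.1.1 hχ.1.1.1
      (isWeakGrad_grad hχ.1.1.2)).ae_eq 𝒯.isOpen_Ω
    rw [← neg_add, ← integral_add (integrable_dot hE (memL2_grad 𝒯 hφ.1))
      (integrable_dot hE (memL2_grad 𝒯 hχ.1))]
    congr 1
    refine integral_congr_ae ?_
    filter_upwards [h] with x hx
    rw [hx, Pi.add_apply, dotProduct_add]
  · have h := ((isWeakGrad_grad hφ.1.1.2).smul a).ae_eq 𝒯.isOpen_Ω
    rw [mul_neg, ← integral_const_mul]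
    congr 1
    refine integral_congr_ae ?_
    filter_upwards [h] with x hx
    rw [hx, Pi.smul_apply, dotProduct_smul, smul_eq_mul]

/-- The gradient of `p i` at the points that are attributed to the cell `i`. -/
def piecewiseGrad (p : ι → MvPolynomial (Fin 3) ℝ) : Vec → Vec :=
  𝒯.Ωh.indicator fun x => evalVec (gradPoly (p (𝒯.cellOf x))) x

theorem grad_ae_eq_piecewiseGrad {φ : Vec → ℝ} (hφ : φ ∈ Q 𝒯 k)
    {p : ι → MvPolynomial (Fin 3) ℝ} (hp : ∀ i, ∀ x ∈ 𝒯.cell i, φ x = MvPolynomial.eval x (p i)) :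
    ∀ᵐ x ∂volume.restrict 𝒯.Ω, grad 𝒯.Ω φ x = piecewiseGrad 𝒯 p x := by
  refine 𝒯.ae_Ω_of_cells fun i => ?_
  have hL : MemL2 𝒯.Ω (gradC fun y => MvPolynomial.eval y (p i)) := by
    rw [show gradC (fun y => MvPolynomial.eval y (p i)) = evalVec (gradPoly (p i)) from
      funext (gradC_eval (p i))]
    exact 𝒯.memL2_of_continuousOn (continuous_evalVec _).continuousOn
  filter_upwards [(isWeakGrad_grad hφ.1.2).ae_eq_gradC isOpen_interior
    (𝒯.interior_cell_subset_Ω i) (contDiff_eval (p i)) hL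
    fun x hx => hp i x (interior_subset hx)] with x hx hxi
  rw [hx hxi, gradC_eval]
  exact (eqOn_interior_cell 𝒯 (fun i => evalVec (gradPoly (p i))) i hxi).symm

/-- First step of the discrete de Rham complex. The representative `piecewiseGrad` is used instead
of `grad` because membership in `Ned` and the particle current involve point values, whereas `grad`
is determined only up to null sets. -/
theorem piecewiseGrad_mem_Ned₀ {φ : Vec → ℝ} (hφ : φ ∈ Q₀ 𝒯 (k + 1))
    {p : ι → MvPolynomial (Fin 3) ℝ} (hdeg : ∀ i, (p i).totalDegree ≤ k + 1)
    (hp : ∀ i, ∀ x ∈ 𝒯.cell i, φ x = MvPolynomial.eval x (p i)) :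
    piecewiseGrad 𝒯 p ∈ Ned₀ 𝒯 k ∧
      ∀ᵐ x ∂volume.restrict 𝒯.Ω, curl 𝒯.Ω (piecewiseGrad 𝒯 p) x = 0 := by
  have hL : MemL2 𝒯.Ω (piecewiseGrad 𝒯 p) :=
    memL2_piecewise 𝒯 fun i => continuous_evalVec (gradPoly (p i))
  have hw : ∀ ψ : Vec → Vec, IsTest univ ψ →
      ∫ x in 𝒯.Ω, piecewiseGrad 𝒯 p x ⬝ᵥ curlC ψ x = ∫ x in 𝒯.Ω, (0 : Vec → Vec) x ⬝ᵥ ψ x := by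
    intro ψ hψ
    simp only [Pi.zero_apply, zero_dotProduct, integral_zero]
    rw [← integral_gradient_dot_curlC hφ.2 hψ]
    refine integral_congr_ae ?_
    filter_upwards [grad_ae_eq_piecewiseGrad 𝒯 hφ.1 hp] with x hx
    rw [hx]
  have hmem := mem_Hcurl₀_of 𝒯.isOpen_Ω hL memL2_zero hw
  have hcurl : IsWeakCurl 𝒯.Ω (piecewiseGrad 𝒯 p) 0 :=
    ⟨memL2_zero, fun ψ hψ => hw ψ (hψ.mono (subset_univ _))⟩
  refine ⟨⟨⟨hmem.1, support_indicator_subset, fun i => ⟨gradPoly (p i), 0,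
    fun j => totalDegree_pderiv_le (hdeg i) j, by simp [PolyLE], fun x hx hi => ?_⟩⟩, hmem⟩,
    hcurl.ae_eq 𝒯.isOpen_Ω⟩
  have h0 : evalVec (0 : Fin 3 → MvPolynomial (Fin 3) ℝ) x = 0 := by ext j; simp [evalVec]
  rw [h0, map_zero, add_zero]
  exact indicator_cell 𝒯 (fun i => evalVec (gradPoly (p i))) hx hi

/-- Second step of the complex: `curlPoly_crossX` gives the local form of the curl, while the zero
tangential trace of `E` gives zero divergence and zero normal trace. -/
theorem exists_curl_mem_RT₀ {E : Vec → Vec} (hE : E ∈ Ned₀ 𝒯 k) :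
    ∃ τ ∈ RT₀ 𝒯 k, (∀ᵐ x ∂volume.restrict 𝒯.Ω, curl 𝒯.Ω E x = τ x) ∧
      ∀ φ : Vec → ℝ, IsTest univ φ → ∫ x in 𝒯.Ω, τ x ⬝ᵥ gradC φ x = 0 := by
  choose p q hp hq hE' using hE.1.2.2
  set P : ι → Fin 3 → MvPolynomial (Fin 3) ℝ := fun i => p i + crossX (q i) with hP
  have hEP : E = 𝒯.Ωh.indicator fun x => evalVec (P (𝒯.cellOf x)) x :=
    eq_indicator 𝒯 (G := fun i => evalVec (P i)) hE.1.2.1 fun i x hx hi => by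
      rw [hE' i x hx hi, hP, evalVec_add, evalVec_crossX]
  set τ : Vec → Vec := 𝒯.Ωh.indicator fun x => evalVec (curlPoly (P (𝒯.cellOf x))) x with hτ
  have hτL : MemL2 𝒯.Ω τ := memL2_piecewise 𝒯 fun i => continuous_evalVec (curlPoly (P i))
  have hae : ∀ᵐ x ∂volume.restrict 𝒯.Ω, curl 𝒯.Ω E x = τ x := by
    refine 𝒯.ae_Ω_of_cells fun i => ?_
    have hL : MemL2 𝒯.Ω (curlC (evalVec (P i))) := by
      rw [show curlC (evalVec (P i)) = evalVec (curlPoly (P i)) from funext (curlC_evalVec (P i))]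
      exact 𝒯.memL2_of_continuousOn (continuous_evalVec _).continuousOn
    filter_upwards [(isWeakCurl_curl hE.1.1.2).ae_eq_curlC isOpen_interior
      (𝒯.interior_cell_subset_Ω i) (contDiff_evalVec (P i)) hL fun x hx => by
        rw [hEP]; exact eqOn_interior_cell 𝒯 (fun i => evalVec (P i)) i hx] with x hx hxi
    rw [hx hxi, curlC_evalVec]
    exact (eqOn_interior_cell 𝒯 (fun i => evalVec (curlPoly (P i))) i hxi).symm
  have hdiv : ∀ φ : Vec → ℝ, IsTest univ φ → ∫ x in 𝒯.Ω, τ x ⬝ᵥ gradC φ x = 0 := by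
    intro φ hφ
    rw [← integral_curl_dot_gradC hE.2 hφ]
    refine integral_congr_ae ?_
    filter_upwards [hae] with x hx
    rw [hx]
  have hmem := mem_Hdiv₀_of 𝒯.isOpen_Ω hτL (g := 0) memL2_zero fun φ hφ => by simp [hdiv φ hφ]
  refine ⟨τ, ⟨⟨hmem.1, support_indicator_subset, fun i =>
    ⟨curlPoly (p i) - fun j => q i j + q i j + eulerPoly (q i j), divPoly (q i), fun j => ?_,
      totalDegree_divPoly_le (hq i), fun x hx hi => ?_⟩⟩, hmem⟩, hae, hdiv⟩
  · exact totalDegree_sub_le (totalDegree_curlPoly_le (hp i) j)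
      (totalDegree_add_le (totalDegree_add_le (hq i j) (hq i j))
        (totalDegree_eulerPoly_le (hq i j)))
  · rw [← evalVec_X_mul, ← evalVec_add, ← curlPoly_crossX]
    exact indicator_cell 𝒯 (fun i => evalVec (curlPoly (P i))) hx hi

end FiniteElements

/-! ### Curves in finite element spaces -/

section Curves

open Filter Topology

variable {T : ℝ}

theorem ae_Ioo_of_ae_Icc {p : ℝ → Prop} (h : ∀ᵐ t ∂volume.restrict (Icc 0 T), p t) :
    ∀ᵐ t, t ∈ Ioo 0 T → p t := by
  rw [ae_restrict_iff' measurableSet_Icc] at h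
  filter_upwards [h] with t ht hmem using ht (Ioo_subset_Icc_self hmem)

/-- The two endpoints are null, so derivatives are needed only at interior times; there the values
outside `[0, T]` have no influence. -/
theorem eq_initial_of_ae_hasDerivAt_zero {F : ℝ → ℝ} (hT : 0 ≤ T)
    (hF : AbsolutelyContinuousOnInterval F 0 T) (h : ∀ᵐ t, t ∈ Ioo 0 T → HasDerivAt F 0 t) :
    ∀ t ∈ Icc 0 T, F t = F 0 := by
  have h0 : ∀ᵐ t : ℝ, t ≠ 0 := by simp [ae_iff, measure_singleton]
  have h1 : ∀ᵐ t : ℝ, t ≠ T := by simp [ae_iff, measure_singleton]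
  obtain ⟨C, hC⟩ := hF.const_of_ae_hasDerivAt_zero (by
    filter_upwards [h, h0, h1] with t ht ht0 htT hmem
    rw [uIcc_of_le hT] at hmem
    exact ht ⟨lt_of_le_of_ne hmem.1 ht0.symm, lt_of_le_of_ne hmem.2 htT⟩)
  rw [uIcc_of_le hT] at hC
  intro t ht
  rw [hC t ht, hC 0 (left_mem_Icc.2 hT)]

theorem Icc_mem_nhds_of_mem_Ioo {t : ℝ} (ht : t ∈ Ioo 0 T) : Icc 0 T ∈ 𝓝 t :=
  Icc_mem_nhds ht.1 ht.2

theorem hasDerivAt_congr_Icc {X : Type*} [NormedAddCommGroup X] [NormedSpace ℝ X] {f g : ℝ → X}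
    {f' : X} {t : ℝ} (ht : t ∈ Ioo 0 T) (h : ∀ s ∈ Icc 0 T, f s = g s) (hg : HasDerivAt g f' t) :
    HasDerivAt f f' t :=
  hg.congr_of_eventuallyEq (mem_of_superset (Icc_mem_nhds_of_mem_Ioo ht) h)

/-- Point evaluations followed by the coordinates `e j` separate the elements of `W`, so pointwise
absolute continuity controls every functional. Off `[0, T]` the curve takes the default value `0`.
-/
theorem exists_curve {F κ : Type*} [AddCommGroup F] [Module ℝ F] (W : Submodule ℝ (Vec → F))
    [FiniteDimensional ℝ W] (e : κ → F →ₗ[ℝ] ℝ) (he : ∀ v, (∀ j, e j v = 0) → v = 0)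
    (hT : 0 ≤ T) {f : ℝ → Vec → F} (hmem : ∀ t ∈ Icc 0 T, f t ∈ W)
    (hac : ∀ x j, AbsolutelyContinuousOnInterval (fun t => e j (f t x)) 0 T) :
    ∃ u : ℝ → W, (∀ t ∈ Icc 0 T, (u t : Vec → F) = f t) ∧
      ∀ L : W →ₗ[ℝ] ℝ, AbsolutelyContinuousOnInterval (fun t => L (u t)) 0 T := by
  classical
  let u : ℝ → W := fun t => if h : t ∈ Icc 0 T then ⟨f t, hmem t h⟩ else 0
  have hu : ∀ t ∈ Icc 0 T, (u t : Vec → F) = f t := fun t ht => by simp only [u, dif_pos ht]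
  refine ⟨u, hu, ?_⟩
  refine ac_linear_of_separating
    (fun (j : Vec × κ) => (e j.2 ∘ₗ LinearMap.proj j.1) ∘ₗ W.subtype) (fun v hv => ?_) fun j => ?_
  · ext1
    funext x
    exact he _ fun i => hv (x, i)
  · refine ac_congr (hac j.1 j.2) fun t ht => ?_
    rw [uIcc_of_le hT] at ht
    simp [hu t ht]

theorem exists_curve_scalar (W : Submodule ℝ (Vec → ℝ)) [FiniteDimensional ℝ W]
    (hT : 0 ≤ T) {f : ℝ → Vec → ℝ} (hmem : ∀ t ∈ Icc 0 T, f t ∈ W)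
    (hac : ∀ x, AbsolutelyContinuousOnInterval (fun t => f t x) 0 T) :
    ∃ u : ℝ → W, (∀ t ∈ Icc 0 T, (u t : Vec → ℝ) = f t) ∧
      ∀ L : W →ₗ[ℝ] ℝ, AbsolutelyContinuousOnInterval (fun t => L (u t)) 0 T :=
  exists_curve W (fun _ : Unit => LinearMap.id) (fun _ hv => hv ()) hT hmem fun x _ => hac x

theorem exists_curve_vec (W : Submodule ℝ (Vec → Vec)) [FiniteDimensional ℝ W]
    (hT : 0 ≤ T) {f : ℝ → Vec → Vec} (hmem : ∀ t ∈ Icc 0 T, f t ∈ W)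
    (hac : ∀ x, AbsolutelyContinuousOnInterval (fun t => f t x) 0 T) :
    ∃ u : ℝ → W, (∀ t ∈ Icc 0 T, (u t : Vec → Vec) = f t) ∧
      ∀ L : W →ₗ[ℝ] ℝ, AbsolutelyContinuousOnInterval (fun t => L (u t)) 0 T :=
  exists_curve W (fun i : Fin 3 => LinearMap.proj i) (fun _ hv => funext hv) hT hmem
    fun x i => ac_apply (hac x) i

theorem hasDerivAt_scalar_curve {W : Submodule ℝ (Vec → ℝ)} {u : ℝ → W} {f : ℝ → Vec → ℝ}
    (hu : ∀ t ∈ Icc 0 T, (u t : Vec → ℝ) = f t) {t : ℝ} (ht : t ∈ Ioo 0 T) {v : W}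
    (hv : ∀ L : W →ₗ[ℝ] ℝ, HasDerivAt (fun s => L (u s)) (L v) t) (x : Vec) :
    HasDerivAt (fun s => f s x) (v.1 x) t :=
  hasDerivAt_congr_Icc ht (fun s hs => by simp [← hu s hs])
    (hv (LinearMap.proj x ∘ₗ W.subtype))

theorem hasDerivAt_vec_curve {W : Submodule ℝ (Vec → Vec)} {u : ℝ → W} {f : ℝ → Vec → Vec}
    (hu : ∀ t ∈ Icc 0 T, (u t : Vec → Vec) = f t) {t : ℝ} (ht : t ∈ Ioo 0 T) {v : W}
    (hv : ∀ L : W →ₗ[ℝ] ℝ, HasDerivAt (fun s => L (u s)) (L v) t) (x : Vec) :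
    HasDerivAt (fun s => f s x) (v.1 x) t :=
  hasDerivAt_pi.2 fun i => hasDerivAt_congr_Icc ht (fun s hs => by simp [← hu s hs])
    (hv ((LinearMap.proj i ∘ₗ LinearMap.proj x) ∘ₗ W.subtype))

variable {ι : Type*} [Fintype ι] (𝒯 : Mesh ι)

/-- The supremum over the compact set `Ωh` is bounded by coordinates, as basis functions are bounded
there. This makes the domination below uniform in `x`. -/
theorem exists_bound_coord {W : Submodule ℝ (Vec → ℝ)} [FiniteDimensional ℝ W]
    (hW : ∀ f ∈ W, ContinuousOn f 𝒯.Ωh) :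
    ∃ (n : ℕ) (L : Fin n → W →ₗ[ℝ] ℝ) (D : ℝ), 0 ≤ D ∧ ∀ f g : W, ∀ x ∈ 𝒯.Ωh,
      |f.1 x - g.1 x| ≤ D * ∑ j, |L j f - L j g| := by
  choose D hD using fun j => 𝒯.isCompact_Ωh.exists_bound_of_continuousOn
    (hW _ (Module.finBasis ℝ W j).2)
  refine ⟨_, (Module.finBasis ℝ W).coord, ∑ j, |D j|, Finset.sum_nonneg fun _ _ => abs_nonneg _,
    fun f g x hx => ?_⟩
  have h := linear_eq_sum (LinearMap.proj x ∘ₗ W.subtype : W →ₗ[ℝ] ℝ) (f - g)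
  have h' : f.1 x - g.1 x = ∑ j, ((Module.finBasis ℝ W).coord j f
      - (Module.finBasis ℝ W).coord j g) * (Module.finBasis ℝ W j).1 x := by
    simp only [map_sub] at h
    exact h
  rw [h', Finset.mul_sum]
  refine (Finset.abs_sum_le_sum_abs _ _).trans (Finset.sum_le_sum fun j _ => ?_)
  rw [abs_mul, mul_comm]
  refine mul_le_mul_of_nonneg_right ?_ (abs_nonneg _)
  exact ((hD j x hx).trans (le_abs_self _)).trans
    (Finset.single_le_sum (f := fun j => |D j|) (fun _ _ => abs_nonneg _) (Finset.mem_univ j))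

theorem ac_integral_of_dominated {σ : Type*} [Fintype σ] {h : ℝ → Vec → ℝ} {g : σ → ℝ → ℝ} {C : ℝ}
    (hT : 0 ≤ T) (hint : ∀ s ∈ Icc 0 T, Integrable (h s) (volume.restrict 𝒯.Ω))
    (hg : ∀ j, AbsolutelyContinuousOnInterval (g j) 0 T)
    (hdom : ∀ s ∈ Icc 0 T, ∀ t ∈ Icc 0 T, ∀ x ∈ 𝒯.Ωh,
      |h s x - h t x| ≤ C * ∑ j, |g j s - g j t|) :
    AbsolutelyContinuousOnInterval (fun s => ∫ x in 𝒯.Ω, h s x) 0 T := by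
  refine ac_of_dist_le hg (C * volume.real 𝒯.Ω) fun s hs t ht => ?_
  rw [uIcc_of_le hT] at hs ht
  simp only [Real.dist_eq]
  rw [← integral_sub (hint s hs) (hint t ht), mul_right_comm, ← Real.norm_eq_abs]
  exact norm_setIntegral_le_of_norm_le_const
    ((measure_mono 𝒯.Ω_subset_Ωh).trans_lt 𝒯.isCompact_Ωh.measure_lt_top)
    fun x hx => hdom s hs t ht x (𝒯.Ω_subset_Ωh hx)

theorem eventually_abs_sub_le {g : ℝ → ℝ} {t : ℝ} (hg : DifferentiableAt ℝ g t) :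
    ∃ K, ∀ᶠ s in 𝓝 t, |g s - g t| ≤ K * |s - t| := by
  obtain ⟨K, hK⟩ := hg.hasDerivAt.isBigO_sub.bound
  exact ⟨K, hK⟩

/-- Differentiation under the integral, with increments compared only to the base time `t`. Such a
bound follows from differentiability of the `g j` at the single point `t`, which is all that holds
for absolutely continuous coordinates. -/
theorem hasDerivAt_integral_of_dominated {σ : Type*} [Fintype σ] {h : ℝ → Vec → ℝ} {h' : Vec → ℝ}
    {g : σ → ℝ → ℝ} {C t : ℝ} (hC : 0 ≤ C) (ht : t ∈ Ioo 0 T)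
    (hint : ∀ s ∈ Icc 0 T, Integrable (h s) (volume.restrict 𝒯.Ω))
    (hint' : Integrable h' (volume.restrict 𝒯.Ω))
    (hg : ∀ j, DifferentiableAt ℝ (g j) t)
    (hdom : ∀ s ∈ Icc 0 T, ∀ x ∈ 𝒯.Ωh, |h s x - h t x| ≤ C * ∑ j, |g j s - g j t|)
    (hderiv : ∀ x ∈ 𝒯.Ωh, HasDerivAt (fun s => h s x) (h' x) t) :
    HasDerivAt (fun s => ∫ x in 𝒯.Ω, h s x) (∫ x in 𝒯.Ω, h' x) t := by
  choose K hK using fun j => eventually_abs_sub_le (hg j)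
  have hev : ∀ᶠ s in 𝓝 t, s ∈ Icc 0 T ∧ ∀ j, |g j s - g j t| ≤ K j * |s - t| :=
    (eventually_mem_set.2 (Icc_mem_nhds_of_mem_Ioo ht)).and (eventually_all.2 hK)
  have key := hasFDerivAt_integral_of_dominated_loc_of_lip' (μ := volume.restrict 𝒯.Ω) (𝕜 := ℝ)
    (F := h) (x₀ := t) (bound := fun _ => C * ∑ j, K j) hev
    (F' := fun x => (ContinuousLinearMap.toSpanSingleton ℝ (h' x) : ℝ →L[ℝ] ℝ))
    (fun s hs => (hint s hs.1).aestronglyMeasurable) (hint t (Ioo_subset_Icc_self ht))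
    ?_ ?_ (integrable_const _) ?_
  · have h2 := key.2.hasDerivAt
    rwa [ContinuousLinearMap.integral_apply key.1, show (∫ x in 𝒯.Ω,
      (ContinuousLinearMap.toSpanSingleton ℝ (h' x) : ℝ →L[ℝ] ℝ) 1) = ∫ x in 𝒯.Ω, h' x by simp]
      at h2
  · exact (ContinuousLinearMap.toSpanSingletonCLE (𝕜 := ℝ) (E := ℝ)).continuous
      |>.comp_aestronglyMeasurable
      hint'.aestronglyMeasurable
  · rw [𝒯.ae_restrict_iff_Ω]
    refine Eventually.of_forall fun x hx s hs => ?_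
    refine (hdom s hs.1 x (𝒯.Ω_subset_Ωh hx)).trans ?_
    rw [Real.norm_eq_abs, mul_assoc, Finset.sum_mul]
    exact mul_le_mul_of_nonneg_left (Finset.sum_le_sum fun j _ => hs.2 j) hC
  · rw [𝒯.ae_restrict_iff_Ω]
    exact Eventually.of_forall fun x hx => (hderiv x (𝒯.Ω_subset_Ωh hx)).hasFDerivAt

end Curves

/-! ### The relativistic factor -/

section Gamma

theorem sqrt_sq_add_sq_le (a b d e : ℝ) :
    √(a ^ 2 + b ^ 2 + d ^ 2 + e ^ 2) ≤ |a| + |b| + |d| + |e| := by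
  rw [Real.sqrt_le_iff]
  refine ⟨by positivity, ?_⟩
  rw [← sq_abs a, ← sq_abs b, ← sq_abs d, ← sq_abs e]
  nlinarith [mul_nonneg (abs_nonneg a) (abs_nonneg b), mul_nonneg (abs_nonneg a) (abs_nonneg d),
    mul_nonneg (abs_nonneg a) (abs_nonneg e), mul_nonneg (abs_nonneg b) (abs_nonneg d),
    mul_nonneg (abs_nonneg b) (abs_nonneg e), mul_nonneg (abs_nonneg d) (abs_nonneg e)]

/-- The square root is the Euclidean norm of `(r, κ a)` in `ℝ⁴`; apply the reverse triangle
inequality. -/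
theorem abs_sqrt_sub_sqrt_le (r r' : ℝ) (a b : Vec) (κ : ℝ) :
    |√(r ^ 2 + κ ^ 2 * (a ⬝ᵥ a)) - √(r' ^ 2 + κ ^ 2 * (b ⬝ᵥ b))|
      ≤ |r - r'| + |κ| * ∑ i, |a i - b i| := by
  let v : ℝ → Vec → EuclideanSpace ℝ (Fin 4) := fun r a => !₂[r, κ * a 0, κ * a 1, κ * a 2]
  have hv : ∀ r a, √(r ^ 2 + κ ^ 2 * (a ⬝ᵥ a)) = ‖v r a‖ := by
    intro r a
    rw [EuclideanSpace.norm_eq]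
    congr 1
    simp [v, Fin.sum_univ_four, dotProduct, Fin.sum_univ_three, sq_abs]
    ring
  rw [hv, hv]
  refine (abs_norm_sub_norm_le _ _).trans ?_
  rw [EuclideanSpace.norm_eq]
  simp only [Fin.sum_univ_four, Real.norm_eq_abs, sq_abs]
  refine (sqrt_sq_add_sq_le _ _ _ _).trans (le_of_eq ?_)
  simp [v, Fin.sum_univ_three, ← mul_sub, abs_mul]
  ring

variable {m c : ℝ}

theorem dot_self_nonneg (u : Vec) : 0 ≤ u ⬝ᵥ u :=
  Finset.sum_nonneg fun i _ => mul_self_nonneg (u i)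

theorem one_le_gam (m c : ℝ) (u : Vec) : 1 ≤ gam m c u := by
  rw [gam, Real.one_le_sqrt]
  have := dot_self_nonneg u
  have : 0 ≤ (u ⬝ᵥ u) / (m ^ 2 * c ^ 2) := by positivity
  linarith

theorem gam_pos (m c : ℝ) (u : Vec) : 0 < gam m c u := zero_lt_one.trans_le (one_le_gam m c u)

theorem gam_eq (m c : ℝ) (u : Vec) :
    gam m c u = √(1 ^ 2 + ((m * c)⁻¹) ^ 2 * (u ⬝ᵥ u)) := by
  rw [gam]
  congr 1
  rw [inv_pow, mul_pow, div_eq_inv_mul, one_pow]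

theorem hasDerivAt_dot_self {U : ℝ → Vec} {U' : Vec} {t : ℝ} (h : HasDerivAt U U' t) :
    HasDerivAt (fun s => U s ⬝ᵥ U s) (2 * (U t ⬝ᵥ U')) t := by
  have hi := fun i => hasDerivAt_pi.1 h i
  have := HasDerivAt.fun_sum (u := Finset.univ) fun i _ => (hi i).fun_mul (hi i)
  refine this.congr_deriv ?_
  rw [dotProduct, Finset.mul_sum]
  exact Finset.sum_congr rfl fun i _ => by ring

theorem hasDerivAt_gam {U : ℝ → Vec} {U' : Vec} {t : ℝ} (h : HasDerivAt U U' t) :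
    HasDerivAt (fun s => gam m c (U s)) ((U t ⬝ᵥ U') / (m ^ 2 * c ^ 2 * gam m c (U t))) t := by
  have hpos := gam_pos m c (U t)
  have hne : 1 + (U t ⬝ᵥ U t) / (m ^ 2 * c ^ 2) ≠ 0 := by
    intro h0
    rw [gam, h0, Real.sqrt_zero] at hpos
    exact lt_irrefl _ hpos
  have := (((hasDerivAt_dot_self h).div_const (m ^ 2 * c ^ 2)).const_add 1).sqrt hne
  refine this.congr_deriv ?_
  change _ / (2 * gam m c (U t)) = _
  rw [div_div, mul_left_comm, mul_div_mul_left _ _ two_ne_zero]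

/-- Particles do not exceed the speed of light: each component of `u / (m γ)` is at most `c` in
absolute value. This makes trajectories Lipschitz. -/
theorem abs_apply_le_gam (hm : 0 < m) (hc : 0 < c) (u : Vec) (i : Fin 3) :
    |u i| ≤ m * c * gam m c u := by
  have h1 : u i * u i ≤ u ⬝ᵥ u :=
    Finset.single_le_sum (f := fun i => u i * u i) (fun i _ => mul_self_nonneg (u i))
      (Finset.mem_univ i)
  refine abs_le_of_sq_le_sq ?_ (by have := gam_pos m c u; positivity)
  have h2 : gam m c u ^ 2 = 1 + (u ⬝ᵥ u) / (m ^ 2 * c ^ 2) :=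
    Real.sq_sqrt (by have := dot_self_nonneg u; positivity)
  rw [mul_pow, h2, mul_pow]
  have : m ^ 2 * c ^ 2 * (1 + (u ⬝ᵥ u) / (m ^ 2 * c ^ 2)) = m ^ 2 * c ^ 2 + u ⬝ᵥ u := by
    field_simp
  rw [this]
  nlinarith [sq_nonneg (m * c)]

theorem ac_gam {a b : ℝ} {U : ℝ → Vec} (hU : AbsolutelyContinuousOnInterval U a b) :
    AbsolutelyContinuousOnInterval (fun t => gam m c (U t)) a b := by
  refine ac_of_dist_le (fun i => ac_apply hU i) |(m * c)⁻¹| fun s _ t _ => ?_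
  have h := abs_sqrt_sub_sqrt_le 1 1 (U s) (U t) (m * c)⁻¹
  simpa only [Real.dist_eq, gam_eq, sub_self, abs_zero, zero_add] using h

/-- The density of the fluid energy. -/
def fluidEnergy (m c r : ℝ) (M : Vec) : ℝ := r * (fluidGam m c r M - 1) * c ^ 2

theorem fluidGam_eq (hm : m ≠ 0) (r : ℝ) (M : Vec) :
    fluidGam m c r M = √(1 + (M ⬝ᵥ M) / (r ^ 2 * c ^ 2)) := by
  rw [fluidGam, gam]
  congr 2
  simp only [smul_dotProduct, dotProduct_smul, smul_eq_mul]
  field_simp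

theorem fluidGam_pos (m c r : ℝ) (M : Vec) : 0 < fluidGam m c r M := gam_pos _ _ _

theorem abs_mul_fluidGam (hm : m ≠ 0) (hc : 0 < c) {r : ℝ} (hr : r ≠ 0) (M : Vec) :
    |r| * fluidGam m c r M = √(r ^ 2 + (c⁻¹) ^ 2 * (M ⬝ᵥ M)) := by
  rw [fluidGam_eq hm, ← Real.sqrt_sq_eq_abs, ← Real.sqrt_mul (sq_nonneg r)]
  congr 1
  field_simp

/-- By `abs_mul_fluidGam`, `|r| γ` is the norm of `(r, M / c)`, so the energy density is Lipschitz
with constants independent of the distance of `r` from zero. The two densities must have equal sign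
for the absolute values to be removed. -/
theorem abs_fluidEnergy_sub_le (hm : m ≠ 0) (hc : 0 < c) {r r' : ℝ} (hr : 0 < r * r')
    (M M' : Vec) :
    |fluidEnergy m c r M - fluidEnergy m c r' M'|
      ≤ 2 * c ^ 2 * |r - r'| + c * ∑ i, |M i - M' i| := by
  have hr0 : r ≠ 0 := left_ne_zero_of_mul hr.ne'
  have hr0' : r' ≠ 0 := right_ne_zero_of_mul hr.ne'
  have h1 := abs_mul_fluidGam hm hc hr0 M
  have h2 := abs_mul_fluidGam hm hc hr0' M'
  have h := abs_sqrt_sub_sqrt_le r r' M M' c⁻¹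
  rw [← h1, ← h2, abs_of_pos (inv_pos.2 hc)] at h
  have key : |r * fluidGam m c r M - r' * fluidGam m c r' M'|
      ≤ |r - r'| + c⁻¹ * ∑ i, |M i - M' i| := by
    rcases pos_and_pos_or_neg_and_neg_of_mul_pos hr with ⟨hp, hp'⟩ | ⟨hn, hn'⟩
    · rwa [abs_of_pos hp, abs_of_pos hp'] at h
    · rw [abs_of_neg hn, abs_of_neg hn', ← abs_neg] at h
      convert h using 2
      ring
  have e : fluidEnergy m c r M - fluidEnergy m c r' M'
      = c ^ 2 * ((r * fluidGam m c r M - r' * fluidGam m c r' M') - (r - r')) := by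
    unfold fluidEnergy; ring
  rw [e, abs_mul, abs_of_pos (pow_pos hc 2)]
  calc c ^ 2 * |(r * fluidGam m c r M - r' * fluidGam m c r' M') - (r - r')|
      ≤ c ^ 2 * ((|r - r'| + c⁻¹ * ∑ i, |M i - M' i|) + |r - r'|) :=
        mul_le_mul_of_nonneg_left ((abs_sub _ _).trans (by gcongr)) (by positivity)
    _ = 2 * c ^ 2 * |r - r'| + c * ∑ i, |M i - M' i| := by field_simp; ring

/-- The chain rule identifies `c ^ 2 * fluidPot` and `fluidVel` as the partial derivatives of the
energy density in density and momentum. This is the Hamiltonian structure behind the scheme. -/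
theorem hasDerivAt_fluidEnergy (hm : m ≠ 0) (hc : 0 < c) {r : ℝ → ℝ} {M : ℝ → Vec} {r' t : ℝ}
    {M' : Vec} (hr : HasDerivAt r r' t) (hM : HasDerivAt M M' t) (h0 : r t ≠ 0) :
    HasDerivAt (fun s => fluidEnergy m c (r s) (M s))
      (c ^ 2 * (fluidPot m c (r t) (M t) * r') + M' ⬝ᵥ fluidVel m c (r t) (M t)) t := by
  have hγ := fluidGam_pos m c (r t) (M t)
  have hu : HasDerivAt (fun s => (m / r s) • M s) _ t :=
    ((hasDerivAt_const t m).fun_div hr h0).fun_smul hM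
  have hg := hasDerivAt_gam (m := m) (c := c) hu
  have hall := (hr.fun_mul (hg.sub_const 1)).mul_const (c ^ 2)
  refine hall.congr_deriv ?_
  change (r' * (fluidGam m c (r t) (M t) - 1)
    + r t * (_ / (m ^ 2 * c ^ 2 * fluidGam m c (r t) (M t))))
    * c ^ 2 = _
  simp only [fluidPot, fluidVel, dotProduct_add, smul_dotProduct, dotProduct_smul, smul_eq_mul]
  rw [dotProduct_comm M' (M t)]
  set γ := fluidGam m c (r t) (M t)
  field_simp
  ring

theorem continuous_dot : Continuous fun u : Vec => u ⬝ᵥ u := by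
  unfold dotProduct
  fun_prop

theorem continuousOn_fluidGam {s : Set Vec} {r : Vec → ℝ} {M : Vec → Vec} (hr : ContinuousOn r s)
    (hM : ContinuousOn M s) (h0 : ∀ x ∈ s, r x ≠ 0) :
    ContinuousOn (fun x => fluidGam m c (r x) (M x)) s := by
  have hu : ContinuousOn (fun x => (m / r x) • M x) s := (continuousOn_const.div hr h0).smul hM
  exact (continuousOn_const.add ((continuous_dot.comp_continuousOn hu).div_const _)).sqrt

theorem continuousOn_fluidVel {s : Set Vec} {r : Vec → ℝ} {M : Vec → Vec} (hr : ContinuousOn r s)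
    (hM : ContinuousOn M s) (h0 : ∀ x ∈ s, r x ≠ 0) :
    ContinuousOn (fun x => fluidVel m c (r x) (M x)) s :=
  ((hr.mul (continuousOn_fluidGam hr hM h0)).inv₀ fun x hx =>
    mul_ne_zero (h0 x hx) (fluidGam_pos _ _ _ _).ne').smul hM

theorem continuousOn_fluidPot (hc : 0 < c) {s : Set Vec} {r : Vec → ℝ} {M : Vec → Vec}
    (hr : ContinuousOn r s) (hM : ContinuousOn M s) (h0 : ∀ x ∈ s, r x ≠ 0) :
    ContinuousOn (fun x => fluidPot m c (r x) (M x)) s := by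
  have hγ := continuousOn_fluidGam (m := m) (c := c) hr hM h0
  exact (hγ.sub continuousOn_const).sub ((continuous_dot.comp_continuousOn hM).div
    (((hr.pow 2).mul continuousOn_const).mul hγ) fun x hx => mul_ne_zero
      (mul_ne_zero (pow_ne_zero 2 (h0 x hx)) (pow_ne_zero 2 hc.ne')) (fluidGam_pos _ _ _ _).ne')

theorem continuousOn_fluidEnergy {s : Set Vec} {r : Vec → ℝ} {M : Vec → Vec}
    (hr : ContinuousOn r s) (hM : ContinuousOn M s) (h0 : ∀ x ∈ s, r x ≠ 0) :
    ContinuousOn (fun x => fluidEnergy m c (r x) (M x)) s :=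
  (hr.mul ((continuousOn_fluidGam hr hM h0).sub continuousOn_const)).mul continuousOn_const

end Gamma

/-! ### Finite element functions along particle trajectories -/

section Particles

open Filter Topology

variable {ι : Type*} [Fintype ι] (𝒯 : Mesh ι) {k : ℕ} {T : ℝ}

theorem abs_sub_le_of_ae_abs_deriv_le {f : ℝ → ℝ} {C : ℝ} (hT : 0 ≤ T)
    (hf : AbsolutelyContinuousOnInterval f 0 T)
    (hd : ∀ᵐ t, t ∈ Ioo 0 T → |deriv f t| ≤ C) :
    ∀ s ∈ Icc 0 T, ∀ t ∈ Icc 0 T, |f t - f s| ≤ C * |t - s| := by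
  intro s hs t ht
  have hsub : uIcc s t ⊆ uIcc 0 T := by
    rw [uIcc_of_le hT]; exact (convex_Icc 0 T).ordConnected.uIcc_subset hs ht
  rw [← (hf.mono hsub).integral_deriv_eq_sub]
  refine intervalIntegral.norm_integral_le_of_norm_le_const_ae (f := deriv f) ?_
  have h0 : ∀ᵐ t : ℝ, t ≠ 0 := by simp [ae_iff, measure_singleton]
  have h1 : ∀ᵐ t : ℝ, t ≠ T := by simp [ae_iff, measure_singleton]
  filter_upwards [hd, h0, h1] with r hr hr0 hrT hmem
  have hr' := hsub (uIoc_subset_uIcc hmem)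
  rw [uIcc_of_le hT] at hr'
  exact hr ⟨lt_of_le_of_ne hr'.1 hr0.symm, lt_of_le_of_ne hr'.2 hrT⟩

theorem fderiv_eq_gradC_dot (f : Vec → ℝ) (x v : Vec) : fderiv ℝ f x v = v ⬝ᵥ gradC f x := by
  have := LinearMap.pi_apply_eq_sum_univ (fderiv ℝ f x).toLinearMap v
  have e : ∀ i : Fin 3, (fun j => if i = j then (1 : ℝ) else 0) = Pi.single i 1 := fun i => by
    ext j
    simp [Pi.single_apply, eq_comm]
  simp only [e] at this
  exact this

variable {X : ℝ → Vec} {φ : Vec → ℝ} {p : ι → MvPolynomial (Fin 3) ℝ} {C : ℝ}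

/-- Polynomials are Lipschitz on compact convex cells. The sum of the cell constants serves all
cells, and `dist_le_of_finite_closed_cover` handles passages between them. -/
theorem abs_sub_le_along_curve (hX : ContinuousOn X (Icc 0 T))
    (hXL : ∀ s ∈ Icc 0 T, ∀ t ∈ Icc 0 T, ∀ i, |X t i - X s i| ≤ C * |t - s|) (hC : 0 ≤ C)
    (hmem : ∀ t ∈ Icc 0 T, X t ∈ 𝒯.Ωh)
    (hp : ∀ i, ∀ x ∈ 𝒯.cell i, φ x = MvPolynomial.eval x (p i)) :
    ∃ L, 0 ≤ L ∧ ∀ s ∈ Icc 0 T, ∀ t ∈ Icc 0 T, |φ (X t) - φ (X s)| ≤ L * |t - s| := by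
  choose K hK using fun i => ((contDiff_eval (p i)).of_le
    (show (1 : WithTop ℕ∞) ≤ ∞ by simp)).contDiffOn.exists_lipschitzOnWith one_ne_zero
    (𝒯.convex_cell i) (𝒯.isCompact_cell i)
  set L : ℝ := (∑ i, (K i : ℝ)) * C
  have hL : 0 ≤ L := mul_nonneg (Finset.sum_nonneg fun _ _ => NNReal.coe_nonneg _) hC
  have hcell : ∀ i, ∀ s ∈ Icc 0 T, ∀ t ∈ Icc 0 T, X s ∈ 𝒯.cell i → X t ∈ 𝒯.cell i →
      |φ (X t) - φ (X s)| ≤ L * |t - s| := by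
    intro i s hs t ht hsi hti
    rw [hp i _ hsi, hp i _ hti]
    refine ((hK i).dist_le_mul _ hti _ hsi).trans ?_
    rw [mul_assoc]
    have hd : dist (X t) (X s) ≤ C * |t - s| :=
      (dist_pi_le_iff (by positivity)).2 fun j => hXL s hs t ht j
    have hKi : (K i : ℝ) ≤ ∑ i, (K i : ℝ) :=
      Finset.single_le_sum (f := fun i => (K i : ℝ)) (fun _ _ => NNReal.coe_nonneg _)
        (Finset.mem_univ i)
    exact mul_le_mul hKi hd dist_nonneg (Finset.sum_nonneg fun _ _ => NNReal.coe_nonneg _)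
  have hle : ∀ s ∈ Icc 0 T, ∀ t ∈ Icc 0 T, s ≤ t → |φ (X t) - φ (X s)| ≤ L * (t - s) := by
    intro s hs t ht hst
    have hsub : Icc s t ⊆ Icc 0 T := Icc_subset_Icc hs.1 ht.2
    refine dist_le_of_finite_closed_cover (g := fun r => φ (X r)) Finset.univ
      (τ := fun i => X ⁻¹' 𝒯.cell i) hst (fun i _ => ?_) (fun r hr => ?_) fun i _ r hr r' hr' => ?_
    · exact (hX.mono hsub).preimage_isClosed_of_isClosed isClosed_Icc (𝒯.isCompact_cell i).isClosed
    · simpa [Mesh.Ωh] using hmem r (hsub hr)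
    · exact hcell i r (hsub hr.1) r' (hsub hr'.1) hr.2 hr'.2
  refine ⟨L, hL, fun s hs t ht => ?_⟩
  rcases le_total s t with h | h
  · rw [abs_of_nonneg (sub_nonneg.2 h)]
    exact hle s hs t ht h
  · rw [abs_sub_comm, abs_sub_comm t, abs_of_nonneg (sub_nonneg.2 h)]
    exact hle t ht s hs h

theorem ac_along_curve (hT : 0 ≤ T) {L : ℝ} {g : ℝ → ℝ} (hL : 0 ≤ L)
    (h : ∀ s ∈ Icc 0 T, ∀ t ∈ Icc 0 T, |g t - g s| ≤ L * |t - s|) :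
    AbsolutelyContinuousOnInterval g 0 T := by
  refine LipschitzOnWith.absolutelyContinuousOnInterval (K := ⟨L, hL⟩) ?_
  rw [uIcc_of_le hT]
  exact LipschitzOnWith.of_dist_le_mul fun t ht s hs => h s hs t ht

/-- A chain rule in spite of the jumps of `∇φ`. On the set of times spent in a fixed closed cell,
`φ` along the curve is a polynomial along the curve, and at almost every time of that set the
derivatives agree. Applied to the cell selected by `cellOf`, this gives the value of
`piecewiseGrad`, even for a curve that stays in a face. -/
theorem ae_hasDerivAt_along_curve (hT : 0 ≤ T)
    (hac : AbsolutelyContinuousOnInterval (fun t => φ (X t)) 0 T)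
    (hmem : ∀ t ∈ Icc 0 T, X t ∈ 𝒯.Ωh)
    (hp : ∀ i, ∀ x ∈ 𝒯.cell i, φ x = MvPolynomial.eval x (p i)) :
    ∀ᵐ t, t ∈ Ioo 0 T → ∀ X' : Vec, HasDerivAt X X' t →
      HasDerivAt (fun s => φ (X s)) (X' ⬝ᵥ piecewiseGrad 𝒯 p (X t)) t := by
  have hcells : ∀ᵐ t : ℝ, ∀ i, t ∈ Icc 0 T ∩ X ⁻¹' 𝒯.cell i → _ :=
    ae_all_iff.2 fun i => ae_deriv_eq_of_eqOn (Icc 0 T ∩ X ⁻¹' 𝒯.cell i)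
  filter_upwards [hcells, hac.ae_differentiableAt] with t ht hd htI X' hX'
  have htI' := Ioo_subset_Icc_self htI
  rw [uIcc_of_le hT] at hd
  have hi := 𝒯.mem_cell_cellOf (hmem t htI')
  set i := 𝒯.cellOf (X t) with hidef
  have hpoly : HasDerivAt (fun s => MvPolynomial.eval (X s) (p i))
      (X' ⬝ᵥ piecewiseGrad 𝒯 p (X t)) t := by
    have h1 := ((contDiff_eval (p i)).differentiable (by simp) (X t)).hasFDerivAt.comp_hasDerivAt
      t hX'
    refine h1.congr_deriv ?_
    rw [fderiv_eq_gradC_dot, gradC_eval, piecewiseGrad,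
      indicator_cell 𝒯 (fun i => evalVec (gradPoly (p i))) hi hidef.symm]
  have heq := ht i ⟨htI', hi⟩ (fun s => φ (X s)) (fun s => MvPolynomial.eval (X s) (p i))
    (fun s hs => hp i _ hs.2) _ _ (hd htI').hasDerivAt hpoly
  rw [← heq]
  exact (hd htI').hasDerivAt

end Particles

/-! ### Time derivatives of integrals of finite element functions -/

section Families

open Filter Topology

variable {ι : Type*} [Fintype ι] {𝒯 : Mesh ι} {k : ℕ} {T : ℝ}

theorem scalar_family (hT : 0 ≤ T) {f : ℝ → Vec → ℝ} (hmem : ∀ t ∈ Icc 0 T, f t ∈ Q 𝒯 k)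
    (hac : ∀ x, AbsolutelyContinuousOnInterval (fun t => f t x) 0 T) :
    ∃ u : ℝ → QSub 𝒯 k, (∀ t ∈ Icc 0 T, (u t : Vec → ℝ) = f t) ∧
      (∀ L : QSub 𝒯 k →ₗ[ℝ] ℝ, AbsolutelyContinuousOnInterval (fun t => L (u t)) 0 T) ∧
      ∀ᵐ t, t ∈ Ioo 0 T → ∃ v : QSub 𝒯 k,
        (∀ L : QSub 𝒯 k →ₗ[ℝ] ℝ, HasDerivAt (fun s => L (u s)) (L v) t) ∧
        ∀ x, HasDerivAt (fun s => f s x) (v.1 x) t := by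
  obtain ⟨u, hu, huac⟩ := exists_curve_scalar (QSub 𝒯 k) hT hmem hac
  refine ⟨u, hu, huac, ?_⟩
  filter_upwards [ae_hasDerivAt_linear huac] with t ht htI
  obtain ⟨v, hv⟩ := ht (by rw [uIcc_of_le hT]; exact Ioo_subset_Icc_self htI)
  exact ⟨v, hv, hasDerivAt_scalar_curve hu htI hv⟩

theorem vec_family (W : Submodule ℝ (Vec → Vec)) [FiniteDimensional ℝ W] (hT : 0 ≤ T)
    {f : ℝ → Vec → Vec} (hmem : ∀ t ∈ Icc 0 T, f t ∈ W)
    (hac : ∀ x, AbsolutelyContinuousOnInterval (fun t => f t x) 0 T) :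
    ∃ u : ℝ → W, (∀ t ∈ Icc 0 T, (u t : Vec → Vec) = f t) ∧
      (∀ L : W →ₗ[ℝ] ℝ, AbsolutelyContinuousOnInterval (fun t => L (u t)) 0 T) ∧
      ∀ᵐ t, t ∈ Ioo 0 T → ∃ v : W,
        (∀ L : W →ₗ[ℝ] ℝ, HasDerivAt (fun s => L (u s)) (L v) t) ∧
        ∀ x, HasDerivAt (fun s => f s x) (v.1 x) t := by
  obtain ⟨u, hu, huac⟩ := exists_curve_vec W hT hmem hac
  refine ⟨u, hu, huac, ?_⟩
  filter_upwards [ae_hasDerivAt_linear huac] with t ht htI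
  obtain ⟨v, hv⟩ := ht (by rw [uIcc_of_le hT]; exact Ioo_subset_Icc_self htI)
  exact ⟨v, hv, hasDerivAt_vec_curve hu htI hv⟩

theorem integral_mul_family (hT : 0 ≤ T) {f : ℝ → Vec → ℝ} (hmem : ∀ t ∈ Icc 0 T, f t ∈ Q 𝒯 k)
    (hac : ∀ x, AbsolutelyContinuousOnInterval (fun t => f t x) 0 T) {χ : Vec → ℝ}
    (hχ : MemL2 𝒯.Ω χ) :
    AbsolutelyContinuousOnInterval (fun t => ∫ x in 𝒯.Ω, f t x * χ x) 0 T ∧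
      ∀ᵐ t, t ∈ Ioo 0 T → HasDerivAt (fun s => ∫ x in 𝒯.Ω, f s x * χ x)
        (∫ x in 𝒯.Ω, deriv (fun s => f s x) t * χ x) t := by
  obtain ⟨u, hu, huac, hder⟩ := scalar_family hT hmem hac
  let L : QSub 𝒯 k →ₗ[ℝ] ℝ :=
    { toFun := fun g => ∫ x in 𝒯.Ω, g.1 x * χ x
      map_add' := fun g g' => by
        simp only [Submodule.coe_add, Pi.add_apply, add_mul]
        exact integral_add (integrable_mul g.2.1.1 hχ) (integrable_mul g'.2.1.1 hχ)
      map_smul' := fun a g => by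
        simp only [Submodule.coe_smul, Pi.smul_apply, smul_eq_mul, mul_assoc]
        exact integral_const_mul _ _ }
  have hL : ∀ t ∈ Icc 0 T, ∫ x in 𝒯.Ω, f t x * χ x = L (u t) := fun t ht => by
    rw [← hu t ht]; rfl
  refine ⟨ac_congr (huac L) fun t ht => hL t (by rwa [uIcc_of_le hT] at ht), ?_⟩
  filter_upwards [hder] with t ht htI
  obtain ⟨v, hv, hx⟩ := ht htI
  simp only [fun x => (hx x).deriv]
  exact hasDerivAt_congr_Icc htI hL (hv L)

theorem integral_dot_family {W : Submodule ℝ (Vec → Vec)} [FiniteDimensional ℝ W]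
    (hW : ∀ f ∈ W, MemL2 𝒯.Ω f) (hT : 0 ≤ T) {f : ℝ → Vec → Vec} (hmem : ∀ t ∈ Icc 0 T, f t ∈ W)
    (hac : ∀ x, AbsolutelyContinuousOnInterval (fun t => f t x) 0 T) {χ : Vec → Vec}
    (hχ : MemL2 𝒯.Ω χ) :
    AbsolutelyContinuousOnInterval (fun t => ∫ x in 𝒯.Ω, f t x ⬝ᵥ χ x) 0 T ∧
      ∀ᵐ t, t ∈ Ioo 0 T → HasDerivAt (fun s => ∫ x in 𝒯.Ω, f s x ⬝ᵥ χ x)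
        (∫ x in 𝒯.Ω, deriv (fun s => f s x) t ⬝ᵥ χ x) t := by
  obtain ⟨u, hu, huac, hder⟩ := vec_family W hT hmem hac
  let L : W →ₗ[ℝ] ℝ :=
    { toFun := fun g => ∫ x in 𝒯.Ω, g.1 x ⬝ᵥ χ x
      map_add' := fun g g' => by
        simp only [Submodule.coe_add, Pi.add_apply, add_dotProduct]
        exact integral_add (integrable_dot (hW _ g.2) hχ) (integrable_dot (hW _ g'.2) hχ)
      map_smul' := fun a g => by
        simp only [Submodule.coe_smul, Pi.smul_apply, smul_dotProduct]
        exact integral_const_mul _ _ }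
  have hL : ∀ t ∈ Icc 0 T, ∫ x in 𝒯.Ω, f t x ⬝ᵥ χ x = L (u t) := fun t ht => by
    rw [← hu t ht]; rfl
  refine ⟨ac_congr (huac L) fun t ht => hL t (by rwa [uIcc_of_le hT] at ht), ?_⟩
  filter_upwards [hder] with t ht htI
  obtain ⟨v, hv, hx⟩ := ht htI
  simp only [fun x => (hx x).deriv]
  exact hasDerivAt_congr_Icc htI hL (hv L)

theorem integral_sq_family {W : Submodule ℝ (Vec → Vec)} [FiniteDimensional ℝ W]
    (hW : ∀ f ∈ W, MemL2 𝒯.Ω f) (hT : 0 ≤ T) {f : ℝ → Vec → Vec} (hmem : ∀ t ∈ Icc 0 T, f t ∈ W)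
    (hac : ∀ x, AbsolutelyContinuousOnInterval (fun t => f t x) 0 T) :
    AbsolutelyContinuousOnInterval (fun t => ∫ x in 𝒯.Ω, f t x ⬝ᵥ f t x) 0 T ∧
      ∀ᵐ t, t ∈ Ioo 0 T → HasDerivAt (fun s => ∫ x in 𝒯.Ω, f s x ⬝ᵥ f s x)
        (2 * ∫ x in 𝒯.Ω, deriv (fun s => f s x) t ⬝ᵥ f t x) t := by
  obtain ⟨u, hu, huac, hder⟩ := vec_family W hT hmem hac
  let β : W →ₗ[ℝ] W →ₗ[ℝ] ℝ := LinearMap.mk₂ ℝ (fun f g => ∫ x in 𝒯.Ω, f.1 x ⬝ᵥ g.1 x)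
    (fun f f' g => by
      simp only [Submodule.coe_add, Pi.add_apply, add_dotProduct]
      exact integral_add (integrable_dot (hW _ f.2) (hW _ g.2))
        (integrable_dot (hW _ f'.2) (hW _ g.2)))
    (fun a f g => by
      simp only [Submodule.coe_smul, Pi.smul_apply, smul_dotProduct]
      exact integral_const_mul _ _)
    (fun f g g' => by
      simp only [Submodule.coe_add, Pi.add_apply, dotProduct_add]
      exact integral_add (integrable_dot (hW _ f.2) (hW _ g.2))
        (integrable_dot (hW _ f.2) (hW _ g'.2)))
    (fun a f g => by
      simp only [Submodule.coe_smul, Pi.smul_apply, dotProduct_smul]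
      exact integral_const_mul _ _)
  have hβ : ∀ t ∈ Icc 0 T, ∫ x in 𝒯.Ω, f t x ⬝ᵥ f t x = β (u t) (u t) := fun t ht => by
    rw [← hu t ht]; rfl
  refine ⟨ac_congr (ac_bilinear huac β) fun t ht => hβ t (by rwa [uIcc_of_le hT] at ht), ?_⟩
  filter_upwards [hder] with t ht htI
  obtain ⟨v, hv, hx⟩ := ht htI
  simp only [fun x => (hx x).deriv]
  refine (hasDerivAt_congr_Icc htI hβ (hasDerivAt_bilinear hv β)).congr_deriv ?_
  rw [two_mul, ← hu t (Ioo_subset_Icc_self htI)]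
  change (∫ x in 𝒯.Ω, v.1 x ⬝ᵥ (u t).1 x) + (∫ x in 𝒯.Ω, (u t).1 x ⬝ᵥ v.1 x) = _
  simp only [dotProduct_comm ((u t).1 _)]

/-- By the intermediate value theorem `f` keeps its sign. For the density at a fixed point this
supplies the sign condition of the Lipschitz bound, without positivity of `ρ`. -/
theorem mul_pos_of_ne_zero {f : ℝ → ℝ} (hf : ContinuousOn f (Icc 0 T))
    (h0 : ∀ t ∈ Icc 0 T, f t ≠ 0) : ∀ s ∈ Icc 0 T, ∀ t ∈ Icc 0 T, 0 < f s * f t := by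
  intro s hs t ht
  by_contra hcon
  have hzero : (0 : ℝ) ∈ f '' Icc 0 T := by
    rcases mul_nonpos_iff.1 (not_lt.1 hcon) with ⟨h1, h2⟩ | ⟨h1, h2⟩
    · exact isPreconnected_Icc.intermediate_value ht hs hf ⟨h2, h1⟩
    · exact isPreconnected_Icc.intermediate_value hs ht hf ⟨h1, h2⟩
  obtain ⟨r, hr, hr0⟩ := hzero
  exact h0 r hr hr0

theorem integral_dot_projQ3 {z : Vec → Vec} (hz : ContinuousOn z 𝒯.Ωh) {v : Vec → Vec}
    (hv : ∀ i, (fun x => v x i) ∈ Q 𝒯 k) :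
    ∫ x in 𝒯.Ω, v x ⬝ᵥ projQ3 𝒯 k z x = ∫ x in 𝒯.Ω, v x ⬝ᵥ z x := by
  have hzi : ∀ i, ContinuousOn (fun x => z x i) 𝒯.Ωh := continuousOn_pi.1 hz
  have hswap : ∀ z : Vec → Vec, (∀ i, MemL2 𝒯.Ω fun x => z x i) →
      ∫ x in 𝒯.Ω, v x ⬝ᵥ z x = ∑ i, ∫ x in 𝒯.Ω, z x i * v x i := fun z hz => by
    simp only [dotProduct]
    rw [integral_finsetSum _ fun i _ => integrable_mul (hv i).1.1 (hz i)]
    simp only [mul_comm]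
  rw [hswap z fun i => 𝒯.memL2_of_continuousOn (hzi i),
    hswap (projQ3 𝒯 k z) fun i => memL2_of_mem_Q 𝒯 (projQ_spec 𝒯 (hzi i)).1]
  exact Finset.sum_congr rfl fun i _ => (projQ_spec 𝒯 (hzi i)).2 _ (hv i)

theorem abs_fluidEnergy_sub_le_sum {m c D : ℝ} {σ : Type*} [Fintype σ] (hm : 0 < m) (hc : 0 < c)
    {R R' : Option (Fin 3) → ℝ} (hsign : 0 < R none * R' none) {G : Option (Fin 3) → σ → ℝ}
    (hR : ∀ o, |R o - R' o| ≤ D * ∑ j, G o j) :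
    |fluidEnergy m c (R none) (fun i => R (some i))
        - fluidEnergy m c (R' none) fun i => R' (some i)|
      ≤ ((2 * c ^ 2 + c) * D) * ∑ o : Option (Fin 3) × σ, G o.1 o.2 := by
  refine (abs_fluidEnergy_sub_le hm.ne' hc hsign _ _).trans ?_
  calc 2 * c ^ 2 * |R none - R' none| + c * ∑ i, |R (some i) - R' (some i)|
      ≤ (2 * c ^ 2 + c) * |R none - R' none|
          + (2 * c ^ 2 + c) * ∑ i, |R (some i) - R' (some i)| := by
        have h1 : 0 ≤ |R none - R' none| := abs_nonneg _
        have h2 : 0 ≤ ∑ i, |R (some i) - R' (some i)| := Finset.sum_nonneg fun _ _ => abs_nonneg _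
        gcongr
        · linarith
        · nlinarith [sq_nonneg c]
    _ = (2 * c ^ 2 + c) * ∑ o, |R o - R' o| := by rw [Fintype.sum_option, mul_add]
    _ ≤ (2 * c ^ 2 + c) * ∑ o, D * ∑ j, G o j := by
        gcongr with o _
        exact hR o
    _ = _ := by rw [Fintype.sum_prod_type, ← Finset.mul_sum, mul_assoc]

/-- The uniform Lipschitz bound allows differentiation under the integral. The exact partial
derivatives are then replaced by their projections, which changes nothing since they are integrated
against elements of `Q`. -/
theorem fluidEnergy_family {m c : ℝ} (hm : 0 < m) (hc : 0 < c) (hT : 0 ≤ T) {ρ : ℝ → Vec → ℝ}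
    {M : ℝ → Vec → Vec} (hρmem : ∀ t ∈ Icc 0 T, ρ t ∈ Q 𝒯 k)
    (hMmem : ∀ t ∈ Icc 0 T, ∀ i, (fun x => M t x i) ∈ Q 𝒯 k)
    (hρac : ∀ x, AbsolutelyContinuousOnInterval (fun t => ρ t x) 0 T)
    (hMac : ∀ x, AbsolutelyContinuousOnInterval (fun t => M t x) 0 T)
    (hρ : ∀ t ∈ Icc 0 T, ∀ x ∈ 𝒯.Ωh, ρ t x ≠ 0) :
    AbsolutelyContinuousOnInterval (fun t => ∫ x in 𝒯.Ω, fluidEnergy m c (ρ t x) (M t x)) 0 T ∧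
      ∀ᵐ t, t ∈ Ioo 0 T → HasDerivAt (fun s => ∫ x in 𝒯.Ω, fluidEnergy m c (ρ s x) (M s x))
        (c ^ 2 * (∫ x in 𝒯.Ω, deriv (fun s => ρ s x) t
            * projQ 𝒯 k (fun x => fluidPot m c (ρ t x) (M t x)) x)
          + ∫ x in 𝒯.Ω, deriv (fun s => M s x) t
            ⬝ᵥ projQ3 𝒯 k (fun x => fluidVel m c (ρ t x) (M t x)) x) t := by
  -- The density (`none`) and the three momentum components (`some i`) are treated as one family of
  -- four scalar curves.
  let R : Option (Fin 3) → ℝ → Vec → ℝ := fun o t x => o.elim (ρ t x) fun i => M t x i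
  have hRmem : ∀ o, ∀ t ∈ Icc 0 T, R o t ∈ Q 𝒯 k := fun o t ht => by
    cases o with
    | none => exact hρmem t ht
    | some i => exact hMmem t ht i
  have hRac : ∀ o x, AbsolutelyContinuousOnInterval (fun t => R o t x) 0 T := fun o x => by
    cases o with
    | none => exact hρac x
    | some i => exact ac_apply (hMac x) i
  choose u hu huac hder using fun o => scalar_family hT (hRmem o) (hRac o)
  have hρc : ∀ t ∈ Icc 0 T, ContinuousOn (ρ t) 𝒯.Ωh := fun t ht =>
    continuousOn_of_mem_Q 𝒯 (hρmem t ht)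
  have hMc : ∀ t ∈ Icc 0 T, ContinuousOn (M t) 𝒯.Ωh := fun t ht =>
    continuousOn_pi.2 fun i => continuousOn_of_mem_Q 𝒯 (hMmem t ht i)
  obtain ⟨n, L, D, hD0, hD⟩ := exists_bound_coord 𝒯 (W := QSub 𝒯 k) fun f hf =>
    continuousOn_of_mem_Q 𝒯 hf
  have hint : ∀ t ∈ Icc 0 T, Integrable (fun x => fluidEnergy m c (ρ t x) (M t x))
      (volume.restrict 𝒯.Ω) := fun t ht =>
    𝒯.integrable_of_continuousOn (continuousOn_fluidEnergy (hρc t ht) (hMc t ht) (hρ t ht))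
  let g : Option (Fin 3) × Fin n → ℝ → ℝ := fun o s => L o.2 (u o.1 s)
  have hdom : ∀ s ∈ Icc 0 T, ∀ t ∈ Icc 0 T, ∀ x ∈ 𝒯.Ωh,
      |fluidEnergy m c (ρ s x) (M s x) - fluidEnergy m c (ρ t x) (M t x)|
        ≤ ((2 * c ^ 2 + c) * D) * ∑ o, |g o s - g o t| := by
    intro s hs t ht x hx
    have hsign : 0 < ρ s x * ρ t x := by
      have hcont := (hρac x).continuousOn
      rw [uIcc_of_le hT] at hcont
      exact mul_pos_of_ne_zero hcont (fun r hr => hρ r hr x hx) s hs t ht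
    have hR : ∀ o, |R o s x - R o t x| ≤ D * ∑ j, |g (o, j) s - g (o, j) t| := fun o => by
      rw [← hu o s hs, ← hu o t ht]
      exact hD (u o s) (u o t) x hx
    exact abs_fluidEnergy_sub_le_sum (R := fun o => R o s x) (R' := fun o => R o t x) hm hc hsign hR
  have hgac : ∀ o, AbsolutelyContinuousOnInterval (g o) 0 T := fun o => huac o.1 (L o.2)
  refine ⟨ac_integral_of_dominated 𝒯 hT hint hgac hdom, ?_⟩
  filter_upwards [ae_all_iff.2 hder] with t ht htI
  have htI' := Ioo_subset_Icc_self htI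
  choose v hv hvx using fun o => ht o htI
  have hρd : ∀ x, HasDerivAt (fun s => ρ s x) ((v none).1 x) t := hvx none
  have hMd : ∀ x, HasDerivAt (fun s => M s x) (fun i => (v (some i)).1 x) t := fun x =>
    hasDerivAt_pi.2 fun i => hvx (some i) x
  have hpot : ContinuousOn (fun x => fluidPot m c (ρ t x) (M t x)) 𝒯.Ωh :=
    continuousOn_fluidPot hc (hρc t htI') (hMc t htI') (hρ t htI')
  have hvel : ContinuousOn (fun x => fluidVel m c (ρ t x) (M t x)) 𝒯.Ωh :=
    continuousOn_fluidVel (hρc t htI') (hMc t htI') (hρ t htI')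
  have hvL : ∀ o, MemL2 𝒯.Ω (v o).1 := fun o => memL2_of_mem_Q 𝒯 (v o).2
  have hi1 : Integrable (fun x => fluidPot m c (ρ t x) (M t x) * (v none).1 x)
      (volume.restrict 𝒯.Ω) := integrable_mul (𝒯.memL2_of_continuousOn hpot) (hvL none)
  have hi2 : Integrable (fun x => (fun i => (v (some i)).1 x) ⬝ᵥ fluidVel m c (ρ t x) (M t x))
      (volume.restrict 𝒯.Ω) :=
    integrable_dot (memL2_pi fun i => hvL (some i)) (𝒯.memL2_of_continuousOn hvel)
  have hgd : ∀ o, DifferentiableAt ℝ (g o) t := fun o => (hv o.1 (L o.2)).differentiableAt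
  have key := hasDerivAt_integral_of_dominated 𝒯
    (h := fun s x => fluidEnergy m c (ρ s x) (M s x))
    (h' := fun x => c ^ 2 * (fluidPot m c (ρ t x) (M t x) * (v none).1 x)
      + (fun i => (v (some i)).1 x) ⬝ᵥ fluidVel m c (ρ t x) (M t x))
    (g := g) (C := (2 * c ^ 2 + c) * D) (by positivity) htI hint ((hi1.const_mul _).add hi2)
    hgd
    (fun s hs x hx => hdom s hs t htI' x hx)
    fun x hx => hasDerivAt_fluidEnergy hm.ne' hc (hρd x) (hMd x) (hρ t htI' x hx)
  refine key.congr_deriv ?_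
  rw [integral_add (hi1.const_mul _) hi2, integral_const_mul]
  simp only [fun x => (hρd x).deriv, fun x => (hMd x).deriv]
  congr 1
  · rw [← (projQ_spec 𝒯 hpot).2 _ (v none).2]
    simp only [mul_comm]
  · exact (integral_dot_projQ3 hvel fun i => (v (some i)).2).symm

end Families

/-! ### The invariants of the scheme -/

section Conservation

open Filter Topology

variable {ι : Type*} [Fintype ι] {𝒯 : Mesh ι} {k N : ℕ} {m c e : ℝ} {wt : Fin N → ℝ} {T : ℝ}
  {ρ : ℝ → Vec → ℝ} {M E B : ℝ → Vec → Vec} {X U : ℝ → Fin N → Vec}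

theorem particleMass_eq_sum {X : Fin N → Vec} (hX : ∀ p, X p ∈ 𝒯.Ωh) :
    particleMass 𝒯 wt X = ∑ p, wt p := by
  refine Finset.sum_congr rfl fun p _ => ?_
  rw [measureReal_def, Measure.dirac_apply' _ 𝒯.isCompact_Ωh.isClosed.measurableSet,
    indicator_of_mem (hX p)]
  simp

namespace IsSolution

theorem fluidMass_eq (hsol : IsSolution 𝒯 k N m c e wt T ρ M E B X U)
    (hT : 0 ≤ T) : ∀ t ∈ Icc 0 T, fluidMass 𝒯 (ρ t) = fluidMass 𝒯 (ρ 0) := by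
  have h1 := one_mem_Q 𝒯 (k := k + 1)
  obtain ⟨hac, hder⟩ := integral_mul_family hT hsol.rho_mem hsol.rho_ac (memL2_of_mem_Q 𝒯 h1)
  have hmass : ∀ t, fluidMass 𝒯 (ρ t) = ∫ x in 𝒯.Ω, ρ t x * 𝒯.Ωh.indicator 1 x := fun t => by
    rw [fluidMass, 𝒯.integral_Ωh]
    exact setIntegral_congr_fun 𝒯.isOpen_Ω.measurableSet fun x hx => by
      simp [indicator_of_mem (𝒯.Ω_subset_Ωh hx)]
  simp only [hmass]
  refine eq_initial_of_ae_hasDerivAt_zero hT hac ?_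
  filter_upwards [hder, ae_Ioo_of_ae_Icc hsol.density_eq] with t ht hdens htI
  refine (ht htI).congr_deriv ?_
  rw [hdens htI _ h1]
  refine integral_eq_zero_of_ae ?_
  filter_upwards [grad_one 𝒯] with x hx
  simp [hx]

/-- Faraday's equation is upgraded from its tested form to `∂ₜB = -c curl E` almost everywhere in
`Ω`. The right-hand side is orthogonal to all gradients of test functions, so the pairings that
define the weak divergence are constant. -/
theorem dvg_ae_eq (hsol : IsSolution 𝒯 k N m c e wt T ρ M E B X U)
    (hT : 0 ≤ T) :
    ∀ t ∈ Icc 0 T, dvg 𝒯.Ω (B t) =ᵐ[volume.restrict 𝒯.Ω] dvg 𝒯.Ω (B 0) := by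
  have hmem : ∀ t ∈ Icc 0 T, B t ∈ RT₀Sub 𝒯 k := hsol.mag_mem
  have hconst : ∀ φ : Vec → ℝ, IsTest 𝒯.Ω φ → ∀ t ∈ Icc 0 T,
      ∫ x in 𝒯.Ω, B t x ⬝ᵥ gradC φ x = ∫ x in 𝒯.Ω, B 0 x ⬝ᵥ gradC φ x := by
    intro φ hφ
    have hg : MemL2 𝒯.Ω (gradC φ) := hφ.gradC.memL2
    obtain ⟨hac, hder⟩ := integral_dot_family (𝒯 := 𝒯)
      (fun f (hf : f ∈ RT₀Sub 𝒯 k) => hf.1.1.1) hT hmem hsol.mag_ac hg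
    obtain ⟨_, _, _, hfam⟩ := vec_family (RT₀Sub 𝒯 k) hT hmem hsol.mag_ac
    refine eq_initial_of_ae_hasDerivAt_zero hT hac ?_
    filter_upwards [hder, hfam, ae_Ioo_of_ae_Icc hsol.faraday_eq] with t ht hfam hfar htI
    refine (ht htI).congr_deriv ?_
    obtain ⟨v, -, hv⟩ := hfam htI
    replace hfar := hfar htI
    simp only [fun x => (hv x).deriv] at hfar ⊢
    obtain ⟨τ, hτ, hcurl, hdiv⟩ := exists_curl_mem_RT₀ 𝒯 (hsol.elec_mem t (Ioo_subset_Icc_self htI))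
    have hτL : MemL2 𝒯.Ω τ := hτ.1.1.1
    have hvL : MemL2 𝒯.Ω v.1 := v.2.1.1.1
    -- The residual `∂ₜB + c curl E` lies in the test space, so it can be tested against itself and
    -- has zero norm.
    have hz : v.1 + c • τ ∈ RT₀Sub 𝒯 k :=
      (RT₀Sub 𝒯 k).add_mem v.2 ((RT₀Sub 𝒯 k).smul_mem c hτ)
    have hzL : MemL2 𝒯.Ω (v.1 + c • τ) := hz.1.1.1
    have hsplit : ∀ χ : Vec → Vec, MemL2 𝒯.Ω χ → ∫ x in 𝒯.Ω, (v.1 + c • τ) x ⬝ᵥ χ x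
        = (∫ x in 𝒯.Ω, v.1 x ⬝ᵥ χ x) + c * ∫ x in 𝒯.Ω, τ x ⬝ᵥ χ x := by
      intro χ hχ
      simp only [Pi.add_apply, Pi.smul_apply, add_dotProduct, smul_dotProduct, smul_eq_mul]
      rw [integral_add (integrable_dot hvL hχ) ((integrable_dot hτL hχ).const_mul c),
        integral_const_mul]
    have hsq : ∫ x in 𝒯.Ω, (v.1 + c • τ) x ⬝ᵥ (v.1 + c • τ) x = 0 := by
      have hcτ : ∫ x in 𝒯.Ω, (v.1 + c • τ) x ⬝ᵥ curl 𝒯.Ω (E t) x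
          = ∫ x in 𝒯.Ω, τ x ⬝ᵥ (v.1 + c • τ) x := by
        refine integral_congr_ae ?_
        filter_upwards [hcurl] with x hx
        rw [hx, dotProduct_comm]
      rw [hsplit _ hzL, hfar _ hz, hcτ]
      ring
    have hzero : ∀ᵐ x ∂volume.restrict 𝒯.Ω, (v.1 + c • τ) x = 0 := by
      filter_upwards [(integral_eq_zero_iff_of_nonneg (fun x => dot_self_nonneg _)
        (integrable_dot hzL hzL)).1 hsq] with x hx
      exact dotProduct_self_eq_zero.1 hx
    have h0 : ∫ x in 𝒯.Ω, (v.1 + c • τ) x ⬝ᵥ gradC φ x = 0 := by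
      refine integral_eq_zero_of_ae ?_
      filter_upwards [hzero] with x hx
      simp [hx]
    rwa [hsplit _ hg, hdiv φ (hφ.mono (subset_univ _)), mul_zero, add_zero] at h0
  intro t ht
  have hw := fun s (hs : s ∈ Icc 0 T) => isWeakDiv_dvg (hsol.mag_mem s hs).1.1.2
  have h0 : (0 : ℝ) ∈ Icc 0 T := left_mem_Icc.2 hT
  have key := ae_eq_of_integral_test 𝒯.isOpen_Ω subset_rfl (hw t ht).1 (hw 0 h0).1 fun φ hφ => by
    rw [← neg_inj, ← (hw t ht).2 φ hφ, ← (hw 0 h0).2 φ hφ]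
    exact hconst φ hφ t ht
  exact 𝒯.ae_restrict_iff_Ω.2 key

theorem continuousOn_mom (hsol : IsSolution 𝒯 k N m c e wt T ρ M E B X U)
    {t : ℝ} (ht : t ∈ Icc 0 T) : ContinuousOn (M t) 𝒯.Ωh :=
  continuousOn_pi.2 fun i => continuousOn_of_mem_Q 𝒯 (hsol.mom_mem t ht i)

theorem abs_pos_sub_le (hsol : IsSolution 𝒯 k N m c e wt T ρ M E B X U)
    (hm : 0 < m) (hc : 0 < c) (hT : 0 ≤ T) (p : Fin N) :
    ∀ s ∈ Icc 0 T, ∀ t ∈ Icc 0 T, ∀ i, |X t p i - X s p i| ≤ c * |t - s| := by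
  intro s hs t ht i
  refine abs_sub_le_of_ae_abs_deriv_le hT (ac_apply (hsol.pos_ac p) i) ?_ s hs t ht
  filter_upwards [ae_Ioo_of_ae_Icc hsol.position_eq] with t hX htI
  have hγ := gam_pos m c (U t p)
  rw [(hasDerivAt_pi.1 (hX htI p) i).deriv, Pi.smul_apply, smul_eq_mul, abs_mul,
    abs_of_pos (by positivity), inv_mul_le_iff₀ (by positivity)]
  calc |U t p i| ≤ m * c * gam m c (U t p) := abs_apply_le_gam hm hc _ i
    _ = m * gam m c (U t p) * c := by ring

/-- Ampère's equation is tested with `ν = ∇φ`, which removes the magnetic term. The fluid current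
becomes the time derivative of `∫ ρ φ`, the particle current that of `∑ wₚ φ(Xₚ)`. -/
theorem gauss_eq (hsol : IsSolution 𝒯 k N m c e wt T ρ M E B X U)
    (hm : 0 < m) (hc : 0 < c) (hT : 0 ≤ T) {φ : Vec → ℝ} (hφ : φ ∈ Q₀ 𝒯 (k + 1)) :
    ∀ t ∈ Icc 0 T, gauss 𝒯 (k + 1) m e wt (ρ t) (E t) (X t) φ
      = gauss 𝒯 (k + 1) m e wt (ρ 0) (E 0) (X 0) φ := by
  choose p hdeg hp using hφ.1.2.2
  obtain ⟨hνmem, hνcurl⟩ := piecewiseGrad_mem_Ned₀ 𝒯 hφ hdeg hp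
  have hνgrad := grad_ae_eq_piecewiseGrad 𝒯 hφ.1 hp
  set ν := piecewiseGrad 𝒯 p
  have hνL : MemL2 𝒯.Ω ν := hνmem.1.1.1
  have hφL := memL2_of_mem_Q 𝒯 hφ.1
  have hEmem : ∀ t ∈ Icc 0 T, E t ∈ PW 𝒯 (k + 1) := fun t ht =>
    Ned_subset_PW 𝒯 (hsol.elec_mem t ht).1
  obtain ⟨hEac, hEder⟩ := integral_dot_family (fun f hf => memL2_of_mem_PW 𝒯 hf) hT hEmem
    hsol.elec_ac hνL
  obtain ⟨hρac, hρder⟩ := integral_mul_family hT hsol.rho_mem hsol.rho_ac hφL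
  have hpos : ∀ q : Fin N, ∀ t ∈ Icc 0 T, X t q ∈ 𝒯.Ωh := fun q t ht => hsol.pos_mem t ht q
  have hXac : ∀ q : Fin N, AbsolutelyContinuousOnInterval (fun t => φ (X t q)) 0 T := fun q => by
    have hcont := (hsol.pos_ac q).continuousOn
    rw [uIcc_of_le hT] at hcont
    obtain ⟨L, hL, hLip⟩ := abs_sub_le_along_curve 𝒯 hcont (hsol.abs_pos_sub_le hm hc hT q) hc.le
      (hpos q) hp
    exact ac_along_curve hT hL hLip
  have hXder := ae_all_iff.2 fun q : Fin N =>
    ae_hasDerivAt_along_curve 𝒯 hT (hXac q) (hpos q) hp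
  -- The weak divergence is eliminated by its definition, leaving terms whose time dependence is
  -- explicit.
  let G : ℝ → ℝ := fun t => -(∫ x in 𝒯.Ω, E t x ⬝ᵥ ν x)
    - 4 * Real.pi * e / m * (∫ x in 𝒯.Ω, ρ t x * φ x) - 4 * Real.pi * e * ∑ q, wt q * φ (X t q)
  have hG : ∀ t ∈ Icc 0 T, gauss 𝒯 (k + 1) m e wt (ρ t) (E t) (X t) φ = G t := by
    intro t ht
    have hEL : MemL2 𝒯.Ω (E t) := memL2_of_mem_PW 𝒯 (hEmem t ht)
    obtain ⟨hd, hdiv⟩ := divW_spec 𝒯 (k := k + 1) hEL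
    have hdL := memL2_of_mem_Q 𝒯 hd.1
    have hρL := memL2_of_mem_Q 𝒯 (hsol.rho_mem t ht)
    have hgrad : ∫ x in 𝒯.Ω, E t x ⬝ᵥ grad 𝒯.Ω φ x = ∫ x in 𝒯.Ω, E t x ⬝ᵥ ν x := by
      refine integral_congr_ae ?_
      filter_upwards [hνgrad] with x hx
      rw [hx]
    have hsplit : ∀ x, (divW 𝒯 (k + 1) (E t) x - 4 * Real.pi * e * (ρ t x / m)) * φ x
        = divW 𝒯 (k + 1) (E t) x * φ x - 4 * Real.pi * e / m * (ρ t x * φ x) := fun x => by ring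
    rw [gauss, 𝒯.integral_Ωh]
    simp only [hsplit]
    rw [integral_sub (integrable_mul hdL hφL) ((integrable_mul hρL hφL).const_mul _),
      integral_const_mul, hdiv φ hφ, hgrad]
  have hGac : AbsolutelyContinuousOnInterval G 0 T :=
    (hEac.fun_neg.fun_sub (hρac.const_mul _)).fun_sub
      ((ac_sum Finset.univ fun q _ => (hXac q).const_mul (wt q)).const_mul _)
  intro t ht
  rw [hG t ht, hG 0 (left_mem_Icc.2 hT)]
  refine eq_initial_of_ae_hasDerivAt_zero hT hGac ?_ t ht
  filter_upwards [hEder, hρder, hXder, ae_Ioo_of_ae_Icc hsol.density_eq,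
    ae_Ioo_of_ae_Icc hsol.ampere_eq, ae_Ioo_of_ae_Icc hsol.position_eq]
    with t hE' hρ' hX' hdens hamp hposeq htI
  have hd := ((hE' htI).fun_neg.fun_sub ((hρ' htI).const_mul (4 * Real.pi * e / m))).fun_sub
    ((HasDerivAt.fun_sum (u := Finset.univ) fun q _ =>
      ((hX' q htI _ (hposeq htI q)).const_mul (wt q))).const_mul (4 * Real.pi * e))
  refine hd.congr_deriv ?_
  rw [hamp htI ν hνmem, hdens htI φ hφ.1]
  set w := projQ3 𝒯 (k + 1) fun x => fluidVel m c (ρ t x) (M t x)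
  have hcurl0 : ∫ x in 𝒯.Ω, B t x ⬝ᵥ curl 𝒯.Ω ν x = 0 := by
    refine integral_eq_zero_of_ae ?_
    filter_upwards [hνcurl] with x hx
    simp [hx]
  have hflux : ∫ x in 𝒯.Ω, ρ t x * (w x ⬝ᵥ grad 𝒯.Ω φ x) = ∫ x in 𝒯.Ω, ρ t x * (w x ⬝ᵥ ν x) := by
    refine integral_congr_ae ?_
    filter_upwards [hνgrad] with x hx
    rw [hx]
  have hsum : 4 * Real.pi * e * ∑ q, wt q * ((m * gam m c (U t q))⁻¹ • U t q ⬝ᵥ ν (X t q))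
      = 4 * Real.pi * e / m * ∑ q, wt q / gam m c (U t q) * (U t q ⬝ᵥ ν (X t q)) := by
    rw [Finset.mul_sum, Finset.mul_sum]
    refine Finset.sum_congr rfl fun q _ => ?_
    have hγ := (gam_pos m c (U t q)).ne'
    rw [smul_dotProduct, smul_eq_mul]
    field_simp
  rw [hcurl0, hflux, hsum]
  ring

/-- Each equation is tested with the derivative of the energy in the corresponding unknown: `η`,
`w`, `E` and `B`, up to constants. The scheme is built so that the resulting exchange terms are
antisymmetric. -/
theorem energy_eq (hsol : IsSolution 𝒯 k N m c e wt T ρ M E B X U)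
    (hm : 0 < m) (hc : 0 < c) (hT : 0 ≤ T)
    (hρ : ∀ t ∈ Icc 0 T, ∀ x ∈ 𝒯.Ωh, ρ t x ≠ 0) :
    ∀ t ∈ Icc 0 T, energy 𝒯 m c wt (ρ t) (M t) (E t) (B t) (U t)
      = energy 𝒯 m c wt (ρ 0) (M 0) (E 0) (B 0) (U 0) := by
  have hEmem : ∀ t ∈ Icc 0 T, E t ∈ PW 𝒯 (k + 1) := fun t ht =>
    Ned_subset_PW 𝒯 (hsol.elec_mem t ht).1
  have hBmem : ∀ t ∈ Icc 0 T, B t ∈ PW 𝒯 (k + 1) := fun t ht =>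
    RT₀_subset_PW 𝒯 (hsol.mag_mem t ht)
  obtain ⟨hEac, hEder⟩ := integral_sq_family (fun f hf => memL2_of_mem_PW 𝒯 hf) hT hEmem
    hsol.elec_ac
  obtain ⟨hBac, hBder⟩ := integral_sq_family (fun f hf => memL2_of_mem_PW 𝒯 hf) hT hBmem
    hsol.mag_ac
  obtain ⟨hFac, hFder⟩ := fluidEnergy_family hm hc hT hsol.rho_mem hsol.mom_mem hsol.rho_ac
    hsol.mom_ac hρ
  let H : ℝ → ℝ := fun t => (∫ x in 𝒯.Ω, fluidEnergy m c (ρ t x) (M t x))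
    + (∑ p, wt p * m * c ^ 2 * (gam m c (U t p) - 1))
    + 1 / (8 * Real.pi) * ((∫ x in 𝒯.Ω, E t x ⬝ᵥ E t x) + ∫ x in 𝒯.Ω, B t x ⬝ᵥ B t x)
  have hH : ∀ t ∈ Icc 0 T, energy 𝒯 m c wt (ρ t) (M t) (E t) (B t) (U t) = H t := by
    intro t ht
    have hEL := memL2_of_mem_PW 𝒯 (hEmem t ht)
    have hBL := memL2_of_mem_PW 𝒯 (hBmem t ht)
    rw [energy, 𝒯.integral_Ωh, 𝒯.integral_Ωh,
      integral_add (integrable_dot hEL hEL) (integrable_dot hBL hBL)]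
    congr 2
    exact Finset.sum_congr rfl fun p _ => by ring
  have hHac : AbsolutelyContinuousOnInterval H 0 T :=
    (hFac.fun_add (ac_sum Finset.univ fun p _ =>
      ((ac_gam (hsol.vel_ac p)).fun_sub (ac_const 1)).const_mul (wt p * m * c ^ 2))).fun_add
      ((hEac.fun_add hBac).const_mul _)
  intro t ht
  rw [hH t ht, hH 0 (left_mem_Icc.2 hT)]
  refine eq_initial_of_ae_hasDerivAt_zero hT hHac ?_ t ht
  filter_upwards [hEder, hBder, hFder, ae_Ioo_of_ae_Icc hsol.density_eq,
    ae_Ioo_of_ae_Icc hsol.momentum_eq, ae_Ioo_of_ae_Icc hsol.ampere_eq,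
    ae_Ioo_of_ae_Icc hsol.faraday_eq, ae_Ioo_of_ae_Icc hsol.velocity_eq]
    with t hE' hB' hF' hdens hmom hamp hfar hvel htI
  have htI' := Ioo_subset_Icc_self htI
  have hd := ((hF' htI).fun_add (HasDerivAt.fun_sum (u := Finset.univ) fun p _ =>
    ((hasDerivAt_gam (m := m) (c := c) (hvel htI p)).sub_const 1).const_mul
      (wt p * m * c ^ 2))).fun_add
    (((hE' htI).fun_add (hB' htI)).const_mul (1 / (8 * Real.pi)))
  refine hd.congr_deriv ?_
  have hρc := continuousOn_of_mem_Q 𝒯 (hsol.rho_mem t htI')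
  have hMc := hsol.continuousOn_mom htI'
  have hη := (projQ_spec 𝒯 (k := k + 1) (continuousOn_fluidPot (m := m) hc hρc hMc (hρ t htI'))).1
  have hw : ∀ i, (fun x => projQ3 𝒯 (k + 1) (fun x => fluidVel m c (ρ t x) (M t x)) x i)
      ∈ Q 𝒯 (k + 1) := fun i =>
    (projQ_spec 𝒯 (continuousOn_pi.1 (continuousOn_fluidVel (m := m) (c := c) hρc hMc
      (hρ t htI')) i)).1
  rw [hdens htI _ hη, hmom htI _ hw, hamp htI _ (hsol.elec_mem t htI'),
    hfar htI _ (hsol.mag_mem t htI')]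
  set w := projQ3 𝒯 (k + 1) fun x => fluidVel m c (ρ t x) (M t x)
  set η := projQ 𝒯 (k + 1) fun x => fluidPot m c (ρ t x) (M t x)
  -- With `μ = w` the two halves of the advection bracket coincide.
  have hadv : ∫ x in 𝒯.Ω, (advect 𝒯.Ω w w x - advect 𝒯.Ω w w x) ⬝ᵥ M t x = 0 := by simp
  have hpot : ∫ x in 𝒯.Ω, ρ t x * (w x ⬝ᵥ grad 𝒯.Ω η x) * c ^ 2
      = c ^ 2 * ∫ x in 𝒯.Ω, ρ t x * (w x ⬝ᵥ grad 𝒯.Ω η x) := by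
    rw [integral_mul_const, mul_comm]
  -- The magnetic force is orthogonal to the velocity; only electric work remains, here and in the
  -- particle sum below.
  have hlor : ∀ x, ρ t x * ((E t x + w x ⨯₃ (c⁻¹ • B t x)) ⬝ᵥ w x) = ρ t x * (w x ⬝ᵥ E t x) :=
    fun x => by
      rw [add_dotProduct, dotProduct_comm (w x ⨯₃ _) (w x), dot_self_cross, add_zero,
        dotProduct_comm]
  have hpart : ∑ p, wt p * m * c ^ 2 * (U t p ⬝ᵥ (e • (E t (X t p)
        + (c * m * gam m c (U t p))⁻¹ • (U t p ⨯₃ B t (X t p))))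
        / (m ^ 2 * c ^ 2 * gam m c (U t p)))
      = e / m * ∑ p, wt p / gam m c (U t p) * (U t p ⬝ᵥ E t (X t p)) := by
    rw [Finset.mul_sum]
    refine Finset.sum_congr rfl fun p _ => ?_
    have hγ := (gam_pos m c (U t p)).ne'
    rw [dotProduct_smul, dotProduct_add, dotProduct_smul, dot_self_cross, smul_zero, add_zero,
      smul_eq_mul]
    field_simp
  rw [hadv, hpot, hpart]
  simp only [hlor]
  -- What is left cancels in pairs: the `∇η` terms of continuity and momentum, the two curl terms,
  -- and the electric work on fluid and particles against the currents in Ampère's equation, where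
  -- the factor `2 / (8π)` meets `4π`.
  have hpi := Real.pi_ne_zero
  field_simp
  ring

end IsSolution

end Conservation

end

end ColdPlasma

theorem mainTheorem3 {ι : Type*} [Fintype ι] (𝒯 : ColdPlasma.Mesh ι) (k N : ℕ)
    (m c e : ℝ) (hm : 0 < m) (hc : 0 < c) (wt : Fin N → ℝ) (T : ℝ)
    (ρ : ℝ → ColdPlasma.Vec → ℝ) (M E B : ℝ → ColdPlasma.Vec → ColdPlasma.Vec)
    (X U : ℝ → Fin N → ColdPlasma.Vec)
    (hsol : ColdPlasma.IsSolution 𝒯 k N m c e wt T ρ M E B X U)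
    (hρ : ∀ t ∈ Set.Icc 0 T, ∀ x ∈ 𝒯.Ωh, ρ t x ≠ 0) :
    ∀ t ∈ Set.Icc 0 T,
      ColdPlasma.fluidMass 𝒯 (ρ t) = ColdPlasma.fluidMass 𝒯 (ρ 0) ∧
      (ColdPlasma.particleMass 𝒯 wt (X t) = ColdPlasma.particleMass 𝒯 wt (X 0) ∧
        ColdPlasma.particleMass 𝒯 wt (X t) = ∑ p, wt p) ∧
      ColdPlasma.energy 𝒯 m c wt (ρ t) (M t) (E t) (B t) (U t)
        = ColdPlasma.energy 𝒯 m c wt (ρ 0) (M 0) (E 0) (B 0) (U 0) ∧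
      (∀ φ ∈ ColdPlasma.Q₀ 𝒯 (k + 1),
        ColdPlasma.gauss 𝒯 (k + 1) m e wt (ρ t) (E t) (X t) φ
          = ColdPlasma.gauss 𝒯 (k + 1) m e wt (ρ 0) (E 0) (X 0) φ) ∧
      ColdPlasma.dvg 𝒯.Ω (B t) =ᵐ[MeasureTheory.volume.restrict 𝒯.Ω]
        ColdPlasma.dvg 𝒯.Ω (B 0) := by
  intro t ht
  have hT : 0 ≤ T := ht.1.trans ht.2
  refine ⟨hsol.fluidMass_eq hT t ht, ⟨?_, ?_⟩, hsol.energy_eq hm hc hT hρ t ht,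
    fun φ hφ => hsol.gauss_eq hm hc hT hφ t ht, hsol.dvg_ae_eq hT t ht⟩
  · rw [ColdPlasma.particleMass_eq_sum (hsol.pos_mem t ht),
      ColdPlasma.particleMass_eq_sum (hsol.pos_mem 0 (Set.left_mem_Icc.2 hT))]
  · exact ColdPlasma.particleMass_eq_sum (hsol.pos_mem t ht)
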